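/- **Setup.** Let $K\cong(\mathbb C^*)^r$ be a torus with cocharacter lattice $\mathbb L\cong\mathbb Z^r$, and let $D_1,\dots,D_m\in\mathbb L^\vee$ be characters. For $I\subset\{1,\dots,m\}$ put $\angle I=\{\sum_{i\in I}a_iD_i : a_i>0\}\subset\mathbb L^\vee\otimes\mathbb R$. For $\omega$ in the cone $\sum_i\mathbb R_{\ge0}D_i$ put $\mathscr A_\omega=\{I:\omega\in\angle I\}$, $C_\omega=\bigcap_{I\in\mathscr A_\omega}\angle I$, $U_\omega=\bigcup_{I\in\mathscr A_\omega}(\mathbb C^*)^I\times\mathbb C^{\overline I}$ (where $\overline I$ is the complement of $I$) and $X_\omega=[U_\omega/K]$. For $f\in\mathbb L\otimes\mathbb Q$ put $I_f=\{j:D_j\cdot f\in\mathbb Z\}$, and let $\mathbb K_\omega=\{f: I_f\in\mathscr A_\omega\}$. Then $H^*_{CR}(X_\omega)=\bigoplus_{f\in\mathbb K_\omega/\mathbb L}H^*(X^f_\omega;\mathbb C)$ with $X_\omega^f=[(U_\omega\cap\mathbb C^{I_f})/K]$. Each $H^*(X_\omega^f)$ is the quotient of $\mathrm{Sym}(\mathbb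 L^\vee\otimes\mathbb C)$ by the ideal generated by all $\prod_{j\in J}D_j$ with $J\subset I_f$, $I_f\setminus J\notin\mathscr A_\omega$. Let $\theta_\omega(p)$ denote the class of $p\in\mathbb L^\vee\otimes\mathbb Q$ in it, let $u_j=\theta_\omega(D_j)$, and let $\mathbb 1_f$ be the unit of $H^*(X^f_\omega)$. Let $\omega_\pm$ be stability conditions for which $C_\pm=C_{\omega_\pm}$ have maximal dimension and $X_\pm$ have proper coarse moduli space. Assume that $C_+$ and $C_-$ lie on opposite sides of a hyperplane $W$, and that $W\cap\overline{C_+}=W\cap\overline{C_-}$ has codimension one. Let $e\in\mathbb L$ be a primitive generator of $W^\perp$ that is positive on $C_+$, write $e_j=D_j\cdot e$, and assume $E:=\sum_je_j>0$. Let $p_1,\dots,p_r$ be a basis of the dual of the lattice generated by $\mathbb K_-=\mathbb K_{\omega_-}$, with all $p_i\in\overline{C_-}$ and $p_1,\dots,p_{r-1}\in W$. Then $p_r\cdot e<0$; put $s=-E/(p_r\cdot e)>0$. Write $\theta_-=\theta_{\omega_-}$. Let $z\in\mathbb C^*$. For $k\in\mathbb K_-$ let $$I_k=\prod_{j=1}^m\frac{\prod_{\langle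 a\rangle=\langle D_j\cdot k\rangle,\,a\le0}(u_j+az)}{\prod_{\langle a\rangle=\langle D_j\cdot k\rangle,\,a\le D_j\cdot k}(u_j+az)}\ \mathbb 1_{[-k]},$$ and let $\sigma=\sum_{i=1}^r\theta_-(p_i)\log\tilde y_i$, $\tilde y^k=\prod_i\tilde y_i^{p_i\cdot k}$. Put $$I^-=ze^{\sigma/z}\sum_{k\in\mathbb K_-}\tilde y^kI_k,\qquad I^-_{reg}=ze^{\sigma/z}\sum_{k\in\mathbb K_-}\frac{\tilde y^kI_k}{\Gamma\left(1+s\,(p_r\cdot k+\theta_-(p_r)/z)\right)}.$$ Functions of nilpotent classes are understood through their Taylor expansions. In $I^-_{reg}$ substitute $\tilde y_r=x^{s}$ (so $\log\tilde y_r=s\log x$). All series are formal in $\tilde y_1,\dots,\tilde y_{r-1}$: for $N\in\mathbb Z^{r-1}$ and $\lambda\in\mathbb C^{r-1}$, the coefficient of $\prod_{i<r}\tilde y_i^{N_i}$, with $\log\tilde y_i$ replaced by $\lambda_i$ for $i<r$, is the sum over those $k\in\mathbb K_-$ with $p_i\cdot k=N_i$ for all $i<r$. All logarithms are principal. **Proposition.**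 There is $\delta$ with $0<\delta\le\min(\pi/2,\pi/E)$, independent of $N$ and $\lambda$, which can be taken equal to $\min(\pi/2,\pi/E)$ if $z$ is a positive real number, such that for all $N\in\mathbb Z^{r-1}$ and $\lambda\in\mathbb C^{r-1}$ the following holds. 1. For every integer $M\ge 0$, only finitely many $k\in\mathbb K_-$ with $p_i\cdot k=N_i$ $(i<r)$ and $p_r\cdot k\le M$ have $I_k\ne0$. 2. The coefficient of $I^-_{reg}$ converges for all small $x$ in the sector $0<\arg x<\delta$, and continues analytically to a function $F(x)\in H^*_{CR}(X_-)$ on that sector. 3. There is a function $\mathbb I(u)\in H^*_{CR}(X_-)$, defined for $|\arg u|<\pi/2$, with $$\mathbb I(u)=u\int_0^{\infty}e^{-ux}F(x)\,dx$$ along every ray $\arg x=\alpha$ with $0<\alpha<\delta$ and $\mathrm{Re}(ux)>0$. These integrals converge absolutely, and their value does not depend on $\alpha$. 4. $\mathbb I$ has asymptotic expansion $I^-|_{\tilde y_r=u^{-s}}=I^-|_{\tilde y_r=u^{E/(p_r\cdot e)}}$ as $u\to\infty$ along any ray with $|\arg u|<\pi/2$. That is, for every integer $M\ge0$, $$\mathbb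 I(u)-\sum_{\substack{k\in\mathbb K_-,\ p_i\cdot k=N_i\,(i<r)\\ p_r\cdot k\le M}}z\,\exp\Big(\frac1z\sum_{i<r}\lambda_i\theta_-(p_i)-\frac{s\log u}{z}\theta_-(p_r)\Big)\,u^{-s\,(p_r\cdot k)}I_k=o\left(|u|^{-sM}\right).$$ -/

import Mathlib

/-!
Toric wall crossing, Chen–Ruan cohomology of toric stacks, the `I`-function, its regularization,
the Laplace transform, and asymptotic expansions.

Throughout, `K = (ℂˣ)^(n+1)` is a torus of rank `r = n + 1`.  The cocharacter lattice `𝕃` and the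
character lattice `𝕃^∨` are both identified with `ℤ^r`, the pairing being the dot product, so
`𝕃 ⊗ ℚ = ℚ^r` and `𝕃^∨ ⊗ ℝ = ℝ^r`.  The characters are `D 0, …, D (m-1)`.
-/

noncomputable section

namespace ToricWall

open Filter Topology

variable {n m : ℕ}

/-! ### Stability conditions, chambers and the GIT quotient -/

/-- The pairing `𝕃^∨ × (𝕃 ⊗ ℚ) → ℚ` of an integral character with a rational cocharacter. -/
def pairZ (χ : Fin (n + 1) → ℤ) (f : Fin (n + 1) → ℚ) : ℚ := ∑ i, (χ i : ℚ) * f i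

/-- The pairing `(𝕃^∨ ⊗ ℝ) × 𝕃 → ℝ`. -/
def pairR (v : Fin (n + 1) → ℝ) (e : Fin (n + 1) → ℤ) : ℝ := ∑ i, v i * (e i : ℝ)

/-- The cone `∠I` of combinations of the `D i`, `i ∈ I`, with positive coefficients. -/
def angle (D : Fin m → Fin (n + 1) → ℤ) (I : Set (Fin m)) : Set (Fin (n + 1) → ℝ) :=
  {v | ∃ a : Fin m → ℝ, (∀ j ∈ I, 0 < a j) ∧ (∀ j, j ∉ I → a j = 0) ∧
    ∀ i, v i = ∑ j, a j * (D j i : ℝ)}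

/-- The set `𝒜_ω` of all `I` with `ω ∈ ∠I`. -/
def anticones (D : Fin m → Fin (n + 1) → ℤ) (ω : Fin (n + 1) → ℝ) : Set (Set (Fin m)) :=
  {I | ω ∈ angle D I}

/-- `C_ω`, the intersection of the cones `∠I` over `I ∈ 𝒜_ω`. -/
def chamber (D : Fin m → Fin (n + 1) → ℤ) (ω : Fin (n + 1) → ℝ) : Set (Fin (n + 1) → ℝ) :=
  {v | ∀ I ∈ anticones D ω, v ∈ angle D I}

/-- The semistable locus `U_ω ⊆ ℂ^m`. -/
def semistable (D : Fin m → Fin (n + 1) → ℤ) (ω : Fin (n + 1) → ℝ) : Set (Fin m → ℂ) :=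
  {x | ∃ I ∈ anticones D ω, ∀ j ∈ I, x j ≠ 0}

/-- The value of the character `χ` at the point `t` of the torus `K`. -/
def charVal (χ : Fin (n + 1) → ℤ) (t : Fin (n + 1) → ℂˣ) : ℂˣ := ∏ i, t i ^ χ i

/-- The relation "same `K`-orbit" on `U_ω`. -/
def orbitRel (D : Fin m → Fin (n + 1) → ℤ) (ω : Fin (n + 1) → ℝ) :
    Setoid (semistable D ω) where
  r x y := ∃ t : Fin (n + 1) → ℂˣ, ∀ j, y.1 j = (charVal (D j) t : ℂ) * x.1 j
  iseqv :=
    { refl := fun x => ⟨1, fun j => by simp [charVal]⟩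
      symm := by
        rintro x y ⟨t, ht⟩
        refine ⟨t⁻¹, fun j => ?_⟩
        have h : charVal (D j) t⁻¹ = (charVal (D j) t)⁻¹ := by simp [charVal]
        rw [ht j, h, ← mul_assoc, Units.inv_mul, one_mul]
      trans := by
        rintro x y w ⟨t, ht⟩ ⟨t', ht'⟩
        refine ⟨t' * t, fun j => ?_⟩
        have h : charVal (D j) (t' * t) = charVal (D j) t' * charVal (D j) t := by
          simp [charVal, mul_zpow, Finset.prod_mul_distrib]
        rw [ht' j, ht j, h, Units.val_mul, mul_assoc] }

/-- The (analytic) coarse moduli space `U_ω / K` of `X_ω = [U_ω / K]`, with its quotient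
topology. -/
abbrev CoarseSpace (D : Fin m → Fin (n + 1) → ℤ) (ω : Fin (n + 1) → ℝ) : Type :=
  Quotient (orbitRel D ω)

/-- The standing assumptions on a stability condition: it lies in the cone spanned by the
characters, its chamber has maximal dimension, and the coarse moduli space is proper. -/
structure IsStability (D : Fin m → Fin (n + 1) → ℤ) (ω : Fin (n + 1) → ℝ) : Prop where
  mem_cone : ∃ a : Fin m → ℝ, (∀ j, 0 ≤ a j) ∧ ∀ i, ω i = ∑ j, a j * (D j i : ℝ)
  maximal : (interior (chamber D ω)).Nonempty
  proper : CompactSpace (CoarseSpace D ω)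

/-- The hyperplane `W = e^⊥` in `𝕃^∨ ⊗ ℝ`. -/
def hyperplane (e : Fin (n + 1) → ℤ) : Set (Fin (n + 1) → ℝ) := {v | pairR v e = 0}

/-- The integer `∑_j D_j · e`. -/
def degSum (D : Fin m → Fin (n + 1) → ℤ) (e : Fin (n + 1) → ℤ) : ℤ := ∑ j, ∑ i, D j i * e i

/-- The wall-crossing setup: `C_+` and `C_-` are chambers on the two sides of the hyperplane
`W = e^⊥`, with a common wall `W ∩ closure C_+ = W ∩ closure C_-` of codimension one; `e` is a
primitive lattice vector, positive on `C_+`, with `∑_j D_j · e > 0`. -/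
structure IsWallCrossing (D : Fin m → Fin (n + 1) → ℤ) (ωp ωm : Fin (n + 1) → ℝ)
    (e : Fin (n + 1) → ℤ) : Prop where
  stab_plus : IsStability D ωp
  stab_minus : IsStability D ωm
  primitive : ∀ (a : ℤ) (e' : Fin (n + 1) → ℤ), e = a • e' → IsUnit a
  pos_plus : ∀ v ∈ chamber D ωp, 0 < pairR v e
  neg_minus : ∀ v ∈ chamber D ωm, pairR v e < 0
  common_wall : hyperplane e ∩ closure (chamber D ωp) = hyperplane e ∩ closure (chamber D ωm)
  codim_one : (Submodule.span ℝ (hyperplane e ∩ closure (chamber D ωp)) :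
    Set (Fin (n + 1) → ℝ)) = hyperplane e
  degSum_pos : 0 < degSum D e

/-! ### The set `𝕂_ω`, the dual lattice, and Chen–Ruan cohomology -/

/-- `I_f`, the set of `j` with `D_j · f ∈ ℤ`. -/
def intIndex (D : Fin m → Fin (n + 1) → ℤ) (f : Fin (n + 1) → ℚ) : Set (Fin m) :=
  {j | ∃ a : ℤ, pairZ (D j) f = a}

/-- The set `𝕂_ω ⊆ 𝕃 ⊗ ℚ`. -/
def boxSet (D : Fin m → Fin (n + 1) → ℤ) (ω : Fin (n + 1) → ℝ) : Set (Fin (n + 1) → ℚ) :=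
  {f | intIndex D f ∈ anticones D ω}

/-- The pairing `(𝕃^∨ ⊗ ℚ) × (𝕃 ⊗ ℚ) → ℚ`. -/
def pairQ (q k : Fin (n + 1) → ℚ) : ℚ := ∑ i, q i * k i

/-- The dual of the lattice generated by `𝕂_ω`: all `q ∈ 𝕃^∨ ⊗ ℚ` that are integral
on `𝕂_ω`. -/
def dualLattice (D : Fin m → Fin (n + 1) → ℤ) (ω : Fin (n + 1) → ℝ) :
    AddSubgroup (Fin (n + 1) → ℚ) where
  carrier := {q | ∀ k ∈ boxSet D ω, ∃ a : ℤ, pairQ q k = a}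
  zero_mem' := fun k _ => ⟨0, by simp [pairQ]⟩
  add_mem' := by
    intro q q' h h' k hk
    obtain ⟨a, ha⟩ := h k hk
    obtain ⟨b, hb⟩ := h' k hk
    refine ⟨a + b, ?_⟩
    push_cast
    rw [← ha, ← hb]
    simp [pairQ, add_mul, Finset.sum_add_distrib]
  neg_mem' := by
    intro q h k hk
    obtain ⟨a, ha⟩ := h k hk
    refine ⟨-a, ?_⟩
    push_cast
    rw [← ha]
    simp [pairQ]

/-- The lattice `𝕃` inside `𝕃 ⊗ ℚ`. -/
def latticeL (n : ℕ) : AddSubgroup (Fin (n + 1) → ℚ) :=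
  ((Int.castAddHom ℚ).compLeft (Fin (n + 1))).range

/-- `I_f` as a function of the class `c` of `f` in `(𝕃 ⊗ ℚ) / 𝕃`. -/
def classIndex (D : Fin m → Fin (n + 1) → ℤ) (c : (Fin (n + 1) → ℚ) ⧸ latticeL n) :
    Set (Fin m) :=
  {j | ∃ f : Fin (n + 1) → ℚ, QuotientAddGroup.mk f = c ∧ j ∈ intIndex D f}

theorem classIndex_mk (D : Fin m → Fin (n + 1) → ℤ) (f : Fin (n + 1) → ℚ) :
    classIndex D (QuotientAddGroup.mk f) = intIndex D f := by
  ext j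
  constructor
  · rintro ⟨g, hg, a, ha⟩
    rw [QuotientAddGroup.eq] at hg
    obtain ⟨l, hl⟩ := hg
    refine ⟨a + ∑ i, D j i * l i, ?_⟩
    have hf : ∀ i, f i = g i + (l i : ℚ) := by
      intro i
      have h := congrFun hl i
      simp at h
      linarith
    push_cast
    rw [← ha]
    simp only [pairZ, hf, mul_add, Finset.sum_add_distrib]
  · intro h
    exact ⟨f, rfl, h⟩

theorem intIndex_neg (D : Fin m → Fin (n + 1) → ℤ) (f : Fin (n + 1) → ℚ) :
    intIndex D (-f) = intIndex D f := by
  have key : ∀ g : Fin (n + 1) → ℚ, ∀ j, j ∈ intIndex D g → j ∈ intIndex D (-g) := by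
    rintro g j ⟨a, ha⟩
    refine ⟨-a, ?_⟩
    push_cast
    rw [← ha]
    simp [pairZ]
  ext j
  exact ⟨fun h => by simpa using key (-f) j h, key f j⟩

/-- The index set `𝕂_ω / 𝕃` of the components of the inertia stack `IX_ω`. -/
abbrev Sector (D : Fin m → Fin (n + 1) → ℤ) (ω : Fin (n + 1) → ℝ) : Type :=
  {c : (Fin (n + 1) → ℚ) ⧸ latticeL n // classIndex D c ∈ anticones D ω}

/-- The class `[-k]` of an element `k ∈ 𝕂_ω`. -/
def negSector (D : Fin m → Fin (n + 1) → ℤ) (ω : Fin (n + 1) → ℝ) (k : boxSet D ω) :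
    Sector D ω :=
  ⟨QuotientAddGroup.mk (-k.1), by
    rw [classIndex_mk, intIndex_neg]
    exact k.2⟩

/-- The linear form on `𝕃 ⊗ ℂ` given by `q ∈ 𝕃^∨ ⊗ ℚ`, as an element of
`H^*_K(pt) = Sym(𝕃^∨ ⊗ ℂ) = ℂ[X_0, …, X_n]`. -/
def linForm (q : Fin (n + 1) → ℚ) : MvPolynomial (Fin (n + 1)) ℂ :=
  ∑ i, MvPolynomial.C (q i : ℂ) * MvPolynomial.X i

/-- The character `χ ∈ 𝕃^∨` in `𝕃^∨ ⊗ ℚ`. -/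
def ratChar (χ : Fin (n + 1) → ℤ) : Fin (n + 1) → ℚ := fun i => (χ i : ℚ)

/-- The Stanley–Reisner ideal of the component `X_ω^c = [U_ω ∩ ℂ^{I_c} / K]`: the divisors
`{z_j = 0}`, `j ∈ J ⊆ I_c`, have empty intersection in it iff `I_c ∖ J ∉ 𝒜_ω`. -/
def srIdeal (D : Fin m → Fin (n + 1) → ℤ) (ω : Fin (n + 1) → ℝ)
    (c : (Fin (n + 1) → ℚ) ⧸ latticeL n) : Ideal (MvPolynomial (Fin (n + 1)) ℂ) :=
  Ideal.span {q | ∃ J : Finset (Fin m), (J : Set (Fin m)) ⊆ classIndex D c ∧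
    classIndex D c \ (J : Set (Fin m)) ∉ anticones D ω ∧ q = ∏ j ∈ J, linForm (ratChar (D j))}

/-- The cohomology ring `H^*(X_ω^c; ℂ)` of a component of the inertia stack, in its standard
presentation `Sym(𝕃^∨ ⊗ ℂ) / (Stanley–Reisner relations)`.  Equivalently it is
`ℂ[u_1, …, u_m]` modulo the linear relations among the characters `D_j` and the
Stanley–Reisner relations. -/
abbrev SectorCoh (D : Fin m → Fin (n + 1) → ℤ) (ω : Fin (n + 1) → ℝ) (c : Sector D ω) : Type :=
  MvPolynomial (Fin (n + 1)) ℂ ⧸ srIdeal D ω c.1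

/-- The Chen–Ruan cohomology `H^*_CR(X_ω) = ⨁_{c ∈ 𝕂_ω/𝕃} H^*(X_ω^c)`. -/
abbrev ChenRuan (D : Fin m → Fin (n + 1) → ℤ) (ω : Fin (n + 1) → ℝ) : Type :=
  DirectSum (Sector D ω) (fun c => SectorCoh D ω c)

open Classical in
/-- The inclusion of the summand `H^*(X_ω^c)`, that is `a ↦ a 𝟙_c`. -/
def inSector (D : Fin m → Fin (n + 1) → ℤ) (ω : Fin (n + 1) → ℝ) (c : Sector D ω) :
    SectorCoh D ω c →ₗ[ℂ] ChenRuan D ω :=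
  DirectSum.lof ℂ (Sector D ω) (fun c => SectorCoh D ω c) c

/-- The map `θ_ω : 𝕃^∨ ⊗ ℚ → H^2`, restricted to the component `X_ω^c`; it sends `D_j`
to `u_j`. -/
def theta (D : Fin m → Fin (n + 1) → ℤ) (ω : Fin (n + 1) → ℝ) (c : Sector D ω)
    (q : Fin (n + 1) → ℚ) : SectorCoh D ω c :=
  Ideal.Quotient.mk (srIdeal D ω c.1) (linForm q)

/-! ### The `I`-function and its regularization -/

/-- The value `g(w + a)` of an entire function `g` at `w` plus a nilpotent element `a`,
by Taylor expansion at `w`. -/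
def nilEval {A : Type*} [CommRing A] [Algebra ℂ A] (g : ℂ → ℂ) (w : ℂ) (a : A) : A :=
  ∑ i ∈ Finset.range (nilpotencyClass a), (iteratedDeriv i g w / (Nat.factorial i : ℂ)) • a ^ i

/-- The hypergeometric factor
`∏_{⟨a⟩ = ⟨q⟩, a ≤ 0} (u + a z) / ∏_{⟨a⟩ = ⟨q⟩, a ≤ q} (u + a z)` after cancellation: the
factors with `q < a ≤ 0` (here `a = q + l + 1`) remain in the numerator, those with `0 < a ≤ q`
(here `a = q - l`) in the denominator. -/
def hyperFactor {A : Type*} [CommRing A] [Algebra ℂ A] (u : A) (z : ℂ) (q : ℚ) : A :=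
  (∏ l ∈ Finset.range ⌊-q⌋₊, (u + algebraMap ℂ A (((q : ℂ) + l + 1) * z))) *
    Ring.inverse (∏ l ∈ Finset.range ⌈q⌉₊, (u + algebraMap ℂ A (((q : ℂ) - l) * z)))

/-- The class `I_k`, as an element of `H^*(X_ω^{[-k]})`. -/
def coeffI (D : Fin m → Fin (n + 1) → ℤ) (ω : Fin (n + 1) → ℝ) (z : ℂ) (k : boxSet D ω) :
    SectorCoh D ω (negSector D ω k) :=
  ∏ j, hyperFactor (theta D ω (negSector D ω k) (ratChar (D j))) z (pairZ (D j) k.1)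

/-- The term `z e^{σ/z} ỹ_r^{p_r · k} I_k` of the `I`-function, where
`σ = ∑_i θ(p_i) log ỹ_i`, with `log ỹ_i = lam i` for `i < r` and `log ỹ_r = τ`.  The formal
monomial `∏_{i < r} ỹ_i^{p_i · k}`, of which this is a contribution to the coefficient, is
left out. -/
def termI (D : Fin m → Fin (n + 1) → ℤ) (ω : Fin (n + 1) → ℝ)
    (p : Fin (n + 1) → Fin (n + 1) → ℚ) (z : ℂ) (lam : Fin n → ℂ) (τ : ℂ) (k : boxSet D ω) :
    SectorCoh D ω (negSector D ω k) :=
  z • (nilEval Complex.exp ((pairQ (p (Fin.last n)) k.1 : ℂ) * τ)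
      (z⁻¹ • ((∑ i : Fin n, lam i • theta D ω (negSector D ω k) (p i.castSucc)) +
        τ • theta D ω (negSector D ω k) (p (Fin.last n)))) *
    coeffI D ω z k)

/-- The positive rational number `s = - (∑_j D_j · e) / (p_r · e)`. -/
def slope (D : Fin m → Fin (n + 1) → ℤ) (p : Fin (n + 1) → Fin (n + 1) → ℚ)
    (e : Fin (n + 1) → ℤ) : ℚ :=
  -(degSum D e : ℚ) / pairQ (p (Fin.last n)) (ratChar e)

/-- The corresponding term of the regularized `I`-function: `termI` divided by
`Γ(1 + s (p_r · k + θ(p_r) / z))`. -/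
def termReg (D : Fin m → Fin (n + 1) → ℤ) (ω : Fin (n + 1) → ℝ)
    (p : Fin (n + 1) → Fin (n + 1) → ℚ) (e : Fin (n + 1) → ℤ) (z : ℂ) (lam : Fin n → ℂ) (τ : ℂ)
    (k : boxSet D ω) : SectorCoh D ω (negSector D ω k) :=
  nilEval (fun w => (Complex.Gamma w)⁻¹)
      (1 + (slope D p e : ℂ) * (pairQ (p (Fin.last n)) k.1 : ℂ))
      (((slope D p e : ℂ) / z) • theta D ω (negSector D ω k) (p (Fin.last n))) *
    termI D ω p z lam τ k

/-- The degrees `k ∈ 𝕂_ω` that contribute to the coefficient of `∏_{i < r} ỹ_i^{N_i}`. -/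
def fiber (D : Fin m → Fin (n + 1) → ℤ) (ω : Fin (n + 1) → ℝ)
    (p : Fin (n + 1) → Fin (n + 1) → ℚ) (N : Fin n → ℤ) : Set (boxSet D ω) :=
  {k | ∀ i : Fin n, pairQ (p i.castSucc) k.1 = N i}

/-- The degrees in `fiber` whose exponent `p_r · k` of `ỹ_r` is at most `M`. -/
def fiberLE (D : Fin m → Fin (n + 1) → ℤ) (ω : Fin (n + 1) → ℝ)
    (p : Fin (n + 1) → Fin (n + 1) → ℚ) (N : Fin n → ℤ) (M : ℕ) : Set (boxSet D ω) :=
  {k | k ∈ fiber D ω p N ∧ pairQ (p (Fin.last n)) k.1 ≤ M}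

/-- The partial sum, over the powers of `ỹ_r` of exponent at most `M`, of the coefficient of
`∏_{i < r} ỹ_i^{N_i}` in the `I`-function, where `log ỹ_i = lam i` and `log ỹ_r = τ`. -/
def partialI (D : Fin m → Fin (n + 1) → ℤ) (ω : Fin (n + 1) → ℝ)
    (p : Fin (n + 1) → Fin (n + 1) → ℚ) (z : ℂ) (N : Fin n → ℤ) (lam : Fin n → ℂ) (M : ℕ)
    (τ : ℂ) : ChenRuan D ω :=
  ∑ᶠ k ∈ fiberLE D ω p N M, inSector D ω (negSector D ω k) (termI D ω p z lam τ k)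

/-! ### Analytic continuation, Laplace transform, asymptotic expansion

A function with values in the finite-dimensional space `ChenRuan D ω` is analytic, integrable,
small, …, iff its composition with every linear functional is. -/

/-- The open sector `0 < arg x < δ`. -/
def sector (δ : ℝ) : Set ℂ := {x | 0 < x.arg ∧ x.arg < δ}

/-- `F` is the coefficient of `∏_{i < r} ỹ_i^{N_i}` in the regularized `I`-function, as a function
of `x`, where `log ỹ_r = s log x`: it is the sum of the defining series near `0`, and analytic on
the sector `0 < arg x < δ`. -/
def IsRegularized (D : Fin m → Fin (n + 1) → ℤ) (ω : Fin (n + 1) → ℝ)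
    (p : Fin (n + 1) → Fin (n + 1) → ℚ) (e : Fin (n + 1) → ℤ) (z : ℂ) (N : Fin n → ℤ)
    (lam : Fin n → ℂ) (δ : ℝ) (F : ℂ → ChenRuan D ω) : Prop :=
  (∀ φ : ChenRuan D ω →ₗ[ℂ] ℂ, AnalyticOnNhd ℂ (fun x => φ (F x)) (sector δ)) ∧
  ∃ R : ℝ, 0 < R ∧ ∀ x ∈ sector δ, ‖x‖ < R → ∀ φ : ChenRuan D ω →ₗ[ℂ] ℂ,
    HasSum (fun k : fiber D ω p N => φ (inSector D ω (negSector D ω k.1)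
      (termReg D ω p e z lam ((slope D p e : ℂ) * Complex.log x) k.1))) (φ (F x))

/-- `G(u) = u ∫ e^{-ux} F(x) dx` for all `u` with `|arg u| < π/2`, where the integral is taken
along any ray `arg x = α` with `0 < α < δ` and `Re (u x) > 0`; it converges absolutely, and its
value does not depend on `α`. -/
def IsLaplace {V : Type*} [AddCommGroup V] [Module ℂ V] (δ : ℝ) (F G : ℂ → V) : Prop :=
  ∀ (u : ℂ) (α : ℝ), |u.arg| < Real.pi / 2 → 0 < α → α < δ →
    0 < (u * Complex.exp (α * Complex.I)).re → ∀ φ : V →ₗ[ℂ] ℂ,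
    MeasureTheory.IntegrableOn (fun t : ℝ =>
      Complex.exp (-(u * (t * Complex.exp (α * Complex.I)))) *
        φ (F (t * Complex.exp (α * Complex.I)))) (Set.Ioi 0) ∧
    φ (G u) = u * ∫ t : ℝ in Set.Ioi 0,
      Complex.exp (-(u * (t * Complex.exp (α * Complex.I)))) *
        φ (F (t * Complex.exp (α * Complex.I))) * Complex.exp (α * Complex.I)

/-- `G(u)` has the asymptotic expansion given by the partial sums `S M u`, up to order
`u^{-sM}`, as `u → ∞` along the ray `arg u = β`. -/
def HasExpansionAlong {V : Type*} [AddCommGroup V] [Module ℂ V] (s : ℝ) (G : ℂ → V)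
    (S : ℕ → ℂ → V) (β : ℝ) : Prop :=
  ∀ (M : ℕ) (φ : V →ₗ[ℂ] ℂ),
    (fun t : ℝ => φ (G (t * Complex.exp (β * Complex.I)) - S M (t * Complex.exp (β * Complex.I))))
      =o[atTop] fun t : ℝ => t ^ (-(s * M))

end ToricWall

end

/-!
The coefficient of the regularized `I`-function splits according to the residue class of `p_r · k`
modulo translation of `k` by the wall direction `e`.  All degrees `k₀ - l e` of such a class live
in the same sector, whose cohomology ring `A` is finite-dimensional with nilpotent divisor classes
(the Stanley–Reisner relations have only the trivial common zero, as the chamber has maximal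
dimension: `isNilpotent_theta`, `finite_sectorCoh`).  Only `l ≥ 0` contributes, since `I_k ≠ 0`
forces `k` to be nonnegative on the closed chamber (`pairQ_nonneg_of_coeffI_ne_zero`), and
`p_1, …, p_r` are coordinates on the degrees, so there are finitely many classes.

The class of `k₀` contributes `x^{σ + a} b ∑_l a_l x^{E l}` with nilpotent `a`, where
`a_l` is the product of `1 / Γ(1 + σ + l E + a)` with the hypergeometric factors.  The functional
equations of `Γ` and of the hypergeometric factors give a recursion
`Q(l + 1) a_{l+1} = c P(l) a_l` with monic polynomials `P`, `Q` of the *same* degree over `A`: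
the `E` linear factors by which the degrees of the hypergeometric factors differ are exactly those
supplied by the Gamma function (`exists_recursion`).  Hence the sum solves, in the variable
`η = E log x`, a linear differential equation which is singular only where `c e^η = 1`.  On a strip
of `η`-values where `c e^η` is never real it therefore continues analytically, and it grows at
most exponentially in `η` by Grönwall's inequality, because the coefficients of the equation are
bounded there.  Together with the convergence of the series for `Re η → -∞` this bounds the
difference from every partial sum on the whole strip (`exists_continuation`).
The number `c` is real when `z` is, so that the only singular rays have `E arg x ∈ ℤπ`, and then the
full sector `0 < arg x < min(π/2, π/E)` is available; otherwise a smaller sector avoids them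
(`exists_sector_avoiding`).

Exponential growth in `log x` is polynomial growth in `x`, so the Laplace integral converges along
rays, and its value is independent of the ray by Cauchy's theorem (`exists_isLaplace`).  The Laplace
transform of a single regularized term `x^{σ + a} / Γ(1 + σ + a)` is `u^{-σ - a}`
(`isLaplace_term`), that is, the corresponding term of the unregularized `I`-function; Watson's
lemma (`hasExpansionAlong_of_isLaplace`) turns the remainders at `x = 0` into the asymptotic
expansion at `u = ∞`.
-/

noncomputable section

namespace ToricWall

open Filter Topology MeasureTheory

/-! ### Linear differential equations on convex domains -/

section ODE

variable {V : Type*} [NormedAddCommGroup V] [NormedSpace ℂ V]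

theorem hasDerivAt_segment (η₀ η : ℂ) (t : ℝ) :
    HasDerivAt (fun t : ℝ => η₀ + t * (η - η₀)) (η - η₀) t := by
  simpa using (((Complex.ofRealCLM.hasDerivAt (x := t)).mul_const (η - η₀)).const_add η₀)

theorem add_mul_sub_mem {K : Set ℂ} (hK : Convex ℝ K) {η₀ η : ℂ} (h₀ : η₀ ∈ K) (h : η ∈ K)
    {t : ℝ} (ht : t ∈ Set.Icc (0 : ℝ) 1) : η₀ + t * (η - η₀) ∈ K := by
  have := hK.add_smul_sub_mem h₀ h ht
  simpa using this

/-- Grönwall's inequality along segments. -/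
theorem norm_le_exp_of_linear_ode {K : Set ℂ} (hK : Convex ℝ K) {M : ℂ → V →L[ℂ] V} {Y : ℂ → V}
    (hY : ∀ η ∈ K, HasDerivAt Y (M η (Y η)) η) {C : ℝ} (hC : ∀ η ∈ K, ‖M η‖ ≤ C)
    {η₀ η : ℂ} (h₀ : η₀ ∈ K) (h : η ∈ K) :
    ‖Y η‖ ≤ ‖Y η₀‖ * Real.exp (C * ‖η - η₀‖) := by
  have hd : ∀ t ∈ Set.Icc (0 : ℝ) 1, HasDerivAt (fun t : ℝ => Y (η₀ + t * (η - η₀)))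
      ((η - η₀) • M (η₀ + t * (η - η₀)) (Y (η₀ + t * (η - η₀)))) t := fun t ht =>
    (hY _ (add_mul_sub_mem hK h₀ h ht)).scomp t (hasDerivAt_segment η₀ η t)
  have := norm_le_gronwallBound_of_norm_deriv_right_le
    (f := fun t : ℝ => Y (η₀ + t * (η - η₀))) (δ := ‖Y η₀‖) (K := C * ‖η - η₀‖) (ε := 0)
    (a := 0) (b := 1) (fun t ht => (hd t ht).continuousAt.continuousWithinAt)
    (fun t ht => (hd t ⟨ht.1, ht.2.le⟩).hasDerivWithinAt) (by simp)
    (fun t ht => by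
      rw [norm_smul, add_zero, mul_comm C, mul_assoc]
      gcongr
      exact (M _).le_of_opNorm_le (hC _ (add_mul_sub_mem hK h₀ h ⟨ht.1, ht.2.le⟩)) _)
    1 (by simp)
  simpa [gronwallBound_ε0] using this

/-- The successive approximations of Picard's method for `Y' = M Y`: the `k`-th term is bounded
by `‖v‖ (C |η - η₀|)^k / k!`. -/
theorem norm_picard_le {K : Set ℂ} (hK : Convex ℝ K) {M : ℂ → V →L[ℂ] V} {Y : ℕ → ℂ → V}
    {v : V} (hY0 : ∀ η, Y 0 η = v)
    (hY : ∀ k, ∀ η ∈ K, HasDerivAt (Y (k + 1)) (M η (Y k η)) η) {C : ℝ}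
    (hC : ∀ η ∈ K, ‖M η‖ ≤ C) {η₀ : ℂ} (h₀ : η₀ ∈ K) (hv : ∀ k, Y (k + 1) η₀ = 0) (k : ℕ) :
    ∀ η ∈ K, ‖Y k η‖ ≤ ‖v‖ * ((C * ‖η - η₀‖) ^ k / k.factorial) := by
  induction k with
  | zero => intro η _; simp [hY0]
  | succ k ih =>
    intro η h
    have hC0 : 0 ≤ C := (norm_nonneg _).trans (hC _ h₀)
    have hd : ∀ t ∈ Set.Icc (0 : ℝ) 1, HasDerivAt (fun t : ℝ => Y (k + 1) (η₀ + t * (η - η₀)))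
        ((η - η₀) • M (η₀ + t * (η - η₀)) (Y k (η₀ + t * (η - η₀)))) t := fun t ht =>
      (hY k _ (add_mul_sub_mem hK h₀ h ht)).scomp t (hasDerivAt_segment η₀ η t)
    set r := C * ‖η - η₀‖ with hr
    have hB : ∀ t : ℝ, HasDerivAt (fun t : ℝ => ‖v‖ * ((r * t) ^ (k + 1) / (k + 1).factorial))
        (‖v‖ * (r * ((r * t) ^ k / k.factorial))) t := by
      intro t
      have h1 := ((((hasDerivAt_id t).const_mul r).pow (k + 1)).div_const
        ((k + 1).factorial : ℝ)).const_mul ‖v‖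
      have h2 : ‖v‖ * (r * ((r * t) ^ k / k.factorial)) = ‖v‖ * (((k + 1 : ℕ) : ℝ) *
          (r * id t) ^ (k + 1 - 1) * (r * 1) / ((k + 1).factorial : ℝ)) := by
        rw [Nat.factorial_succ, Nat.cast_mul, Nat.add_sub_cancel, id]
        field_simp
      rw [h2]
      exact h1
    have := image_norm_le_of_norm_deriv_right_le_deriv_boundary
      (f := fun t : ℝ => Y (k + 1) (η₀ + t * (η - η₀)))
      (a := 0) (b := 1) (fun t ht => (hd t ht).continuousAt.continuousWithinAt)
      (fun t ht => (hd t ⟨ht.1, ht.2.le⟩).hasDerivWithinAt)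
      (B := fun t : ℝ => ‖v‖ * ((r * t) ^ (k + 1) / (k + 1).factorial)) (by simp [hv]) hB
      (fun t ht => by
        have hm := add_mul_sub_mem hK h₀ h (t := t) ⟨ht.1, ht.2.le⟩
        have h1 := ih _ hm
        have h2 : C * ‖η₀ + t * (η - η₀) - η₀‖ = r * t := by
          rw [add_sub_cancel_left, norm_mul, Complex.norm_real, Real.norm_of_nonneg ht.1, hr]
          ring
        rw [h2] at h1
        rw [norm_smul]
        calc ‖η - η₀‖ * ‖M (η₀ + t * (η - η₀)) (Y k (η₀ + t * (η - η₀)))‖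
            ≤ ‖η - η₀‖ * (C * (‖v‖ * ((r * t) ^ k / k.factorial))) := by
              gcongr
              exact ((M _).le_of_opNorm_le (hC _ hm) _).trans (by gcongr)
          _ = _ := by rw [hr]; ring)
      (x := 1) (by simp)
    simpa using this

/-- Existence of global solutions of a holomorphic linear differential equation on an open convex
set, by Picard's method.  The primitives are those of holomorphic functions on convex sets. -/
theorem exists_linear_ode_solution [CompleteSpace V] {U : Set ℂ} (hU : IsOpen U)
    (hcv : Convex ℝ U) {M : ℂ → V →L[ℂ] V} (hM : DifferentiableOn ℂ M U) {η₀ : ℂ}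
    (h₀ : η₀ ∈ U) (v : V)
    (hb : ∀ η ∈ U, ∃ K : Set ℂ, ∃ C : ℝ, IsOpen K ∧ Convex ℝ K ∧ K ⊆ U ∧ η₀ ∈ K ∧ η ∈ K ∧
      ∀ x ∈ K, ‖M x‖ ≤ C) :
    ∃ Y : ℂ → V, Y η₀ = v ∧ ∀ η ∈ U, HasDerivAt Y (M η (Y η)) η := by
  have hprim : ∀ f : ℂ → V, DifferentiableOn ℂ f U → ∃ g : ℂ → V, g η₀ = 0 ∧
      ∀ η ∈ U, HasDerivAt g (M η (f η)) η := by
    intro f hf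
    obtain ⟨g, hg⟩ := hcv.exists_forall_hasDerivWithinAt (hM.clm_apply hf)
    refine ⟨fun η => g η - g η₀, by simp, fun η hη => ?_⟩
    exact ((hg η hη).hasDerivAt (hU.mem_nhds hη)).sub_const _
  choose! G hG0 hG using hprim
  obtain ⟨Y, hY0, hYG⟩ : ∃ Y : ℕ → ℂ → V, (∀ η, Y 0 η = v) ∧ ∀ k, Y (k + 1) = G (Y k) :=
    ⟨fun k => Nat.rec (fun _ => v) (fun _ f => G f) k, fun _ => rfl, fun _ => rfl⟩
  have hYd : ∀ k, DifferentiableOn ℂ (Y k) U := by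
    intro k
    induction k with
    | zero => exact (differentiableOn_const v).congr fun η _ => hY0 η
    | succ k ih =>
      rw [hYG]
      exact fun η hη => (hG _ ih η hη).differentiableAt.differentiableWithinAt
  have hYs : ∀ k, ∀ η ∈ U, HasDerivAt (Y (k + 1)) (M η (Y k η)) η := fun k => by
    rw [hYG]; exact hG _ (hYd k)
  have hv : ∀ k, Y (k + 1) η₀ = 0 := fun k => by rw [hYG]; exact hG0 _ (hYd k)
  have hsum : ∀ η ∈ U, Summable fun k => Y k η := by
    intro η hη
    obtain ⟨K, C, -, hKc, hKU, h0K, hK, hC⟩ := hb η hη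
    refine Summable.of_norm_bounded (g := fun k => ‖v‖ * ((C * ‖η - η₀‖) ^ k / k.factorial))
      ((Real.summable_pow_div_factorial _).mul_left _) fun k => ?_
    exact norm_picard_le hKc hY0 (fun k η h => hYs k η (hKU h)) hC h0K hv k η hK
  refine ⟨fun η => ∑' k, Y k η, ?_, fun η hη => ?_⟩
  · refine (tsum_eq_single 0 fun k hk => ?_).trans (hY0 η₀)
    obtain ⟨k, rfl⟩ := Nat.exists_eq_succ_of_ne_zero hk
    exact hv k
  · obtain ⟨K, C, hKo, hKc, hKU, h0K, hK, hC⟩ := hb η hη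
    have hC0 : 0 ≤ C := (norm_nonneg _).trans (hC _ h0K)
    set R := ‖η - η₀‖ + 1
    have hsh : ∀ x ∈ U, HasSum (fun k => Y (k + 1) x) ((∑' k, Y k x) - v) := fun x hx => by
      have := (hasSum_nat_add_iff' 1).2 (hsum x hx).hasSum
      simpa [hY0] using this
    have hmain : HasDerivAt (fun x => ∑' k, Y (k + 1) x) (∑' k, M η (Y k η)) η := by
      refine hasDerivAt_tsum_of_isPreconnected
        (u := fun k => C * (‖v‖ * ((C * R) ^ k / k.factorial)))
        (((Real.summable_pow_div_factorial _).mul_left _).mul_left _)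
        (t := K ∩ Metric.ball η₀ R) (g := fun k x => Y (k + 1) x)
        (g' := fun k x => M x (Y k x))
        (hKo.inter Metric.isOpen_ball)
        (hKc.inter (convex_ball _ _)).isPreconnected
        (fun k y hy => hYs k y (hKU hy.1)) (fun k y hy => ?_)
        (y₀ := η₀) ⟨h0K, by simp [R]; positivity⟩ ?_ ⟨hK, by simp [R, dist_eq_norm]⟩
      · refine ((M y).le_of_opNorm_le (hC y hy.1) _).trans ?_
        gcongr
        refine (norm_picard_le hKc hY0 (fun k η h => hYs k η (hKU h)) hC h0K hv k y
          hy.1).trans ?_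
        have : ‖y - η₀‖ ≤ R := by
          have := hy.2; rw [Metric.mem_ball, dist_eq_norm] at this; exact this.le
        gcongr
      · exact (hsh η₀ h₀).summable
    have h2 : ∑' k, M η (Y k η) = M η (∑' k, Y k η) := ((M η).map_tsum (hsum η hη)).symm
    rw [h2] at hmain
    refine (hmain.const_add v).congr_of_eventuallyEq ?_
    filter_upwards [hU.mem_nhds hη] with x hx
    rw [(hsh x hx).tsum_eq]
    abel

end ODE

/-! ### Taylor evaluation at nilpotent elements -/

section NilEval

variable {A : Type*} [CommRing A] [Algebra ℂ A]

theorem nilEval_eq_sum (g : ℂ → ℂ) (w : ℂ) {a : A} {N : ℕ} (h : a ^ N = 0) :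
    nilEval g w a =
      ∑ i ∈ Finset.range N, (iteratedDeriv i g w / (Nat.factorial i : ℂ)) • a ^ i := by
  refine Finset.sum_subset (fun i hi => ?_) fun i _ hi => ?_
  · rw [Finset.mem_range] at hi ⊢
    exact hi.trans_le (Nat.sInf_le h)
  · rw [Finset.mem_range, not_lt] at hi
    rw [pow_eq_zero_of_le hi (pow_nilpotencyClass ⟨N, h⟩), smul_zero]

theorem nilEval_congr {g h : ℂ → ℂ} {w : ℂ} (hgh : g =ᶠ[𝓝 w] h) (a : A) :
    nilEval g w a = nilEval h w a := by
  simp only [nilEval, hgh.iteratedDeriv_eq]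

theorem nilEval_mul {g h : ℂ → ℂ} {w : ℂ} (hg : AnalyticAt ℂ g w) (hh : AnalyticAt ℂ h w) {a : A}
    (ha : IsNilpotent a) :
    nilEval (fun x => g x * h x) w a = nilEval g w a * nilEval h w a := by
  obtain ⟨N, hN⟩ := ha
  -- compare the truncated Taylor polynomials modulo `X ^ N`
  let P : (ℂ → ℂ) → Polynomial ℂ := fun f =>
    ∑ i ∈ Finset.range N, Polynomial.monomial i (iteratedDeriv i f w / (Nat.factorial i : ℂ))
  have hP : ∀ f, nilEval f w a = Polynomial.aeval a (P f) := by
    intro f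
    rw [nilEval_eq_sum f w hN, map_sum]
    refine Finset.sum_congr rfl fun i _ => ?_
    rw [Polynomial.aeval_monomial, Algebra.smul_def]
  have hc : ∀ f i, i < N → (P f).coeff i = iteratedDeriv i f w / (Nat.factorial i : ℂ) := by
    intro f i hi
    simp [P, Polynomial.coeff_monomial, hi]
  have hdvd : Polynomial.X ^ N ∣ P g * P h - P (fun x => g x * h x) := by
    rw [Polynomial.X_pow_dvd_iff]
    intro d hd
    rw [Polynomial.coeff_sub, sub_eq_zero, Polynomial.coeff_mul, hc _ d hd,
      iteratedDeriv_fun_mul hg.contDiffAt hh.contDiffAt, Finset.sum_div,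
      Finset.Nat.sum_antidiagonal_eq_sum_range_succ_mk]
    refine Finset.sum_congr rfl fun i hi => ?_
    rw [Finset.mem_range, Nat.lt_succ_iff] at hi
    rw [hc _ _ (hi.trans_lt hd), hc _ _ ((Nat.sub_le _ _).trans_lt hd), Nat.cast_choose ℂ hi]
    have h1 : (d.factorial : ℂ) ≠ 0 := Nat.cast_ne_zero.2 d.factorial_ne_zero
    field_simp
  obtain ⟨q, hq⟩ := hdvd
  have := congrArg (Polynomial.aeval a) hq
  rw [map_sub, map_mul, map_mul, map_pow, Polynomial.aeval_X, hN, zero_mul, sub_eq_zero] at this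
  rw [hP, hP, hP, this]

theorem nilEval_comp_add (g : ℂ → ℂ) (w c : ℂ) (a : A) :
    nilEval (fun x => g (x + c)) w a = nilEval g (w + c) a := by
  simp only [nilEval, iteratedDeriv_comp_add_const]

theorem nilEval_id (w : ℂ) {a : A} (ha : IsNilpotent a) :
    nilEval (fun x => x) w a = algebraMap ℂ A w + a := by
  obtain ⟨N, hN⟩ := ha
  have h2 : a ^ (N + 2) = 0 := by rw [pow_add, hN, zero_mul]
  rw [nilEval_eq_sum _ _ h2, Finset.sum_range_succ', Finset.sum_range_succ']
  have hd : deriv (fun x : ℂ => x) = fun _ => (1 : ℂ) := by ext; simp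
  rw [Finset.sum_eq_zero]
  · simp [iteratedDeriv_succ', hd, Algebra.smul_def]
    ring
  · intro i _
    simp [iteratedDeriv_succ', hd]

theorem analyticAt_inv_Gamma (w : ℂ) : AnalyticAt ℂ (fun x => (Complex.Gamma x)⁻¹) w :=
  Complex.differentiable_one_div_Gamma.analyticAt w

theorem nilEval_inv_Gamma_step (w : ℂ) {a : A} (ha : IsNilpotent a) :
    nilEval (fun x => (Complex.Gamma x)⁻¹) w a =
      nilEval (fun x => (Complex.Gamma x)⁻¹) (w + 1) a * (algebraMap ℂ A w + a) := by
  rw [← nilEval_id w ha, ← nilEval_comp_add, mul_comm]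
  rw [← nilEval_mul (g := fun x => x) analyticAt_id _ ha]
  · congr 1
    ext x
    exact Complex.one_div_Gamma_eq_self_mul_one_div_Gamma_add_one x
  · exact (analyticAt_inv_Gamma _).fun_comp (analyticAt_id.add analyticAt_const)

theorem nilEval_inv_Gamma_iterate (w : ℂ) {a : A} (ha : IsNilpotent a) (E : ℕ) :
    nilEval (fun x => (Complex.Gamma x)⁻¹) w a =
      nilEval (fun x => (Complex.Gamma x)⁻¹) (w + E) a *
        ∏ i ∈ Finset.range E, (algebraMap ℂ A (w + i) + a) := by
  induction E with
  | zero => simp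
  | succ E ih =>
    rw [ih, nilEval_inv_Gamma_step _ ha, Finset.prod_range_succ]
    push_cast
    rw [add_assoc]
    ring

end NilEval

/-! ### The hypergeometric factors -/

section Hyper

variable {A : Type*} [CommRing A] [Algebra ℂ A]

theorem isUnit_add_algebraMap {u : A} (hu : IsNilpotent u) {c : ℂ} (hc : c ≠ 0) :
    IsUnit (u + algebraMap ℂ A c) := by
  rw [add_comm]
  exact hu.isUnit_add_left_of_commute ((isUnit_iff_ne_zero.2 hc).map (algebraMap ℂ A))
    (Commute.all _ _)

/-- The defining recursion of the hypergeometric factor.  It holds for every `q`, since the new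
factor is a unit whenever it has to be moved from the denominator to the numerator. -/
theorem hyperFactor_sub_one {u : A} (hu : IsNilpotent u) {z : ℂ} (hz : z ≠ 0) (q : ℚ) :
    hyperFactor u z (q - 1) = hyperFactor u z q * (u + algebraMap ℂ A ((q : ℂ) * z)) := by
  unfold hyperFactor
  rcases le_or_gt q 0 with hq | hq
  · have h1 : ⌈q⌉₊ = 0 := Nat.ceil_eq_zero.2 hq
    have h2 : ⌈q - 1⌉₊ = 0 := Nat.ceil_eq_zero.2 (by linarith)
    have h3 : ⌊-(q - 1)⌋₊ = ⌊-q⌋₊ + 1 := by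
      rw [← Nat.floor_add_one (by linarith)]
      congr 1
      ring
    rw [h1, h2, h3, Finset.prod_range_succ']
    simp only [Finset.range_zero, Finset.prod_empty, Ring.inverse_one, mul_one]
    congr 1
    · refine Finset.prod_congr rfl fun l _ => ?_
      push_cast
      congr 3
      ring
    · push_cast
      congr 3
      ring
  · have h1 : ⌊-q⌋₊ = 0 := Nat.floor_eq_zero.2 (by linarith)
    have h2 : ⌊-(q - 1)⌋₊ = 0 := Nat.floor_eq_zero.2 (by linarith)
    have h3 : ⌈q⌉₊ = ⌈q - 1⌉₊ + 1 := by
      rcases le_or_gt 1 q with h | h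
      · rw [← Nat.ceil_add_one (by linarith)]
        congr 1
        ring
      · rw [Nat.ceil_eq_zero.2 (by linarith : q - 1 ≤ 0)]
        rw [Nat.ceil_eq_iff (by norm_num)]
        simp
        exact ⟨hq, h.le⟩
    rw [h1, h2, h3, Finset.prod_range_succ']
    have hu0 : IsUnit (u + algebraMap ℂ A ((q : ℂ) * z)) :=
      isUnit_add_algebraMap hu (mul_ne_zero (by exact_mod_cast hq.ne') hz)
    simp only [Finset.range_zero, Finset.prod_empty, one_mul, Nat.cast_zero, sub_zero]
    rw [Ring.mul_inverse_rev, mul_comm (Ring.inverse _), mul_assoc,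
      Ring.inverse_mul_cancel _ hu0, mul_one]
    congr 1
    refine Finset.prod_congr rfl fun l _ => ?_
    push_cast
    congr 2
    ring

theorem hyperFactor_sub_nat {u : A} (hu : IsNilpotent u) {z : ℂ} (hz : z ≠ 0) (q : ℚ) (k : ℕ) :
    hyperFactor u z (q - k) = hyperFactor u z q *
      ∏ i ∈ Finset.range k, (u + algebraMap ℂ A (((q : ℂ) - i) * z)) := by
  induction k with
  | zero => simp
  | succ k ih =>
    have := hyperFactor_sub_one hu hz (q - k)
    rw [Finset.prod_range_succ, ← mul_assoc, ← ih]
    push_cast at this ⊢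
    rw [← this]
    congr 1
    ring

/-- Moving a degree by an integer `e` of either sign, with the extra factors written without
denominators. -/
theorem hyperFactor_sub_int {u : A} (hu : IsNilpotent u) {z : ℂ} (hz : z ≠ 0) (q : ℚ) (e : ℤ) :
    hyperFactor u z (q - e) *
        ∏ i ∈ Finset.range (-e).toNat, (u + algebraMap ℂ A (((q : ℂ) - e - i) * z)) =
      hyperFactor u z q *
        ∏ i ∈ Finset.range e.toNat, (u + algebraMap ℂ A (((q : ℂ) - i) * z)) := by
  rcases le_total 0 e with he | he
  · obtain ⟨k, rfl⟩ := Int.eq_ofNat_of_zero_le he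
    have := hyperFactor_sub_nat hu hz q k
    simpa using this
  · obtain ⟨k, hk⟩ := Int.eq_ofNat_of_zero_le (neg_nonneg.2 he)
    obtain rfl : e = -k := by omega
    have := hyperFactor_sub_nat hu hz (q + k) k
    simpa using this.symm

/-- If `q` is a negative integer, then the hypergeometric factor contains the factor `u`. -/
theorem dvd_hyperFactor (u : A) (z : ℂ) {q : ℚ} (a : ℤ) (hq : q = a) (ha : a < 0) :
    u ∣ hyperFactor u z q := by
  refine Dvd.dvd.mul_right ?_ _
  obtain ⟨k, hk⟩ := Int.eq_ofNat_of_zero_le (neg_nonneg.2 ha.le)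
  obtain rfl : a = -k := by omega
  have hk0 : k ≠ 0 := by omega
  have hf : ⌊-q⌋₊ = k := by rw [hq]; simp
  rw [hf]
  have := Finset.dvd_prod_of_mem
    (fun l : ℕ => u + algebraMap ℂ A (((q : ℂ) + l + 1) * z))
    (Finset.mem_range.2 (Nat.sub_lt (Nat.pos_of_ne_zero hk0) one_pos))
  convert this using 1
  have h0 : (q : ℂ) + (k - 1 : ℕ) + 1 = 0 := by
    rw [hq, Nat.cast_sub (Nat.one_le_iff_ne_zero.2 hk0)]
    push_cast
    ring
  rw [h0, zero_mul, map_zero, add_zero]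

end Hyper

/-! ### Power series with a two-term polynomial recursion -/

section Recursion

variable {A : Type*} [NormedCommRing A] [NormedAlgebra ℂ A]

/-- The value at `l` of a polynomial of degree at most `B` with leading coefficient `1`, applied to
a vector. -/
theorem eval_natCast_mul {P : Polynomial A} {B : ℕ} (hP : P.natDegree ≤ B) (hP1 : P.coeff B = 1)
    (l : ℕ) (v : A) : P.eval (l : A) * v =
      (l : ℂ) ^ B • v + ∑ i ∈ Finset.range B, (l : ℂ) ^ i • (P.coeff i * v) := by
  have hl : ∀ i, (l : A) ^ i = algebraMap ℂ A ((l : ℂ) ^ i) := by simp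
  rw [Polynomial.eval_eq_sum_range' (Nat.lt_succ_of_le hP), Finset.sum_range_succ, hP1, add_mul,
    Finset.sum_mul, add_comm, hl, one_mul, Algebra.smul_def]
  congr 1
  refine Finset.sum_congr rfl fun i _ => ?_
  rw [hl, Algebra.smul_def]
  ring

/-- The terms of degree less than `B` are smaller than `l ^ B` by a factor of order `l`. -/
theorem norm_lower_terms_le (P : Polynomial A) (B : ℕ) {l : ℕ} (hl : 1 ≤ l) (v : A) :
    ‖∑ i ∈ Finset.range B, (l : ℂ) ^ i • (P.coeff i * v)‖ * l ≤
      (∑ i ∈ Finset.range B, ‖P.coeff i‖) * (l : ℝ) ^ B * ‖v‖ := by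
  rw [Finset.sum_mul, Finset.sum_mul]
  refine (mul_le_mul_of_nonneg_right (norm_sum_le _ _) (Nat.cast_nonneg l)).trans ?_
  rw [Finset.sum_mul]
  refine Finset.sum_le_sum fun i hi => ?_
  rw [Finset.mem_range] at hi
  have hl1 : (1 : ℝ) ≤ l := by exact_mod_cast hl
  rw [norm_smul, norm_pow, Complex.norm_natCast]
  calc (l : ℝ) ^ i * ‖P.coeff i * v‖ * l = (l : ℝ) ^ (i + 1) * ‖P.coeff i * v‖ := by ring
    _ ≤ (l : ℝ) ^ B * (‖P.coeff i‖ * ‖v‖) := by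
      gcongr
      exacts [hi, norm_mul_le _ _]
    _ = _ := by ring

theorem exists_geometric_bound {A : Type*} [NormedCommRing A] {a : ℕ → A} {ρ : ℝ} (hρ : 1 ≤ ρ)
    {l₁ : ℕ}
    (h : ∀ l, l₁ ≤ l → ‖a (l + 1)‖ ≤ ρ * ‖a l‖) : ∃ C : ℝ, 0 ≤ C ∧ ∀ l, ‖a l‖ ≤ C * ρ ^ l := by
  refine ⟨∑ i ∈ Finset.range (l₁ + 1), ‖a i‖, by positivity, fun l => ?_⟩
  induction l with
  | zero =>
    rw [pow_zero, mul_one]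
    exact Finset.single_le_sum (f := fun i => ‖a i‖) (fun _ _ => norm_nonneg _) (by simp)
  | succ l ih =>
    rcases le_or_gt l₁ l with hl | hl
    · refine (h l hl).trans ?_
      rw [pow_succ']
      calc ρ * ‖a l‖ ≤ ρ * ((∑ i ∈ Finset.range (l₁ + 1), ‖a i‖) * ρ ^ l) := by gcongr
        _ = _ := by ring
    · calc ‖a (l + 1)‖ ≤ ∑ i ∈ Finset.range (l₁ + 1), ‖a i‖ :=
            Finset.single_le_sum (f := fun i => ‖a i‖) (fun _ _ => norm_nonneg _)
              (by simp; omega)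
        _ ≤ _ := le_mul_of_one_le_right (by positivity) (one_le_pow₀ hρ)

/-- A sequence satisfying a recursion whose two sides have the same degree in `l`, with invertible
leading coefficient, grows at most geometrically. -/
theorem exists_norm_le_of_recursion {P Q : Polynomial A} {B : ℕ} (hP : P.natDegree ≤ B)
    (hP1 : P.coeff B = 1) (hQ : Q.natDegree ≤ B) (hQ1 : Q.coeff B = 1) {c : ℂ} {a : ℕ → A}
    (h : ∀ l : ℕ, Q.eval ((l + 1 : ℕ) : A) * a (l + 1) = c • (P.eval (l : A) * a l)) :
    ∃ C ρ : ℝ, 0 ≤ C ∧ 1 ≤ ρ ∧ ∀ l, ‖a l‖ ≤ C * ρ ^ l := by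
  set SP := ∑ i ∈ Finset.range B, ‖P.coeff i‖ with hSP
  set SQ := ∑ i ∈ Finset.range B, ‖Q.coeff i‖ with hSQ
  have hSP0 : 0 ≤ SP := by positivity
  have hρ : 1 ≤ 2 * ‖c‖ * (1 + SP) + 1 := by
    have : 0 ≤ 2 * ‖c‖ * (1 + SP) := by positivity
    linarith
  obtain ⟨C, hC, hb⟩ := exists_geometric_bound (a := a) hρ (l₁ := ⌈2 * SQ⌉₊ + 1) (fun l hl => by
    have hl1 : 1 ≤ l := by omega
    have hl1' : (1 : ℝ) ≤ l := by exact_mod_cast hl1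
    have hl0 : (0 : ℝ) < ((l + 1 : ℕ) : ℝ) := by positivity
    have hlS : 2 * SQ ≤ ((l + 1 : ℕ) : ℝ) := by
      refine (Nat.le_ceil _).trans ?_
      exact_mod_cast (by omega : ⌈2 * SQ⌉₊ ≤ l + 1)
    set X : ℝ := ((l + 1 : ℕ) : ℝ) ^ B with hX
    have hX0 : 0 < X := by positivity
    have h1 : X * ‖a (l + 1)‖ / 2 ≤ ‖Q.eval ((l + 1 : ℕ) : A) * a (l + 1)‖ := by
      rw [eval_natCast_mul hQ hQ1]
      have h2 := norm_lower_terms_le Q B (l := l + 1) (by omega) (a (l + 1))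
      rw [← hSQ, ← hX] at h2
      have h3 : ‖∑ i ∈ Finset.range B, ((l + 1 : ℕ) : ℂ) ^ i • (Q.coeff i * a (l + 1))‖ ≤
          X * ‖a (l + 1)‖ / 2 := by
        rw [← le_div_iff₀ hl0] at h2
        refine h2.trans ?_
        rw [div_le_iff₀ hl0]
        have : 0 ≤ X * ‖a (l + 1)‖ := by positivity
        nlinarith
      have h4 : ‖((l + 1 : ℕ) : ℂ) ^ B • a (l + 1)‖ = X * ‖a (l + 1)‖ := by
        rw [norm_smul, norm_pow, Complex.norm_natCast]
      have h5 := norm_sub_norm_le (((l + 1 : ℕ) : ℂ) ^ B • a (l + 1))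
        (-∑ i ∈ Finset.range B, ((l + 1 : ℕ) : ℂ) ^ i • (Q.coeff i * a (l + 1)))
      rw [norm_neg, sub_neg_eq_add, h4] at h5
      linarith
    have h6 : ‖P.eval (l : A) * a l‖ ≤ (1 + SP) * X * ‖a l‖ := by
      rw [eval_natCast_mul hP hP1]
      have h2 := norm_lower_terms_le P B hl1 (a l)
      rw [← hSP] at h2
      have hlX : (l : ℝ) ^ B ≤ X := by
        rw [hX]; gcongr; simp
      have h3 : ‖∑ i ∈ Finset.range B, (l : ℂ) ^ i • (P.coeff i * a l)‖ ≤ SP * X * ‖a l‖ := by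
        refine (le_mul_of_one_le_right (norm_nonneg _) hl1').trans (h2.trans ?_)
        gcongr
      have h4 : ‖(l : ℂ) ^ B • a l‖ ≤ X * ‖a l‖ := by
        rw [norm_smul, norm_pow, Complex.norm_natCast]
        gcongr
      refine (norm_add_le _ _).trans ?_
      linarith
    rw [h l, norm_smul] at h1
    have h7 : X * ‖a (l + 1)‖ / 2 ≤ X * (‖c‖ * (1 + SP) * ‖a l‖) :=
      h1.trans ((mul_le_mul_of_nonneg_left h6 (norm_nonneg c)).trans_eq (by ring))
    rw [mul_div_assoc] at h7
    have h8 := le_of_mul_le_mul_left h7 hX0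
    have h9 := norm_nonneg (a l)
    linarith)
  exact ⟨C, _, hC, hρ, hb⟩

/-- The series `∑ l^i a_l e^{lη}`, that is, the `i`-th derivative of `∑ a_l e^{lη}`. -/
def expSum (a : ℕ → A) (i : ℕ) (η : ℂ) : A := ∑' l : ℕ, ((l : ℂ) ^ i * Complex.exp (l * η)) • a l

theorem norm_exp_natCast_mul (l : ℕ) (η : ℂ) : ‖Complex.exp (l * η)‖ = Real.exp η.re ^ l := by
  rw [Complex.norm_exp, ← Real.exp_nat_mul]
  simp

section Sum

variable {a : ℕ → A} {C ρ : ℝ}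

theorem norm_expSum_term_le (hC : 0 ≤ C) (hρ : 1 ≤ ρ) (ha : ∀ l, ‖a l‖ ≤ C * ρ ^ l)
    (i l : ℕ) {η : ℂ} (hη : η.re < -Real.log (2 * ρ)) :
    ‖((l : ℂ) ^ i * Complex.exp (l * η)) • a l‖ ≤ C * ((l : ℝ) ^ i * (1 / 2) ^ l) := by
  have h1 : Real.exp η.re * ρ ≤ 1 / 2 := by
    have : Real.exp η.re ≤ (2 * ρ)⁻¹ := by
      rw [← Real.exp_log (by positivity : 0 < (2 * ρ)⁻¹), Real.log_inv]
      exact Real.exp_le_exp.2 hη.le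
    calc Real.exp η.re * ρ ≤ (2 * ρ)⁻¹ * ρ := by gcongr
      _ = 1 / 2 := by field_simp
  rw [norm_smul, norm_mul, norm_pow, Complex.norm_natCast, norm_exp_natCast_mul]
  calc (l : ℝ) ^ i * Real.exp η.re ^ l * ‖a l‖ ≤ (l : ℝ) ^ i * Real.exp η.re ^ l * (C * ρ ^ l) := by
        gcongr
        exact ha l
    _ = C * ((l : ℝ) ^ i * (Real.exp η.re * ρ) ^ l) := by rw [mul_pow]; ring
    _ ≤ _ := by gcongr

theorem summable_expSum_bound (C : ℝ) (i : ℕ) :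
    Summable fun l : ℕ => C * ((l : ℝ) ^ i * (1 / 2) ^ l) :=
  (summable_pow_mul_geometric_of_norm_lt_one i
    (by norm_num : ‖(1 / 2 : ℝ)‖ < 1)).mul_left C

variable [CompleteSpace A]

theorem hasSum_expSum (hC : 0 ≤ C) (hρ : 1 ≤ ρ) (ha : ∀ l, ‖a l‖ ≤ C * ρ ^ l)
    (i : ℕ) {η : ℂ} (hη : η.re < -Real.log (2 * ρ)) :
    HasSum (fun l : ℕ => ((l : ℂ) ^ i * Complex.exp (l * η)) • a l) (expSum a i η) :=
  (Summable.of_norm_bounded (summable_expSum_bound C i)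
    fun l => norm_expSum_term_le hC hρ ha i l hη).hasSum

theorem hasDerivAt_expSum (hC : 0 ≤ C) (hρ : 1 ≤ ρ) (ha : ∀ l, ‖a l‖ ≤ C * ρ ^ l)
    (i : ℕ) {η : ℂ} (hη : η.re < -Real.log (2 * ρ)) :
    HasDerivAt (expSum a i) (expSum a (i + 1) η) η := by
  have ho : IsOpen {η : ℂ | η.re < -Real.log (2 * ρ)} :=
    isOpen_lt Complex.continuous_re continuous_const
  have hc : Convex ℝ {η : ℂ | η.re < -Real.log (2 * ρ)} := convex_halfSpace_re_lt _
  refine hasDerivAt_tsum_of_isPreconnected (summable_expSum_bound C (i + 1)) ho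
    hc.isPreconnected (g := fun (l : ℕ) η => ((l : ℂ) ^ i * Complex.exp (l * η)) • a l)
    (g' := fun (l : ℕ) η => ((l : ℂ) ^ (i + 1) * Complex.exp (l * η)) • a l)
    (fun l y _ => ?_) (fun l y hy => norm_expSum_term_le hC hρ ha (i + 1) l hy) hη
    (hasSum_expSum hC hρ ha i hη).summable hη
  have h1 : HasDerivAt (fun y : ℂ => (l : ℂ) * y) (l : ℂ) y := by
    simpa using (hasDerivAt_id y).const_mul (l : ℂ)
  have h2 := ((h1.cexp.const_mul ((l : ℂ) ^ i)).smul_const (a l))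
  convert h2 using 2
  ring

/-- The recursion turned into a differential equation. -/
theorem expSum_ode (hC : 0 ≤ C) (hρ : 1 ≤ ρ) (ha : ∀ l, ‖a l‖ ≤ C * ρ ^ l)
    {P Q : Polynomial A} {B : ℕ} (hP : P.natDegree ≤ B)
    (hP1 : P.coeff B = 1) (hQ : Q.natDegree ≤ B) (hQ1 : Q.coeff B = 1) {c : ℂ}
    (h0 : Q.eval 0 * a 0 = 0)
    (h : ∀ l : ℕ, Q.eval ((l + 1 : ℕ) : A) * a (l + 1) = c • (P.eval (l : A) * a l))
    {η : ℂ} (hη : η.re < -Real.log (2 * ρ)) :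
    expSum a B η + ∑ i ∈ Finset.range B, Q.coeff i * expSum a i η =
      (c * Complex.exp η) •
        (expSum a B η + ∑ i ∈ Finset.range B, P.coeff i * expSum a i η) := by
  have key : ∀ R : Polynomial A, R.natDegree ≤ B → R.coeff B = 1 →
      HasSum (fun l : ℕ => Complex.exp (l * η) • (R.eval (l : A) * a l))
        (expSum a B η + ∑ i ∈ Finset.range B, R.coeff i * expSum a i η) := by
    intro R hR hR1
    have h1 := (hasSum_expSum hC hρ ha B hη).add (hasSum_sum fun i (_ : i ∈ Finset.range B) =>
      (hasSum_expSum hC hρ ha i hη).mul_left (R.coeff i))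
    refine Eq.mpr (congrArg (HasSum · _) (funext fun l => ?_)) h1
    rw [eval_natCast_mul hR hR1, smul_add, Finset.smul_sum, smul_smul, mul_comm]
    congr 1
    refine Finset.sum_congr rfl fun i _ => ?_
    rw [smul_smul, mul_smul_comm, mul_comm]
  have hQs := key Q hQ hQ1
  have hPs := (key P hP hP1).const_smul (c * Complex.exp η)
  rw [← hasSum_nat_add_iff' 1] at hQs
  simp only [Finset.range_one, Finset.sum_singleton, Nat.cast_zero, h0, smul_zero, sub_zero] at hQs
  refine hQs.unique (Eq.mpr (congrArg (HasSum · _) (funext fun l => ?_)) hPs)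
  rw [h l, smul_smul, smul_smul]
  congr 1
  push_cast
  rw [add_mul, one_mul, Complex.exp_add]
  ring

end Sum

end Recursion

/-! ### Companion systems on a strip -/

section Continuation

/-- The open strip `0 < Im η < Δ`. -/
def strip (Δ : ℝ) : Set ℂ := {η | 0 < η.im ∧ η.im < Δ}

theorem isOpen_strip (Δ : ℝ) : IsOpen (strip Δ) :=
  (isOpen_lt continuous_const Complex.continuous_im).inter
    (isOpen_lt Complex.continuous_im continuous_const)

theorem convex_strip (Δ : ℝ) : Convex ℝ (strip Δ) :=
  (convex_halfSpace_im_gt 0).inter (convex_halfSpace_im_lt Δ)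

/-- Points `w = c e^η` whose argument stays away from the real axis keep a positive distance
from `1`, since `|1 - w| ≥ |Im w| / |w|`. -/
theorem exists_norm_one_sub_ge {c : ℂ} {φ₁ φ₂ : ℝ}
    (hc : ∀ φ ∈ Set.Icc φ₁ φ₂, (c * Complex.exp (φ * Complex.I)).im ≠ 0) :
    ∃ κ : ℝ, 0 < κ ∧ ∀ η : ℂ, φ₁ ≤ η.im → η.im ≤ φ₂ → κ ≤ ‖1 - c * Complex.exp η‖ := by
  rcases lt_or_ge φ₂ φ₁ with h | h
  · exact ⟨1, one_pos, fun η h1 h2 => absurd (h1.trans h2) (not_le.2 h)⟩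
  have hcont : ContinuousOn (fun φ : ℝ => |(c * Complex.exp (φ * Complex.I)).im|)
      (Set.Icc φ₁ φ₂) := by fun_prop
  obtain ⟨φ₀, hφ₀, hmin⟩ := isCompact_Icc.exists_isMinOn (Set.nonempty_Icc.2 h) hcont
  have hc0 : c ≠ 0 := by
    rintro rfl
    exact hc φ₁ ⟨le_rfl, h⟩ (by simp)
  have hcp : 0 < ‖c‖ := norm_pos_iff.2 hc0
  refine ⟨|(c * Complex.exp (φ₀ * Complex.I)).im| / ‖c‖,
    div_pos (abs_pos.2 (hc φ₀ hφ₀)) hcp, fun η h1 h2 => ?_⟩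
  refine (div_le_div_of_nonneg_right (hmin ⟨h1, h2⟩) hcp.le).trans ?_
  set ζ := c * Complex.exp (η.im * Complex.I) with hζ
  have hζn : ‖ζ‖ = ‖c‖ := by rw [hζ, norm_mul, Complex.norm_exp_ofReal_mul_I, mul_one]
  have hw : c * Complex.exp η = (Real.exp η.re : ℂ) * ζ := by
    conv_lhs => rw [← Complex.re_add_im η, Complex.exp_add]
    rw [hζ, Complex.ofReal_exp]
    ring
  -- multiply `1 - r ζ` by the conjugate of `ζ` and take imaginary parts
  have h3 : |ζ.im| ≤ ‖1 - c * Complex.exp η‖ * ‖c‖ := by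
    rw [hw, ← hζn, ← Complex.norm_conj ζ, ← norm_mul]
    refine le_trans (le_of_eq ?_) (Complex.abs_im_le_norm _)
    rw [sub_mul, one_mul, mul_assoc, Complex.mul_conj, Complex.sub_im, ← Complex.ofReal_mul,
      Complex.ofReal_im, sub_zero, Complex.conj_im, abs_neg]
  rwa [div_le_iff₀ hcp]

variable {A : Type*} [NormedCommRing A] [NormedAlgebra ℂ A] [FiniteDimensional ℂ A]

/-- The part of the companion matrix of the differential equation that is constant. -/
def companionConst (B : ℕ) (P : Polynomial A) : (Fin B → A) →ₗ[ℂ] (Fin B → A) where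
  toFun v i := if h : (i : ℕ) + 1 < B then v ⟨i + 1, h⟩ else -∑ j : Fin B, P.coeff j * v j
  map_add' v w := by
    ext i
    by_cases h : (i : ℕ) + 1 < B
    · simp [h]
    · simp [h, mul_add, Finset.sum_add_distrib, add_comm]
  map_smul' r v := by
    ext i
    by_cases h : (i : ℕ) + 1 < B
    · simp [h]
    · simp [h, Finset.smul_sum]

/-- The part of the companion matrix of the differential equation that is multiplied by
`(1 - c e^η)⁻¹`. -/
def companionSing (B : ℕ) (P Q : Polynomial A) : (Fin B → A) →ₗ[ℂ] (Fin B → A) where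
  toFun v i := if (i : ℕ) + 1 < B then 0 else ∑ j : Fin B, (P.coeff j - Q.coeff j) * v j
  map_add' v w := by
    ext i
    by_cases h : (i : ℕ) + 1 < B
    · simp [h]
    · simp [h, mul_add, Finset.sum_add_distrib]
  map_smul' r v := by
    ext i
    by_cases h : (i : ℕ) + 1 < B
    · simp [h]
    · simp [h, Finset.smul_sum]

/-- The companion matrix of the differential equation of `∑ a_l e^{lη}`. -/
def companion (B : ℕ) (P Q : Polynomial A) (c η : ℂ) : (Fin B → A) →L[ℂ] (Fin B → A) :=
  (1 - c * Complex.exp η)⁻¹ • LinearMap.toContinuousLinearMap (companionSing B P Q) +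
    LinearMap.toContinuousLinearMap (companionConst B P)

theorem norm_companion_le (B : ℕ) (P Q : Polynomial A) {c η : ℂ} {κ : ℝ} (hκ : 0 < κ)
    (h : κ ≤ ‖1 - c * Complex.exp η‖) :
    ‖companion B P Q c η‖ ≤ κ⁻¹ * ‖LinearMap.toContinuousLinearMap (companionSing B P Q)‖ +
      ‖LinearMap.toContinuousLinearMap (companionConst B P)‖ := by
  refine (norm_add_le _ _).trans ?_
  gcongr
  rw [norm_smul, norm_inv]
  gcongr

theorem hasDerivAt_expSum_companion {a : ℕ → A} {C ρ : ℝ} (hC : 0 ≤ C) (hρ : 1 ≤ ρ)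
    (ha : ∀ l, ‖a l‖ ≤ C * ρ ^ l) {P Q : Polynomial A} {B : ℕ} (hP : P.natDegree ≤ B)
    (hP1 : P.coeff B = 1) (hQ : Q.natDegree ≤ B) (hQ1 : Q.coeff B = 1) {c : ℂ}
    (h0 : Q.eval 0 * a 0 = 0)
    (h : ∀ l : ℕ, Q.eval ((l + 1 : ℕ) : A) * a (l + 1) = c • (P.eval (l : A) * a l))
    {η : ℂ} (hη : η.re < -Real.log (2 * ρ)) (hη1 : 1 - c * Complex.exp η ≠ 0) :
    HasDerivAt (fun η => fun i : Fin B => expSum a i η)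
      (companion B P Q c η fun i : Fin B => expSum a i η) η := by
  have : CompleteSpace A := FiniteDimensional.complete ℂ A
  rw [hasDerivAt_pi]
  intro i
  suffices hkey : companion B P Q c η (fun i : Fin B => expSum a i η) i = expSum a (i + 1) η by
    rw [hkey]
    exact hasDerivAt_expSum hC hρ ha i hη
  by_cases hi : (i : ℕ) + 1 < B
  · simp [companion, companionConst, companionSing, hi]
  · have hiB : (i : ℕ) + 1 = B := by omega
    have hode := expSum_ode hC hρ ha hP hP1 hQ hQ1 h0 h hη
    simp only [companion, companionConst, companionSing, add_apply, smul_apply,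
      LinearMap.coe_toContinuousLinearMap', LinearMap.coe_mk,
      AddHom.coe_mk, Pi.add_apply, Pi.smul_apply, hi, if_false, dif_neg, not_false_eq_true]
    rw [hiB]
    rw [Finset.sum_range, Finset.sum_range] at hode
    simp only [sub_mul, Finset.sum_sub_distrib]
    set w := c * Complex.exp η
    set S := ∑ j : Fin B, P.coeff j * expSum a j η
    set T := ∑ j : Fin B, Q.coeff j * expSum a j η
    have h2 : (1 - w) • expSum a B η = (S - T) - (1 - w) • S := by
      rw [smul_add] at hode
      rw [sub_smul, sub_smul, one_smul, one_smul]
      linear_combination (exp := 1) hode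
    calc (1 - w)⁻¹ • (S - T) + -S = (1 - w)⁻¹ • ((S - T) - (1 - w) • S) := by
          rw [smul_sub _ (S - T), smul_smul, inv_mul_cancel₀ hη1, one_smul, ← sub_eq_add_neg]
      _ = expSum a B η := by rw [← h2, smul_smul, inv_mul_cancel₀ hη1, one_smul]

end Continuation

section Continuation

theorem _root_.DifferentiableOn.smul_const_add_const {V : Type*} [NormedAddCommGroup V]
    [NormedSpace ℂ V] {f : ℂ → ℂ} {U : Set ℂ} (hf : DifferentiableOn ℂ f U) (S T : V) :
    DifferentiableOn ℂ (fun x => f x • S + T) U :=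
  (hf.smul (differentiableOn_const S)).add_const T

variable {A : Type*} [NormedCommRing A] [NormedAlgebra ℂ A] [FiniteDimensional ℂ A]

theorem differentiableOn_companion (B : ℕ) (P Q : Polynomial A) {c : ℂ} {U : Set ℂ}
    (hc : ∀ η ∈ U, 1 - c * Complex.exp η ≠ 0) :
    DifferentiableOn ℂ (companion B P Q c) U := by
  have h1 : DifferentiableOn ℂ (fun η : ℂ => (1 - c * Complex.exp η)⁻¹) U :=
    DifferentiableOn.inv (by fun_prop) hc
  exact h1.smul_const_add_const (V := (Fin B → A) →L[ℂ] (Fin B → A)) _ _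

theorem one_sub_ne_zero_of_im_ne_zero {c η : ℂ}
    (h : (c * Complex.exp (η.im * Complex.I)).im ≠ 0) : 1 - c * Complex.exp η ≠ 0 := by
  obtain ⟨κ, hκ, hb⟩ := exists_norm_one_sub_ge (c := c) (φ₁ := η.im) (φ₂ := η.im)
    (fun φ hφ => by rwa [le_antisymm hφ.2 hφ.1])
  exact norm_pos_iff.1 (hκ.trans_le (hb η le_rfl le_rfl))

/-- Estimate of the tail of a power series in `e^η`. -/
theorem norm_tail_le {A : Type*} [NormedCommRing A] [NormedAlgebra ℂ A] {a : ℕ → A}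
    {C ρ : ℝ} (hC : 0 ≤ C) (hρ : 1 ≤ ρ)
    (ha : ∀ l, ‖a l‖ ≤ C * ρ ^ l) {η : ℂ} (hη : η.re < -Real.log (2 * ρ)) {v : A}
    (hv : HasSum (fun l : ℕ => Complex.exp (l * η) • a l) v) (L : ℕ) :
    ‖v - ∑ l ∈ Finset.range L, Complex.exp (l * η) • a l‖ ≤
      2 * C * ρ ^ L * Real.exp (L * η.re) := by
  have h1 := (hasSum_nat_add_iff' L).2 hv
  rw [← h1.tsum_eq]
  set y := Real.exp η.re * ρ with hy
  have hy1 : y ≤ 1 / 2 := by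
    have : Real.exp η.re ≤ (2 * ρ)⁻¹ := by
      rw [← Real.exp_log (by positivity : 0 < (2 * ρ)⁻¹), Real.log_inv]
      exact Real.exp_le_exp.2 hη.le
    calc Real.exp η.re * ρ ≤ (2 * ρ)⁻¹ * ρ := by gcongr
      _ = 1 / 2 := by field_simp
  have hb : HasSum (fun l : ℕ => C * y ^ L * (1 / 2) ^ l) (C * y ^ L * 2) := by
    have := (hasSum_geometric_of_lt_one (r := (1 / 2 : ℝ)) (by norm_num) (by norm_num)).mul_left
      (C * y ^ L)
    norm_num at this ⊢
    exact this
  refine (tsum_of_norm_bounded hb fun l => ?_).trans (le_of_eq ?_)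
  · rw [norm_smul, norm_exp_natCast_mul]
    calc Real.exp η.re ^ (l + L) * ‖a (l + L)‖ ≤ Real.exp η.re ^ (l + L) * (C * ρ ^ (l + L)) := by
          gcongr
          exact ha _
      _ = C * y ^ L * y ^ l := by rw [hy]; ring
      _ ≤ C * y ^ L * (1 / 2) ^ l := by gcongr
  · rw [hy, mul_pow, ← Real.exp_nat_mul]
    ring

/-- A power series in `e^η` with a two-term polynomial recursion of leading ratio `c` continues to
any strip on which `c e^η` is not real; in closed substrips the continuation, minus any of its
partial sums, is at most exponential in `Re η`. -/
theorem exists_continuation {P Q : Polynomial A} {B : ℕ} (hB : 0 < B) (hP : P.natDegree ≤ B)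
    (hP1 : P.coeff B = 1) (hQ : Q.natDegree ≤ B) (hQ1 : Q.coeff B = 1) {c : ℂ} {a : ℕ → A}
    (h0 : Q.eval 0 * a 0 = 0)
    (h : ∀ l : ℕ, Q.eval ((l + 1 : ℕ) : A) * a (l + 1) = c • (P.eval (l : A) * a l))
    {Δ : ℝ} (hΔ : 0 < Δ)
    (hc : ∀ φ : ℝ, 0 < φ → φ < Δ → (c * Complex.exp (φ * Complex.I)).im ≠ 0) :
    ∃ (Φ : ℂ → A) (r : ℝ), DifferentiableOn ℂ Φ (strip Δ) ∧
      (∀ η ∈ strip Δ, η.re < -r → HasSum (fun l : ℕ => Complex.exp (l * η) • a l) (Φ η)) ∧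
      ∀ φ₁ φ₂ : ℝ, 0 < φ₁ → φ₂ < Δ → ∀ L : ℕ, ∃ C K : ℝ, 0 ≤ C ∧ L ≤ K ∧
        ∀ η : ℂ, φ₁ ≤ η.im → η.im ≤ φ₂ →
          ‖Φ η - ∑ l ∈ Finset.range L, Complex.exp (l * η) • a l‖ ≤
            C * (Real.exp (L * η.re) + Real.exp (K * η.re)) := by
  have : CompleteSpace A := FiniteDimensional.complete ℂ A
  obtain ⟨C, ρ, hC, hρ, ha⟩ := exists_norm_le_of_recursion hP hP1 hQ hQ1 h
  set r := Real.log (2 * ρ) with hr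
  have hr0 : 0 ≤ r := Real.log_nonneg (by linarith)
  have hne : ∀ η ∈ strip Δ, 1 - c * Complex.exp η ≠ 0 := fun η hη =>
    one_sub_ne_zero_of_im_ne_zero (hc _ hη.1 hη.2)
  set M := companion B P Q c
  set Y₀ : ℂ → Fin B → A := fun η i => expSum a i η
  have hY₀ : ∀ η ∈ strip Δ, η.re < -r → HasDerivAt Y₀ (M η (Y₀ η)) η := fun η hη hηr =>
    hasDerivAt_expSum_companion hC hρ ha hP hP1 hQ hQ1 h0 h hηr (hne η hη)
  -- the bounds on closed substrips, in the form needed by Picard's method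
  have hbd : ∀ φ₁ φ₂ : ℝ, 0 < φ₁ → φ₂ < Δ → ∃ C : ℝ, ∀ η : ℂ, φ₁ ≤ η.im → η.im ≤ φ₂ →
      ‖M η‖ ≤ C := by
    intro φ₁ φ₂ h1 h2
    obtain ⟨κ, hκ, hb⟩ := exists_norm_one_sub_ge (c := c) (φ₁ := φ₁) (φ₂ := φ₂)
      (fun φ hφ => hc φ (h1.trans_le hφ.1) (hφ.2.trans_lt h2))
    exact ⟨_, fun η h3 h4 => norm_companion_le B P Q hκ (hb η h3 h4)⟩
  set η₀ : ℂ := ⟨-r - 1, Δ / 2⟩ with hη₀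
  have hη₀s : η₀ ∈ strip Δ := ⟨by simp [hη₀, hΔ], by simp [hη₀]; linarith⟩
  have hη₀r : η₀.re < -r := by simp [hη₀]
  have hconv : ∀ φ₁ φ₂ : ℝ, Convex ℝ {η : ℂ | φ₁ < η.im ∧ η.im < φ₂} := fun φ₁ φ₂ =>
    (convex_halfSpace_im_gt φ₁).inter (convex_halfSpace_im_lt φ₂)
  -- an open substrip containing both `η₀` and a given point
  have hsub : ∀ φ₁ φ₂ : ℝ, 0 < φ₁ → φ₂ < Δ → ∃ (K : Set ℂ) (C : ℝ), IsOpen K ∧ Convex ℝ K ∧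
      K ⊆ strip Δ ∧ η₀ ∈ K ∧ (∀ η : ℂ, φ₁ ≤ η.im → η.im ≤ φ₂ → η ∈ K) ∧ ∀ x ∈ K, ‖M x‖ ≤ C := by
    intro φ₁ φ₂ h1 h2
    set ψ₁ := min φ₁ (Δ / 2) / 2 with hψ₁
    set ψ₂ := (max φ₂ (Δ / 2) + Δ) / 2 with hψ₂
    have hm : 0 < min φ₁ (Δ / 2) := lt_min h1 (by linarith)
    have hM : max φ₂ (Δ / 2) < Δ := max_lt h2 (by linarith)
    have e1 : ψ₁ < min φ₁ (Δ / 2) := by rw [hψ₁]; linarith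
    have e2 : max φ₂ (Δ / 2) < ψ₂ := by rw [hψ₂]; linarith
    have e3 : 0 < ψ₁ := by rw [hψ₁]; linarith
    have e4 : ψ₂ < Δ := by rw [hψ₂]; linarith
    obtain ⟨C, hC⟩ := hbd ψ₁ ψ₂ e3 e4
    refine ⟨{η : ℂ | ψ₁ < η.im ∧ η.im < ψ₂}, C,
      (isOpen_lt continuous_const Complex.continuous_im).inter
        (isOpen_lt Complex.continuous_im continuous_const), hconv _ _,
      fun η hη => ⟨e3.trans hη.1, hη.2.trans e4⟩,
      ⟨e1.trans_le (min_le_right _ _), (le_max_right _ _).trans_lt e2⟩,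
      fun η h3 h4 => ⟨(e1.trans_le (min_le_left _ _)).trans_le h3,
        h4.trans_lt ((le_max_left _ _).trans_lt e2)⟩,
      fun x hx => hC x hx.1.le hx.2.le⟩
  obtain ⟨Y, hY0, hY⟩ := exists_linear_ode_solution (isOpen_strip Δ) (convex_strip Δ)
    (differentiableOn_companion B P Q hne) hη₀s (Y₀ η₀) (fun η hη => by
      obtain ⟨K, C, h1, h2, h3, h4, h5, h6⟩ := hsub η.im η.im hη.1 hη.2
      exact ⟨K, C, h1, h2, h3, h4, h5 η le_rfl le_rfl, h6⟩)
  -- uniqueness: the global solution agrees with the series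
  have hagree : ∀ η ∈ strip Δ, η.re < -r → Y η = Y₀ η := by
    intro η hη hηr
    obtain ⟨K, C, -, h2, h3, h4, h5, h6⟩ := hsub η.im η.im hη.1 hη.2
    have hKc : Convex ℝ (K ∩ {x : ℂ | x.re < -r}) := h2.inter (convex_halfSpace_re_lt _)
    have := norm_le_exp_of_linear_ode (Y := fun x => Y x - Y₀ x) (M := M) hKc
      (fun x hx => by
        rw [map_sub]
        exact (hY x (h3 hx.1)).sub (hY₀ x (h3 hx.1) hx.2))
      (fun x hx => h6 x hx.1) (η₀ := η₀) (η := η) ⟨h4, hη₀r⟩ ⟨h5 η le_rfl le_rfl, hηr⟩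
    rw [hY0, sub_self, norm_zero, zero_mul] at this
    exact sub_eq_zero.1 (norm_le_zero_iff.1 this)
  have hsum : ∀ η ∈ strip Δ, η.re < -r →
      HasSum (fun l : ℕ => Complex.exp (l * η) • a l) (Y η ⟨0, hB⟩) := by
    intro η hη hηr
    rw [hagree η hη hηr]
    simpa using hasSum_expSum hC hρ ha 0 hηr
  refine ⟨fun η => Y η ⟨0, hB⟩, r, fun η hη =>
    ((hasDerivAt_pi.1 (hY η hη)) ⟨0, hB⟩).differentiableAt.differentiableWithinAt, hsum, ?_⟩
  intro φ₁ φ₂ h1 h2 L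
  obtain ⟨K, C₁, -, hKc, hKs, hK0, hK, hC₁⟩ := hsub φ₁ φ₂ h1 h2
  have hC₁0 : 0 ≤ C₁ := (norm_nonneg _).trans (hC₁ _ hK0)
  -- Grönwall's inequality to the right of `Re η = -r`
  have hright : ∀ η : ℂ, φ₁ ≤ η.im → η.im ≤ φ₂ → -r ≤ η.re →
      ‖Y η ⟨0, hB⟩‖ ≤ ‖Y₀ η₀‖ * Real.exp (C₁ * (r + 1 + Δ)) * Real.exp (C₁ * η.re) := by
    intro η h3 h4 h5
    have h6 := norm_le_exp_of_linear_ode hKc (fun x hx => hY x (hKs hx)) hC₁ hK0 (hK η h3 h4)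
    refine (norm_le_pi_norm (Y η) _).trans (h6.trans ?_)
    rw [hY0, mul_assoc, ← Real.exp_add]
    have h7 : ‖η - η₀‖ ≤ η.re + (r + 1 + Δ) := by
      refine (Complex.norm_le_abs_re_add_abs_im _).trans ?_
      have e1 : |(η - η₀).re| = η.re + r + 1 := by
        rw [Complex.sub_re, abs_of_nonneg] <;> simp [hη₀] <;> linarith
      have e2 : |(η - η₀).im| ≤ Δ := by
        rw [Complex.sub_im, abs_le]
        simp only [hη₀]
        constructor <;> linarith
      linarith
    have h8 : C₁ * ‖η - η₀‖ ≤ C₁ * (r + 1 + Δ) + C₁ * η.re := by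
      calc _ ≤ C₁ * (η.re + (r + 1 + Δ)) := by gcongr
        _ = _ := by ring
    gcongr
  set K' : ℝ := max C₁ L
  set S : ℝ := ∑ l ∈ Finset.range L, ‖a l‖ with hS
  have hS0 : 0 ≤ S := by positivity
  set D : ℝ := ‖Y₀ η₀‖ * Real.exp (C₁ * (r + 1 + Δ)) * Real.exp (K' * r)
  have hD0 : 0 ≤ D := by positivity
  have hmono : ∀ k : ℝ, ∀ x : ℝ, ∀ k' : ℝ, 0 ≤ k → k ≤ k' → -r ≤ x →
      Real.exp (k * x) ≤ Real.exp (k' * r) * Real.exp (k' * x) := by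
    intro k x k' hk0 hk hx
    rw [← Real.exp_add]
    refine Real.exp_le_exp.2 ?_
    nlinarith
  refine ⟨2 * C * ρ ^ L + D + S * Real.exp (L * r), K', by positivity, le_max_right _ _,
    fun η h3 h4 => ?_⟩
  have hηs : η ∈ strip Δ := ⟨h1.trans_le h3, h4.trans_lt h2⟩
  have eL := Real.exp_pos (L * η.re)
  have eK := Real.exp_pos (K' * η.re)
  have hCρ : 0 ≤ 2 * C * ρ ^ L := by positivity
  have hSr : 0 ≤ S * Real.exp (L * r) := by positivity
  rcases lt_or_ge η.re (-r) with hηr | hηr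
  · refine (norm_tail_le hC hρ ha hηr (hsum η hηs hηr) L).trans ?_
    calc 2 * C * ρ ^ L * Real.exp (L * η.re) ≤
          (2 * C * ρ ^ L + D + S * Real.exp (L * r)) * Real.exp (L * η.re) := by
          gcongr
          linarith
      _ ≤ _ := by
          gcongr
          linarith
  · have e1 : ‖Y η ⟨0, hB⟩‖ ≤ D * Real.exp (K' * η.re) := by
      refine (hright η h3 h4 hηr).trans ?_
      have := hmono C₁ η.re K' hC₁0 (le_max_left _ _) hηr
      calc _ ≤ ‖Y₀ η₀‖ * Real.exp (C₁ * (r + 1 + Δ)) *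
            (Real.exp (K' * r) * Real.exp (K' * η.re)) := by gcongr
        _ = _ := by ring
    have e2 : ‖∑ l ∈ Finset.range L, Complex.exp (l * η) • a l‖ ≤
        S * Real.exp (L * r) * Real.exp (L * η.re) := by
      refine (norm_sum_le _ _).trans ?_
      rw [hS, Finset.sum_mul, Finset.sum_mul]
      refine Finset.sum_le_sum fun l hl => ?_
      rw [norm_smul, norm_exp_natCast_mul, ← Real.exp_nat_mul, mul_comm, mul_assoc]
      gcongr
      exact hmono l η.re L (Nat.cast_nonneg l)
        (by exact_mod_cast (Finset.mem_range.1 hl).le) hηr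
    refine (norm_sub_le _ _).trans ?_
    have e3 : 0 ≤ (2 * C * ρ ^ L + D) * Real.exp (L * η.re) := by positivity
    have e4 : 0 ≤ (2 * C * ρ ^ L + S * Real.exp (L * r)) * Real.exp (K' * η.re) := by positivity
    linarith

end Continuation

/-! ### The Laplace transform along rays -/

theorem log_ray {t α : ℝ} (ht : 0 < t) (h1 : -Real.pi < α) (h2 : α ≤ Real.pi) :
    Complex.log (t * Complex.exp (α * Complex.I)) = Real.log t + α * Complex.I := by
  have : (t : ℂ) * Complex.exp (α * Complex.I) = Complex.exp (Real.log t + α * Complex.I) := by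
    rw [Complex.exp_add, ← Complex.ofReal_exp, Real.exp_log ht]
  rw [this, Complex.log_exp] <;> simp [h1, h2]

theorem norm_exp_neg_mul (r : ℂ) (t : ℝ) : ‖Complex.exp (-(r * t))‖ = Real.exp (-(r.re * t)) := by
  rw [Complex.norm_exp]
  simp

theorem integrableOn_rpow_mul_exp {κ c : ℝ} (hκ : -1 < κ) (hc : 0 < c) :
    IntegrableOn (fun t : ℝ => t ^ κ * Real.exp (-(c * t))) (Set.Ioi 0) := by
  have := integrableOn_rpow_mul_exp_neg_mul_rpow hκ one_pos hc
  simpa using this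

theorem integral_rpow_mul_exp {κ c : ℝ} (hκ : -1 < κ) (hc : 0 < c) :
    ∫ t : ℝ in Set.Ioi 0, t ^ κ * Real.exp (-(c * t)) = (1 / c) ^ (κ + 1) * Real.Gamma (κ + 1) := by
  have := Real.integral_rpow_mul_exp_neg_mul_Ioi (a := κ + 1) (by linarith) hc
  simpa using this

section Bounds

variable {V : Type*} [NormedAddCommGroup V] [NormedSpace ℂ V]

theorem integrableOn_laplace {g : ℝ → V}
    (hg : AEStronglyMeasurable g (volume.restrict (Set.Ioi 0))) {C κ K : ℝ} (hκ : -1 < κ)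
    (hK : -1 < K) (hb : ∀ t : ℝ, 0 < t → ‖g t‖ ≤ C * (t ^ κ + t ^ K)) {r : ℂ} (hr : 0 < r.re) :
    IntegrableOn (fun t : ℝ => Complex.exp (-(r * t)) • g t) (Set.Ioi 0) := by
  have hi := ((integrableOn_rpow_mul_exp hκ hr).add (integrableOn_rpow_mul_exp hK hr)).const_mul C
  refine hi.mono' (AEStronglyMeasurable.smul (Continuous.aestronglyMeasurable (by fun_prop)) hg) ?_
  refine (ae_restrict_iff' measurableSet_Ioi).2 (Eventually.of_forall fun t ht => ?_)
  rw [norm_smul, norm_exp_neg_mul]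
  calc _ ≤ Real.exp (-(r.re * t)) * (C * (t ^ κ + t ^ K)) := by
        gcongr
        exact hb t ht
    _ = _ := by
        simp only [Pi.add_apply]
        ring

theorem norm_laplace_le {g : ℝ → V} {C κ K : ℝ} (hκ : -1 < κ)
    (hK : -1 < K) (hb : ∀ t : ℝ, 0 < t → ‖g t‖ ≤ C * (t ^ κ + t ^ K)) {r : ℂ} (hr : 0 < r.re) :
    ‖∫ t : ℝ in Set.Ioi 0, Complex.exp (-(r * t)) • g t‖ ≤
      C * ((1 / r.re) ^ (κ + 1) * Real.Gamma (κ + 1) +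
        (1 / r.re) ^ (K + 1) * Real.Gamma (K + 1)) := by
  rw [← integral_rpow_mul_exp hκ hr, ← integral_rpow_mul_exp hK hr,
    ← integral_add (integrableOn_rpow_mul_exp hκ hr) (integrableOn_rpow_mul_exp hK hr),
    ← integral_const_mul]
  refine norm_integral_le_of_norm_le
    (((integrableOn_rpow_mul_exp hκ hr).add (integrableOn_rpow_mul_exp hK hr)).const_mul C) ?_
  refine (ae_restrict_iff' measurableSet_Ioi).2 (Eventually.of_forall fun t ht => ?_)
  rw [norm_smul, norm_exp_neg_mul]
  calc _ ≤ Real.exp (-(r.re * t)) * (C * (t ^ κ + t ^ K)) := by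
        gcongr
        exact hb t ht
    _ = _ := by ring

theorem aestronglyMeasurable_ray {V : Type*} [NormedAddCommGroup V] {f : ℂ → V} {δ : ℝ}
    (hf : ContinuousOn f (strip δ)) {α : ℝ}
    (h0 : 0 < α) (h1 : α < δ) :
    AEStronglyMeasurable (fun t : ℝ => f (Real.log t + α * Complex.I))
      (volume.restrict (Set.Ioi 0)) := by
  refine ContinuousOn.aestronglyMeasurable ?_ measurableSet_Ioi
  refine hf.comp (s := Set.Ioi 0) (ContinuousOn.add ?_ continuousOn_const) fun t _ => ?_
  · exact Complex.continuous_ofReal.comp_continuousOn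
      (Real.continuousOn_log.mono fun t ht => (Set.mem_Ioi.1 ht).ne')
  · simp [strip, h0, h1]

end Bounds

section Contour

variable {V : Type*} [NormedAddCommGroup V] [NormedSpace ℂ V]

/-- The integrand `e^{-u x} F(x) dx` in the coordinate `ξ = log x`, where `f ξ = F (e^ξ)`. -/
def logIntegrand (f : ℂ → V) (u ξ : ℂ) : V :=
  (Complex.exp (-(u * Complex.exp ξ)) * Complex.exp ξ) • f ξ

theorem exp_image_univ : Real.exp '' Set.univ = Set.Ioi 0 := by
  rw [Set.image_univ, Real.range_exp]

theorem exp_smul_ray (f : ℂ → V) (u : ℂ) (α ρ : ℝ) :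
    |Real.exp ρ| • ((Complex.exp (-(u * Complex.exp (α * Complex.I) * (Real.exp ρ : ℝ))) *
      Complex.exp (α * Complex.I)) • f (Real.log (Real.exp ρ) + α * Complex.I)) =
      logIntegrand f u (ρ + α * Complex.I) := by
  rw [logIntegrand, Real.log_exp, Real.abs_exp, ← Complex.coe_smul, smul_smul, Complex.exp_add,
    Complex.ofReal_exp]
  congr 1
  rw [show u * Complex.exp (α * Complex.I) * Complex.exp ρ =
    u * (Complex.exp ρ * Complex.exp (α * Complex.I)) by ring]
  ring

theorem integral_ray_eq (f : ℂ → V) (u : ℂ) (α : ℝ) :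
    ∫ t : ℝ in Set.Ioi 0, (Complex.exp (-(u * Complex.exp (α * Complex.I) * t)) *
      Complex.exp (α * Complex.I)) • f (Real.log t + α * Complex.I) =
      ∫ ρ : ℝ, logIntegrand f u (ρ + α * Complex.I) := by
  rw [← exp_image_univ, integral_image_eq_integral_abs_deriv_smul MeasurableSet.univ
    (fun x _ => (Real.hasDerivAt_exp x).hasDerivWithinAt) Real.exp_injective.injOn,
    setIntegral_univ]
  exact integral_congr_ae (Eventually.of_forall fun ρ => exp_smul_ray f u α ρ)

theorem integrable_logIntegrand {f : ℂ → V} {u : ℂ} {α : ℝ}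
    (h : IntegrableOn (fun t : ℝ => Complex.exp (-(u * Complex.exp (α * Complex.I) * t)) •
      f (Real.log t + α * Complex.I)) (Set.Ioi 0)) :
    Integrable fun ρ : ℝ => logIntegrand f u (ρ + α * Complex.I) := by
  have h1 := h.smul (Complex.exp (α * Complex.I))
  rw [← exp_image_univ] at h1
  have h2 := (integrableOn_image_iff_integrableOn_abs_deriv_smul MeasurableSet.univ
    (fun x _ => (Real.hasDerivAt_exp x).hasDerivWithinAt) Real.exp_injective.injOn _).1 h1
  rw [integrableOn_univ] at h2
  refine h2.congr (Eventually.of_forall fun ρ => ?_)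
  simp only [Pi.smul_apply, smul_smul, ← exp_smul_ray f u α ρ]
  congr 2
  ring

/-- The bound for the integrand at the two ends of a horizontal strip tends to zero. -/
theorem tendsto_end_bound {c C κ K : ℝ} (hc : 0 < c) (hκ : -1 < κ) (hK : -1 < K) (B : ℝ)
    {l : Filter ℝ} (hl : l = atTop ∨ l = atBot) :
    Tendsto (fun ρ : ℝ => Real.exp (-(c * Real.exp ρ)) * Real.exp ρ *
      (C * (Real.exp (κ * ρ) + Real.exp (K * ρ))) * B) l (𝓝 0) := by
  have key : ∀ k : ℝ, -1 < k → Tendsto (fun ρ : ℝ => Real.exp (-(c * Real.exp ρ)) *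
      Real.exp ((k + 1) * ρ)) l (𝓝 0) := by
    intro k hk
    rcases hl with rfl | rfl
    · have h1 := (tendsto_rpow_mul_exp_neg_mul_atTop_nhds_zero (k + 1) c hc).comp
        Real.tendsto_exp_atTop
      refine h1.congr fun ρ => ?_
      simp only [Function.comp]
      rw [← Real.exp_mul, mul_comm, mul_comm ρ, neg_mul]
    · have h1 : Tendsto (fun ρ : ℝ => Real.exp ((k + 1) * ρ)) atBot (𝓝 0) :=
        Real.tendsto_exp_atBot.comp (tendsto_id.const_mul_atBot (by linarith))
      refine squeeze_zero (fun ρ => by positivity) (fun ρ => ?_) h1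
      refine mul_le_of_le_one_left (Real.exp_nonneg _) (Real.exp_le_one_iff.2 ?_)
      have := Real.exp_pos ρ
      nlinarith
  have h := (((key κ hκ).add (key K hK)).const_mul C).mul_const B
  simp only [add_zero, mul_zero, zero_mul] at h
  refine h.congr fun ρ => ?_
  rw [show (κ + 1) * ρ = κ * ρ + ρ by ring, show (K + 1) * ρ = K * ρ + ρ by ring, Real.exp_add,
    Real.exp_add]
  ring

/-- Cauchy's theorem: the integral along a ray does not depend on the ray. -/
theorem integral_logIntegrand_eq {f : ℂ → V} {u : ℂ} {α₁ α₂ : ℝ} (h12 : α₁ ≤ α₂) {C κ K : ℝ}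
    (hκ : -1 < κ) (hK : -1 < K)
    (hf : DifferentiableOn ℂ f {ξ | α₁ ≤ ξ.im ∧ ξ.im ≤ α₂})
    (hb : ∀ ξ : ℂ, α₁ ≤ ξ.im → ξ.im ≤ α₂ →
      ‖f ξ‖ ≤ C * (Real.exp (κ * ξ.re) + Real.exp (K * ξ.re)))
    (hu : ∀ α : ℝ, α₁ ≤ α → α ≤ α₂ → 0 < (u * Complex.exp (α * Complex.I)).re)
    (hi₁ : Integrable fun ρ : ℝ => logIntegrand f u (ρ + α₁ * Complex.I))
    (hi₂ : Integrable fun ρ : ℝ => logIntegrand f u (ρ + α₂ * Complex.I)) :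
    ∫ ρ : ℝ, logIntegrand f u (ρ + α₁ * Complex.I) =
      ∫ ρ : ℝ, logIntegrand f u (ρ + α₂ * Complex.I) := by
  have hcont : ContinuousOn (fun α : ℝ => (u * Complex.exp (α * Complex.I)).re)
      (Set.Icc α₁ α₂) := by fun_prop
  obtain ⟨α₀, hα₀, hmin⟩ := isCompact_Icc.exists_isMinOn (Set.nonempty_Icc.2 h12) hcont
  set c := (u * Complex.exp (α₀ * Complex.I)).re
  have hc : 0 < c := hu α₀ hα₀.1 hα₀.2
  have hbound : ∀ ρ y : ℝ, y ∈ Set.Icc α₁ α₂ → ‖logIntegrand f u (ρ + y * Complex.I)‖ ≤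
      Real.exp (-(c * Real.exp ρ)) * Real.exp ρ *
        (C * (Real.exp (κ * ρ) + Real.exp (K * ρ))) := by
    intro ρ y hy
    have h1 := hb (ρ + y * Complex.I) (by simpa using hy.1) (by simpa using hy.2)
    simp only [Complex.add_re, Complex.ofReal_re, Complex.mul_re, Complex.I_re, mul_zero,
      Complex.ofReal_im, Complex.I_im, mul_one, sub_self, add_zero] at h1
    have h2 : c ≤ (u * Complex.exp (y * Complex.I)).re := hmin hy
    rw [logIntegrand, norm_smul, norm_mul, Complex.norm_exp, Complex.norm_exp]
    have h3 : (-(u * Complex.exp (ρ + y * Complex.I))).re =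
        -((u * Complex.exp (y * Complex.I)).re * Real.exp ρ) := by
      rw [Complex.exp_add, ← Complex.ofReal_exp, Complex.neg_re,
        show u * ((Real.exp ρ : ℂ) * Complex.exp (y * Complex.I)) =
          (Real.exp ρ : ℂ) * (u * Complex.exp (y * Complex.I)) by ring, Complex.re_ofReal_mul]
      ring
    have h4 : (ρ + y * Complex.I : ℂ).re = ρ := by simp
    rw [h3, h4]
    gcongr
  have hvert : ∀ l : Filter ℝ, (l = atTop ∨ l = atBot) →
      Tendsto (fun T : ℝ => ∫ y : ℝ in α₁..α₂, logIntegrand f u (T + y * Complex.I)) l (𝓝 0) := by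
    intro l hl
    refine squeeze_zero_norm (fun T => ?_) (tendsto_end_bound (C := C) hc hκ hK |α₂ - α₁| hl)
    refine intervalIntegral.norm_integral_le_of_norm_le_const fun y hy => ?_
    rw [Set.uIoc_of_le h12] at hy
    exact hbound T y ⟨hy.1.le, hy.2⟩
  have hd : DifferentiableOn ℂ (logIntegrand f u) {ξ | α₁ ≤ ξ.im ∧ ξ.im ≤ α₂} := by
    refine DifferentiableOn.smul (DifferentiableOn.mul ?_ ?_) hf <;> fun_prop
  have hrect : ∀ T : ℝ, (∫ ρ : ℝ in (-T)..T, logIntegrand f u (ρ + α₁ * Complex.I)) -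
      (∫ ρ : ℝ in (-T)..T, logIntegrand f u (ρ + α₂ * Complex.I)) =
      Complex.I • (∫ y : ℝ in α₁..α₂, logIntegrand f u ((-T : ℝ) + y * Complex.I)) -
      Complex.I • ∫ y : ℝ in α₁..α₂, logIntegrand f u (T + y * Complex.I) := by
    intro T
    have h1 := Complex.integral_boundary_rect_eq_zero_of_differentiableOn (logIntegrand f u)
      (⟨-T, α₁⟩ : ℂ) (⟨T, α₂⟩ : ℂ) (hd.mono fun ξ hξ => by
        have := hξ.2
        rw [Set.mem_preimage, Set.uIcc_of_le h12] at this
        exact this)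
    simp only at h1
    rw [add_sub_assoc, add_eq_zero_iff_eq_neg, neg_sub] at h1
    exact h1
  have h1 := intervalIntegral_tendsto_integral hi₁ tendsto_neg_atTop_atBot tendsto_id
  have h2 := intervalIntegral_tendsto_integral hi₂ tendsto_neg_atTop_atBot tendsto_id
  have h3 := ((hvert atBot (Or.inr rfl)).comp tendsto_neg_atTop_atBot).const_smul Complex.I
  have h4 := (hvert atTop (Or.inl rfl)).const_smul Complex.I
  have h5 := h3.sub h4
  simp only [smul_zero, sub_zero] at h5
  refine sub_eq_zero.1 (tendsto_nhds_unique (h1.sub h2) (h5.congr fun T => ?_))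
  exact (hrect T).symm

end Contour

section Laplace

theorem add_lt_pi_div_two_of_re_pos {u : ℂ} {α : ℝ} (hu : |u.arg| < Real.pi / 2) (h0 : 0 < α)
    (h1 : α < Real.pi / 2) (h : 0 < (u * Complex.exp (α * Complex.I)).re) :
    u.arg + α < Real.pi / 2 := by
  by_contra hcon
  rw [not_lt] at hcon
  rw [abs_lt] at hu
  have h2 : (u * Complex.exp (α * Complex.I)).re = ‖u‖ * Real.cos (u.arg + α) := by
    conv_lhs => rw [← Complex.norm_mul_exp_arg_mul_I u, mul_assoc, ← Complex.exp_add, ← add_mul,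
      ← Complex.ofReal_add, Complex.re_ofReal_mul, Complex.exp_ofReal_mul_I_re]
  have h3 : Real.cos (u.arg + α) ≤ 0 :=
    Real.cos_nonpos_of_pi_div_two_le_of_le hcon (by linarith)
  rw [h2] at h
  exact absurd h (not_lt.2 (mul_nonpos_of_nonneg_of_nonpos (norm_nonneg _) h3))

theorem re_mul_exp_pos {u : ℂ} {α : ℝ} (hu0 : u ≠ 0) (hu : |u.arg| < Real.pi / 2) (h0 : 0 < α)
    (h : u.arg + α < Real.pi / 2) : 0 < (u * Complex.exp (α * Complex.I)).re := by
  rw [abs_lt] at hu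
  have h2 : (u * Complex.exp (α * Complex.I)).re = ‖u‖ * Real.cos (u.arg + α) := by
    conv_lhs => rw [← Complex.norm_mul_exp_arg_mul_I u, mul_assoc, ← Complex.exp_add, ← add_mul,
      ← Complex.ofReal_add, Complex.re_ofReal_mul, Complex.exp_ofReal_mul_I_re]
  rw [h2]
  exact mul_pos (norm_pos_iff.2 hu0) (Real.cos_pos_of_mem_Ioo ⟨by linarith, h⟩)

theorem exp_mul_log_eq_rpow {t : ℝ} (ht : 0 < t) (κ : ℝ) : Real.exp (κ * Real.log t) = t ^ κ := by
  rw [Real.rpow_def_of_pos ht, mul_comm]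

variable {V : Type*} [NormedAddCommGroup V] [NormedSpace ℂ V] [FiniteDimensional ℂ V]

/-- A function that is holomorphic on a sector, `O(|x|^κ)` with `κ > -1` at the origin and of
polynomial growth has a Laplace transform.  Here `f` is the function in the coordinate `log x`. -/
theorem exists_isLaplace {f : ℂ → V} {δ : ℝ} (hδ : δ ≤ Real.pi / 2)
    (hf : DifferentiableOn ℂ f (strip δ))
    (hb : ∀ φ₁ φ₂ : ℝ, 0 < φ₁ → φ₂ < δ → ∃ C κ K : ℝ, -1 < κ ∧ -1 < K ∧
      ∀ ξ : ℂ, φ₁ ≤ ξ.im → ξ.im ≤ φ₂ →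
        ‖f ξ‖ ≤ C * (Real.exp (κ * ξ.re) + Real.exp (K * ξ.re))) :
    ∃ G : ℂ → V, IsLaplace δ (fun x => f (Complex.log x)) G := by
  classical
  have : CompleteSpace V := FiniteDimensional.complete ℂ V
  have hpi := Real.pi_pos
  have hlog : ∀ α t : ℝ, 0 < α → α < δ → 0 < t →
      Complex.log (t * Complex.exp (α * Complex.I)) = Real.log t + α * Complex.I :=
    fun α t h0 h1 ht => log_ray ht (by linarith) (by linarith)
  have hint : ∀ (u : ℂ) (α : ℝ), 0 < α → α < δ → 0 < (u * Complex.exp (α * Complex.I)).re →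
      IntegrableOn (fun t : ℝ => Complex.exp (-(u * Complex.exp (α * Complex.I) * t)) •
        f (Real.log t + α * Complex.I)) (Set.Ioi 0) := by
    intro u α h0 h1 hr
    obtain ⟨C, κ, K, hκ, hK, hC⟩ := hb α α h0 h1
    refine integrableOn_laplace (aestronglyMeasurable_ray hf.continuousOn h0 h1) (C := C) hκ hK
      (fun t ht => ?_) hr
    have := hC (Real.log t + α * Complex.I) (by simp) (by simp)
    simpa [exp_mul_log_eq_rpow ht] using this
  let J : ℂ → ℝ → V := fun u α => ∫ ρ : ℝ, logIntegrand f u (ρ + α * Complex.I)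
  have hJ : ∀ (u : ℂ) (α₁ α₂ : ℝ), |u.arg| < Real.pi / 2 → 0 < α₁ → α₁ ≤ α₂ → α₂ < δ →
      0 < (u * Complex.exp (α₂ * Complex.I)).re → J u α₁ = J u α₂ := by
    intro u α₁ α₂ hu h1 h12 h2 hr
    have hu0 : u ≠ 0 := by rintro rfl; simp at hr
    have h3 := add_lt_pi_div_two_of_re_pos hu (h1.trans_le h12) (h2.trans_le hδ) hr
    have hpos : ∀ α : ℝ, α₁ ≤ α → α ≤ α₂ → 0 < (u * Complex.exp (α * Complex.I)).re :=
      fun α h4 h5 => re_mul_exp_pos hu0 hu (h1.trans_le h4) (by linarith)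
    obtain ⟨C, κ, K, hκ, hK, hC⟩ := hb α₁ α₂ h1 h2
    exact integral_logIntegrand_eq h12 hκ hK
      (hf.mono fun ξ hξ => ⟨h1.trans_le hξ.1, hξ.2.trans_lt h2⟩) hC hpos
      (integrable_logIntegrand (hint u α₁ h1 (h12.trans_lt h2) (hpos _ le_rfl h12)))
      (integrable_logIntegrand (hint u α₂ (h1.trans_le h12) h2 hr))
  have hJ' : ∀ (u : ℂ) (α₁ α₂ : ℝ), |u.arg| < Real.pi / 2 → 0 < α₁ → α₁ < δ → 0 < α₂ → α₂ < δ →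
      0 < (u * Complex.exp (α₁ * Complex.I)).re → 0 < (u * Complex.exp (α₂ * Complex.I)).re →
      J u α₁ = J u α₂ := by
    intro u α₁ α₂ hu h1 h1' h2 h2' hr1 hr2
    rcases le_total α₁ α₂ with h | h
    · exact hJ u α₁ α₂ hu h1 h h2' hr2
    · exact (hJ u α₂ α₁ hu h2 h h1' hr1).symm
  refine ⟨fun u => if h : ∃ α : ℝ, 0 < α ∧ α < δ ∧ 0 < (u * Complex.exp (α * Complex.I)).re then
    u • J u h.choose else 0, ?_⟩
  intro u α hu h0 h1 hr φ
  have hi := hint u α h0 h1 hr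
  let φ' : V →L[ℂ] ℂ := LinearMap.toContinuousLinearMap φ
  have hφ : ∀ v, φ v = φ' v := fun _ => rfl
  have hcomm : ∀ t : ℝ, u * (t * Complex.exp (α * Complex.I)) =
      u * Complex.exp (α * Complex.I) * t := fun t => by ring
  constructor
  · refine (φ'.integrable_comp hi).congr ?_
    refine (ae_restrict_iff' measurableSet_Ioi).2 (Eventually.of_forall fun t ht => ?_)
    beta_reduce
    rw [hlog α t h0 h1 ht, hcomm, map_smul, smul_eq_mul, hφ]
  · have hex : ∃ α : ℝ, 0 < α ∧ α < δ ∧ 0 < (u * Complex.exp (α * Complex.I)).re :=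
      ⟨α, h0, h1, hr⟩
    have hs := hex.choose_spec
    simp only [dif_pos hex]
    rw [hJ' u _ α hu hs.1 hs.2.1 h0 h1 hs.2.2 hr, map_smul, smul_eq_mul]
    congr 1
    simp only [J]
    rw [← integral_ray_eq, hφ, ← ContinuousLinearMap.integral_comp_comm]
    · refine setIntegral_congr_fun measurableSet_Ioi fun t ht => ?_
      rw [hlog α t h0 h1 ht, hcomm, map_smul, smul_eq_mul, hφ]
      ring
    · refine (hi.smul (Complex.exp (α * Complex.I))).congr (Eventually.of_forall fun t => ?_)
      rw [Pi.smul_apply, smul_smul, mul_comm]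

end Laplace

section IsLaplace

variable {V V' : Type*} [AddCommGroup V] [Module ℂ V] [AddCommGroup V'] [Module ℂ V'] {δ : ℝ}

theorem IsLaplace.map {F G : ℂ → V} (h : IsLaplace δ F G) (T : V →ₗ[ℂ] V') :
    IsLaplace δ (fun x => T (F x)) (fun u => T (G u)) :=
  fun u α h1 h2 h3 h4 φ => h u α h1 h2 h3 h4 (φ ∘ₗ T)

theorem IsLaplace.congr {F F' G G' : ℂ → V} (h : IsLaplace δ F G)
    (hF : ∀ x ∈ sector δ, F x = F' x) (hδ : δ ≤ Real.pi) (hG : ∀ u, G u = G' u) :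
    IsLaplace δ F' G' := by
  obtain rfl : G = G' := funext hG
  intro u α h1 h2 h3 h4 φ
  have hmem : ∀ t : ℝ, t ∈ Set.Ioi (0 : ℝ) → F (t * Complex.exp (α * Complex.I)) =
      F' (t * Complex.exp (α * Complex.I)) := by
    intro t ht
    apply hF
    have : Complex.arg (t * Complex.exp (α * Complex.I)) = α := by
      rw [Complex.arg_real_mul _ ht, Complex.arg_exp_mul_I, toIocMod_eq_self]
      constructor <;> linarith
    rw [sector, Set.mem_ofPred_eq, this]
    exact ⟨h2, h3⟩
  obtain ⟨hi, he⟩ := h u α h1 h2 h3 h4 φ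
  constructor
  · exact hi.congr_fun (fun t ht => by simp only [hmem t ht]) measurableSet_Ioi
  · rw [he]
    congr 1
    exact setIntegral_congr_fun measurableSet_Ioi fun t ht => by simp only [hmem t ht]

theorem IsLaplace.sum {ι : Type*} (s : Finset ι) {F G : ι → ℂ → V}
    (h : ∀ i ∈ s, IsLaplace δ (F i) (G i)) :
    IsLaplace δ (fun x => ∑ i ∈ s, F i x) (fun u => ∑ i ∈ s, G i u) := by
  intro u α h1 h2 h3 h4 φ
  have hi := fun i (hi : i ∈ s) => h i hi u α h1 h2 h3 h4 φ
  simp only [map_sum, Finset.mul_sum, Finset.sum_mul]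
  refine ⟨integrable_finsetSum _ fun i his => (hi i his).1, ?_⟩
  rw [integral_finsetSum _ fun i his => (hi i his).1.mul_const _, Finset.mul_sum]
  exact Finset.sum_congr rfl fun i his => (hi i his).2

/-- Watson's lemma: a Laplace transform inherits the expansion of the original function at the
origin, term by term. -/
theorem hasExpansionAlong_of_isLaplace {F G : ℂ → V} {Freg S : ℕ → ℂ → V} {s : ℝ}
    (hδ0 : 0 < δ) (hδ : δ ≤ Real.pi / 2) (hs : 0 < s) (hG : IsLaplace δ F G)
    (hS : ∀ M, IsLaplace δ (Freg M) (S M))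
    (hb : ∀ (M : ℕ) (α : ℝ) (φ : V →ₗ[ℂ] ℂ), 0 < α → α < δ → ∃ C κ K : ℝ, s * M < κ ∧ s * M < K ∧
      ∀ t : ℝ, 0 < t → ‖φ (F (t * Complex.exp (α * Complex.I)) -
        Freg M (t * Complex.exp (α * Complex.I)))‖ ≤ C * (t ^ κ + t ^ K))
    {β : ℝ} (hβ : |β| < Real.pi / 2) : HasExpansionAlong s G S β := by
  intro M φ
  have hpi := Real.pi_pos
  obtain ⟨hβ1, hβ2⟩ := abs_lt.1 hβ
  obtain ⟨α, h0, hα⟩ : ∃ α : ℝ, 0 < α ∧ α < min δ (Real.pi / 2 - β) :=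
    exists_between (lt_min hδ0 (by linarith))
  have h1 : α < δ := hα.trans_le (min_le_left _ _)
  have h2 : β + α < Real.pi / 2 := by
    have := hα.trans_le (min_le_right _ _)
    linarith
  obtain ⟨C, κ, K, hκ, hK, hC⟩ := hb M α φ h0 h1
  have hsM : 0 ≤ s * M := by positivity
  set c := Real.cos (β + α) with hc
  have hc0 : 0 < c := Real.cos_pos_of_mem_Ioo ⟨by linarith, h2⟩
  have hmain : ∀ τ : ℝ, 0 < τ → ‖φ (G (τ * Complex.exp (β * Complex.I)) -
      S M (τ * Complex.exp (β * Complex.I)))‖ ≤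
      C * (c⁻¹ ^ (κ + 1) * Real.Gamma (κ + 1)) * τ ^ (-κ) +
        C * (c⁻¹ ^ (K + 1) * Real.Gamma (K + 1)) * τ ^ (-K) := by
    intro τ hτ
    set u : ℂ := τ * Complex.exp (β * Complex.I) with hu
    have harg : u.arg = β := by
      rw [hu, Complex.arg_real_mul _ hτ, Complex.arg_exp_mul_I, toIocMod_eq_self]
      constructor <;> linarith
    have hre : (u * Complex.exp (α * Complex.I)).re = τ * c := by
      rw [hu, mul_assoc, ← Complex.exp_add, ← add_mul, ← Complex.ofReal_add,
        Complex.re_ofReal_mul, Complex.exp_ofReal_mul_I_re]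
    have hr : 0 < (u * Complex.exp (α * Complex.I)).re := by rw [hre]; positivity
    obtain ⟨hi1, he1⟩ := hG u α (by rwa [harg]) h0 h1 hr φ
    obtain ⟨hi2, he2⟩ := hS M u α (by rwa [harg]) h0 h1 hr φ
    have hun : ‖u‖ = τ := by
      rw [hu, norm_mul, Complex.norm_exp_ofReal_mul_I, mul_one, Complex.norm_real,
        Real.norm_of_nonneg hτ.le]
    rw [map_sub, he1, he2, ← mul_sub, ← integral_sub (hi1.mul_const _) (hi2.mul_const _)]
    have h3 : ∀ t : ℝ, Complex.exp (-(u * (t * Complex.exp (α * Complex.I)))) *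
        φ (F (t * Complex.exp (α * Complex.I))) * Complex.exp (α * Complex.I) -
        Complex.exp (-(u * (t * Complex.exp (α * Complex.I)))) *
        φ (Freg M (t * Complex.exp (α * Complex.I))) * Complex.exp (α * Complex.I) =
        (Complex.exp (-(u * Complex.exp (α * Complex.I) * t)) •
          φ (F (t * Complex.exp (α * Complex.I)) - Freg M (t * Complex.exp (α * Complex.I)))) *
          Complex.exp (α * Complex.I) := by
      intro t
      rw [map_sub, smul_eq_mul, show u * (t * Complex.exp (α * Complex.I)) =
        u * Complex.exp (α * Complex.I) * t by ring]
      ring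
    simp only [h3]
    rw [integral_mul_const, norm_mul u, hun, norm_mul,
      Complex.norm_exp_ofReal_mul_I, mul_one]
    refine (mul_le_mul_of_nonneg_left
      (norm_laplace_le (by linarith) (by linarith) hC hr) hτ.le).trans (le_of_eq ?_)
    have h4 : ∀ k : ℝ, τ * (1 / (τ * c)) ^ (k + 1) = c⁻¹ ^ (k + 1) * τ ^ (-k) := by
      intro k
      rw [one_div, mul_inv, Real.mul_rpow (by positivity) (by positivity), Real.inv_rpow hτ.le,
        ← Real.rpow_neg hτ.le, show -k = 1 + -(k + 1) by ring, Real.rpow_add hτ, Real.rpow_one]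
      ring
    rw [hre, mul_left_comm, mul_add, ← mul_assoc, ← mul_assoc, h4, h4]
    ring
  have hlit : ∀ k : ℝ, s * M < k →
      (fun τ : ℝ => τ ^ (-k)) =o[atTop] fun τ : ℝ => τ ^ (-(s * M)) := by
    intro k hk
    refine Asymptotics.isLittleO_of_tendsto' ?_ ?_
    · filter_upwards [eventually_gt_atTop 0] with τ hτ h
      exact absurd h (Real.rpow_pos_of_pos hτ _).ne'
    · refine (tendsto_rpow_neg_atTop (sub_pos.2 hk)).congr' ?_
      filter_upwards [eventually_gt_atTop 0] with τ hτ
      rw [← Real.rpow_sub hτ]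
      congr 1
      ring
  refine Asymptotics.IsBigO.trans_isLittleO ?_
    (((hlit κ hκ).const_mul_left (C * (c⁻¹ ^ (κ + 1) * Real.Gamma (κ + 1)))).add
      ((hlit K hK).const_mul_left (C * (c⁻¹ ^ (K + 1) * Real.Gamma (K + 1)))))
  refine Asymptotics.IsBigO.of_bound 1 ?_
  filter_upwards [eventually_gt_atTop 0] with τ hτ
  rw [one_mul]
  exact (hmain τ hτ).trans (le_abs_self _)

end IsLaplace

/-! ### Mellin transforms of exponentials times powers of the logarithm -/

theorem abs_pow_le_exp_add {ε : ℝ} (hε : 0 < ε) (k : ℕ) (x : ℝ) :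
    |x| ^ k ≤ k.factorial / ε ^ k * (Real.exp (ε * x) + Real.exp (-ε * x)) := by
  have h1 := Real.pow_div_factorial_le_exp (ε * |x|) (by positivity) k
  have h2 : Real.exp (ε * |x|) ≤ Real.exp (ε * x) + Real.exp (-ε * x) := by
    have e1 := Real.exp_pos (ε * x)
    have e2 := Real.exp_pos (-ε * x)
    rcases abs_cases x with ⟨h, -⟩ | ⟨h, -⟩ <;> rw [h]
    · linarith
    · rw [mul_neg, ← neg_mul]
      linarith
  have h3 := h1.trans h2
  rw [mul_pow, div_le_iff₀ (by positivity)] at h3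
  rw [div_mul_eq_mul_div, le_div_iff₀ (by positivity)]
  linarith

/-- The function `(log t)^k e^{-rt}`. -/
def logPowExp (r : ℂ) (k : ℕ) (t : ℝ) : ℂ := (Real.log t : ℂ) ^ k * Complex.exp (-(r * t))

theorem norm_logPowExp_le {r : ℂ} {ε : ℝ} (hε : 0 < ε) (k : ℕ) {t : ℝ} (ht : 0 < t) :
    ‖logPowExp r k t‖ ≤ k.factorial / ε ^ k * (t ^ ε + t ^ (-ε)) * Real.exp (-(r.re * t)) := by
  rw [logPowExp, norm_mul, norm_pow, Complex.norm_real, norm_exp_neg_mul, Real.norm_eq_abs]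
  have := abs_pow_le_exp_add hε k (Real.log t)
  rw [exp_mul_log_eq_rpow ht, exp_mul_log_eq_rpow ht] at this
  gcongr

theorem logPowExp_isBigO_atTop {r : ℂ} (hr : 0 < r.re) (k : ℕ) (a : ℝ) :
    logPowExp r k =O[atTop] fun t : ℝ => t ^ (-a) := by
  have h1 : (fun t : ℝ => (t ^ (1 : ℝ) + t ^ (-1 : ℝ)) * Real.exp (-(r.re * t))) =O[atTop]
      fun t : ℝ => t ^ (-a) := by
    have h2 : (fun t : ℝ => t ^ (1 : ℝ) + t ^ (-1 : ℝ)) =O[atTop] fun t : ℝ => t ^ (1 : ℝ) := by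
      refine Asymptotics.IsBigO.of_bound 2 ?_
      filter_upwards [eventually_ge_atTop 1] with t ht
      have e1 : t ^ (-1 : ℝ) ≤ t ^ (1 : ℝ) := Real.rpow_le_rpow_of_exponent_le ht (by norm_num)
      have e2 : 0 < t ^ (-1 : ℝ) := Real.rpow_pos_of_pos (by linarith) _
      have e3 : 0 < t ^ (1 : ℝ) := Real.rpow_pos_of_pos (by linarith) _
      rw [Real.norm_of_nonneg (add_pos e3 e2).le, Real.norm_of_nonneg e3.le, two_mul]
      exact add_le_add_right e1 _
    have h3 := h2.mul (isLittleO_exp_neg_mul_rpow_atTop hr (-a - 1)).isBigO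
    refine (h3.congr_left fun t => by rw [neg_mul]).congr' (EventuallyEq.refl _ _) ?_
    filter_upwards [eventually_gt_atTop 0] with t ht
    rw [← Real.rpow_add ht]
    congr 1
    ring
  refine Asymptotics.IsBigO.trans (Asymptotics.IsBigO.of_bound (k.factorial / 1 ^ k) ?_) h1
  filter_upwards [eventually_gt_atTop 0] with t ht
  refine (norm_logPowExp_le one_pos k ht).trans (le_of_eq ?_)
  rw [Real.norm_of_nonneg (by positivity)]
  ring

theorem logPowExp_isBigO_zero {r : ℂ} (hr : 0 < r.re) (k : ℕ) {b : ℝ} (hb : 0 < b) :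
    logPowExp r k =O[𝓝[>] 0] fun t : ℝ => t ^ (-b) := by
  refine Asymptotics.IsBigO.of_bound (k.factorial / b ^ k * 2) ?_
  filter_upwards [Ioo_mem_nhdsGT one_pos] with t ht
  refine (norm_logPowExp_le hb k ht.1).trans ?_
  rw [Real.norm_of_nonneg (Real.rpow_nonneg ht.1.le _), mul_assoc, mul_assoc]
  refine mul_le_mul_of_nonneg_left ?_ (by positivity)
  have e1 : t ^ b ≤ t ^ (-b) :=
    Real.rpow_le_rpow_of_exponent_ge ht.1 ht.2.le (by linarith)
  have e2 : Real.exp (-(r.re * t)) ≤ 1 := Real.exp_le_one_iff.2 (by nlinarith [ht.1])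
  have e3 : 0 ≤ t ^ b := Real.rpow_nonneg ht.1.le _
  calc (t ^ b + t ^ (-b)) * Real.exp (-(r.re * t)) ≤ (t ^ b + t ^ (-b)) * 1 := by gcongr; linarith
    _ ≤ 2 * t ^ (-b) := by linarith

theorem locallyIntegrableOn_logPowExp (r : ℂ) (k : ℕ) :
    LocallyIntegrableOn (logPowExp r k) (Set.Ioi 0) := by
  refine ContinuousOn.locallyIntegrableOn ?_ measurableSet_Ioi
  refine ContinuousOn.mul (ContinuousOn.pow ?_ k) (by fun_prop)
  exact Complex.continuous_ofReal.comp_continuousOn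
    (Real.continuousOn_log.mono fun t ht => (Set.mem_Ioi.1 ht).ne')

theorem mellinConvergent_logPowExp {r : ℂ} (hr : 0 < r.re) (k : ℕ) {w : ℂ} (hw : 0 < w.re) :
    MellinConvergent (logPowExp r k) w :=
  mellinConvergent_of_isBigO_rpow (locallyIntegrableOn_logPowExp r k)
    (logPowExp_isBigO_atTop hr k (w.re + 1)) (by linarith)
    (logPowExp_isBigO_zero hr k (half_pos hw)) (by linarith)

theorem hasDerivAt_mellin_logPowExp {r : ℂ} (hr : 0 < r.re) (k : ℕ) {w : ℂ} (hw : 0 < w.re) :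
    HasDerivAt (mellin (logPowExp r k)) (mellin (logPowExp r (k + 1)) w) w := by
  have h := (mellin_hasDerivAt_of_isBigO_rpow (locallyIntegrableOn_logPowExp r k)
    (logPowExp_isBigO_atTop hr k (w.re + 1)) (by linarith)
    (logPowExp_isBigO_zero hr k (half_pos hw)) (by linarith)).2
  have h2 : (fun t : ℝ => Real.log t • logPowExp r k t) = logPowExp r (k + 1) := by
    ext t
    rw [logPowExp, logPowExp, Complex.real_smul, pow_succ]
    ring
  rwa [h2] at h

theorem iteratedDeriv_mellin_logPowExp {r : ℂ} (hr : 0 < r.re) (k : ℕ) :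
    ∀ w : ℂ, 0 < w.re → iteratedDeriv k (mellin (logPowExp r 0)) w = mellin (logPowExp r k) w := by
  induction k with
  | zero => intro w _; rw [iteratedDeriv_zero]
  | succ k ih =>
    intro w hw
    rw [iteratedDeriv_succ]
    have h1 : iteratedDeriv k (mellin (logPowExp r 0)) =ᶠ[𝓝 w] mellin (logPowExp r k) := by
      filter_upwards [(isOpen_lt continuous_const Complex.continuous_re).mem_nhds hw] with x hx
      exact ih x hx
    rw [h1.deriv_eq, (hasDerivAt_mellin_logPowExp hr k hw).deriv]

/-- The Gamma integral with a complex rate `r`, obtained from the real one by turning the ray of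
integration. -/
theorem mellin_logPowExp_zero {r : ℂ} (hr : 0 < r.re) {w : ℂ} (hw : 0 < w.re) :
    mellin (logPowExp r 0) w = Complex.Gamma w * Complex.exp (-(w * Complex.log r)) := by
  have hpi := Real.pi_pos
  have hr0 : r ≠ 0 := by rintro rfl; simp at hr
  have hn : 0 < ‖r‖ := norm_pos_iff.2 hr0
  have hψ : |r.arg| < Real.pi / 2 := Complex.abs_arg_lt_pi_div_two_iff.2 (Or.inl hr)
  obtain ⟨hψ1, hψ2⟩ := abs_lt.1 hψ
  set f : ℂ → ℂ := fun ξ => Complex.exp ((w - 1) * ξ) with hf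
  have hray : ∀ (α : ℝ), ∀ t ∈ Set.Ioi (0 : ℝ), f (Real.log t + α * Complex.I) =
      Complex.exp ((w - 1) * (α * Complex.I)) * (t : ℂ) ^ (w - 1) := by
    intro α t ht
    have ht0 : (t : ℂ) ≠ 0 := Complex.ofReal_ne_zero.2 (Set.mem_Ioi.1 ht).ne'
    simp only [hf]
    rw [Complex.cpow_def_of_ne_zero ht0, ← Complex.ofReal_log (Set.mem_Ioi.1 ht).le,
      ← Complex.exp_add]
    congr 1
    ring
  have hre : ∀ α : ℝ, ((‖r‖ : ℂ) * Complex.exp (α * Complex.I)).re = ‖r‖ * Real.cos α := by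
    intro α
    rw [Complex.re_ofReal_mul, Complex.exp_ofReal_mul_I_re]
  have hpos : ∀ α : ℝ, -(Real.pi / 2) < α → α < Real.pi / 2 →
      0 < ((‖r‖ : ℂ) * Complex.exp (α * Complex.I)).re := fun α h1 h2 => by
    rw [hre]
    exact mul_pos hn (Real.cos_pos_of_mem_Ioo ⟨h1, h2⟩)
  have hint : ∀ α : ℝ, -(Real.pi / 2) < α → α < Real.pi / 2 →
      Integrable fun ρ : ℝ => logIntegrand f ‖r‖ (ρ + α * Complex.I) := by
    intro α h1 h2
    refine integrable_logIntegrand ?_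
    have h3 := (mellinConvergent_logPowExp (hpos α h1 h2) 0 hw).const_mul
      (Complex.exp ((w - 1) * (α * Complex.I)))
    refine IntegrableOn.congr_fun h3 (fun t ht => ?_) measurableSet_Ioi
    rw [hray α t ht, logPowExp]
    simp only [pow_zero, one_mul, smul_eq_mul]
    ring
  have hle : ∀ α₁ α₂ : ℝ, -(Real.pi / 2) < α₁ → α₂ < Real.pi / 2 → α₁ ≤ α₂ →
      ∫ ρ : ℝ, logIntegrand f ‖r‖ (ρ + α₁ * Complex.I) =
        ∫ ρ : ℝ, logIntegrand f ‖r‖ (ρ + α₂ * Complex.I) := by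
    intro α₁ α₂ h1 h2 h12
    refine integral_logIntegrand_eq h12 (C := Real.exp (|w.im| * (Real.pi / 2)))
      (κ := w.re - 1) (K := w.re - 1) (by linarith) (by linarith)
      (by simp only [hf]; fun_prop) (fun ξ h3 h4 => ?_)
      (fun α h3 h4 => hpos α (h1.trans_le h3) (h4.trans_lt h2))
      (hint α₁ h1 (h12.trans_lt h2)) (hint α₂ (h1.trans_le h12) h2)
    have h5 : |ξ.im| ≤ Real.pi / 2 := abs_le.2 ⟨by linarith, by linarith⟩
    have h6 : -(w.im * ξ.im) ≤ |w.im| * (Real.pi / 2) :=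
      (neg_le_abs _).trans (by rw [abs_mul]; gcongr)
    rw [hf, Complex.norm_exp]
    have h7 : ((w - 1) * ξ).re = (w.re - 1) * ξ.re - w.im * ξ.im := by
      rw [Complex.mul_re]
      simp
    rw [h7]
    calc Real.exp ((w.re - 1) * ξ.re - w.im * ξ.im) ≤
          Real.exp (|w.im| * (Real.pi / 2)) * Real.exp ((w.re - 1) * ξ.re) := by
          rw [← Real.exp_add]
          exact Real.exp_le_exp.2 (by linarith)
      _ ≤ _ := by
          have := Real.exp_pos ((w.re - 1) * ξ.re)
          gcongr
          linarith
  have hturn : ∫ ρ : ℝ, logIntegrand f ‖r‖ (ρ + r.arg * Complex.I) =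
      ∫ ρ : ℝ, logIntegrand f ‖r‖ (ρ + (0 : ℝ) * Complex.I) := by
    rcases le_total r.arg 0 with h | h
    · exact hle _ _ hψ1 (by linarith) h
    · exact (hle _ _ (by linarith) hψ2 h).symm
  rw [← integral_ray_eq, ← integral_ray_eq] at hturn
  have h1 : ∫ t : ℝ in Set.Ioi 0,
      (Complex.exp (-((‖r‖ : ℂ) * Complex.exp (r.arg * Complex.I) * t)) *
      Complex.exp (r.arg * Complex.I)) • f (Real.log t + r.arg * Complex.I) =
      Complex.exp (w * (r.arg * Complex.I)) * mellin (logPowExp r 0) w := by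
    rw [mellin, ← integral_const_mul]
    refine setIntegral_congr_fun measurableSet_Ioi fun t ht => ?_
    rw [hray _ t ht, Complex.norm_mul_exp_arg_mul_I, logPowExp,
      show w * (r.arg * Complex.I) = r.arg * Complex.I + (w - 1) * (r.arg * Complex.I) by ring,
      Complex.exp_add]
    simp only [pow_zero, one_mul, smul_eq_mul]
    ring
  have h2 : ∫ t : ℝ in Set.Ioi 0,
      (Complex.exp (-((‖r‖ : ℂ) * Complex.exp ((0 : ℝ) * Complex.I) * t)) *
      Complex.exp ((0 : ℝ) * Complex.I)) • f (Real.log t + (0 : ℝ) * Complex.I) =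
      (1 / (‖r‖ : ℂ)) ^ w * Complex.Gamma w := by
    rw [← Complex.integral_cpow_mul_exp_neg_mul_Ioi hw hn]
    refine setIntegral_congr_fun measurableSet_Ioi fun t ht => ?_
    rw [hray _ t ht]
    simp [mul_comm]
  rw [h1, h2] at hturn
  have hn0 : (‖r‖ : ℂ) ≠ 0 := Complex.ofReal_ne_zero.2 hn.ne'
  have h3 : (1 / (‖r‖ : ℂ)) ^ w = Complex.exp (-(w * Real.log ‖r‖)) := by
    rw [Complex.cpow_def_of_ne_zero (one_div_ne_zero hn0), one_div, ← Complex.ofReal_inv,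
      ← Complex.ofReal_log (by positivity), Real.log_inv]
    congr 1
    push_cast
    ring
  have h4 : Complex.log r = Real.log ‖r‖ + r.arg * Complex.I := rfl
  rw [h4, mul_add, neg_add, Complex.exp_add, ← h3]
  have h5 : Complex.exp (-(w * (r.arg * Complex.I))) *
      Complex.exp (w * (r.arg * Complex.I)) = 1 := by
    rw [← Complex.exp_add, neg_add_cancel, Complex.exp_zero]
  linear_combination Complex.exp (-(w * (r.arg * Complex.I))) * hturn -
    mellin (logPowExp r 0) w * h5

/-! ### Exponentials of nilpotent elements and the transform of a single term -/

section NilExp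

variable {A : Type*} [NormedCommRing A] [NormedAlgebra ℂ A]

theorem exp_eq_sum_of_pow_eq_zero {a : A} {N : ℕ} (h : a ^ N = 0) :
    NormedSpace.exp a = ∑ i ∈ Finset.range N, ((i.factorial : ℂ)⁻¹) • a ^ i := by
  rw [NormedSpace.exp_eq_tsum ℂ]
  refine tsum_eq_sum fun i hi => ?_
  rw [Finset.mem_range, not_lt] at hi
  rw [pow_eq_zero_of_le hi h, smul_zero]

theorem exp_add_algebra [CompleteSpace A] (a b : A) :
    NormedSpace.exp (a + b) = NormedSpace.exp a * NormedSpace.exp b := by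
  let : NormedAlgebra ℚ A := NormedAlgebra.restrictScalars ℚ ℂ A
  exact NormedSpace.exp_add

theorem iteratedDeriv_cexp_mul (c : ℂ) (i : ℕ) (w : ℂ) :
    iteratedDeriv i (fun x => Complex.exp (c * x)) w = c ^ i * Complex.exp (c * w) := by
  have := iteratedDeriv_cexp_const_mul i c
  exact congrFun this w

theorem nilEval_cexp_mul {a : A} (ha : IsNilpotent a) (c w : ℂ) :
    nilEval (fun x => Complex.exp (c * x)) w a = Complex.exp (c * w) • NormedSpace.exp (c • a) := by
  obtain ⟨N, hN⟩ := ha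
  rw [nilEval_eq_sum _ _ hN, exp_eq_sum_of_pow_eq_zero (N := N) (by rw [smul_pow, hN, smul_zero]),
    Finset.smul_sum]
  refine Finset.sum_congr rfl fun i _ => ?_
  rw [iteratedDeriv_cexp_mul, smul_pow, smul_smul, smul_smul]
  congr 1
  ring

theorem nilEval_cexp {a : A} (ha : IsNilpotent a) (w : ℂ) :
    nilEval Complex.exp w a = Complex.exp w • NormedSpace.exp a := by
  simpa using nilEval_cexp_mul ha 1 w

/-- The exponential of a multiple of a nilpotent element grows subexponentially. -/
theorem exists_norm_exp_smul_le {a : A} (ha : IsNilpotent a) (Δ : ℝ) {ε : ℝ} (hε : 0 < ε) :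
    ∃ C : ℝ, 0 ≤ C ∧ ∀ ξ : ℂ, |ξ.im| ≤ Δ →
      ‖NormedSpace.exp (ξ • a)‖ ≤ C * (Real.exp (ε * ξ.re) + Real.exp (-ε * ξ.re)) := by
  obtain ⟨N, hN⟩ := ha
  have key : ∀ i : ℕ, ∃ C : ℝ, 0 ≤ C ∧ ∀ ξ : ℂ, |ξ.im| ≤ Δ →
      ‖((i.factorial : ℂ)⁻¹) • (ξ • a) ^ i‖ ≤
        C * (Real.exp (ε * ξ.re) + Real.exp (-ε * ξ.re)) := by
    intro i
    refine ⟨i.factorial / ε ^ i * Real.exp (ε * |Δ|) * ‖a ^ i‖, by positivity, fun ξ hξ => ?_⟩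
    have h1 := abs_pow_le_exp_add hε i ξ.re
    rw [norm_smul, smul_pow, norm_smul, norm_pow, norm_inv, Complex.norm_natCast]
    have h2 : (1 : ℝ) ≤ i.factorial := by exact_mod_cast i.factorial_pos
    have h3 : ‖ξ‖ ^ i ≤ i.factorial / ε ^ i * Real.exp (ε * |Δ|) *
        (Real.exp (ε * ξ.re) + Real.exp (-ε * ξ.re)) := by
      have h4 : ‖ξ‖ ≤ |ξ.re| + |Δ| :=
        (Complex.norm_le_abs_re_add_abs_im ξ).trans
          (add_le_add_right (hξ.trans (le_abs_self Δ)) _)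
      have h5 := Real.pow_div_factorial_le_exp (ε * (|ξ.re| + |Δ|)) (by positivity) i
      rw [mul_pow, div_le_iff₀ (by positivity)] at h5
      have h6 : Real.exp (ε * |ξ.re|) ≤ Real.exp (ε * ξ.re) + Real.exp (-ε * ξ.re) := by
        have e1 := Real.exp_pos (ε * ξ.re)
        have e2 := Real.exp_pos (-ε * ξ.re)
        rcases abs_cases ξ.re with ⟨h, -⟩ | ⟨h, -⟩ <;> rw [h]
        · linarith
        · rw [mul_neg, ← neg_mul]
          linarith
      calc ‖ξ‖ ^ i ≤ (|ξ.re| + |Δ|) ^ i := by gcongr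
        _ ≤ Real.exp (ε * (|ξ.re| + |Δ|)) * i.factorial / ε ^ i := by
          rw [le_div_iff₀ (by positivity)]
          linarith
        _ = i.factorial / ε ^ i * Real.exp (ε * |Δ|) * Real.exp (ε * |ξ.re|) := by
          rw [mul_add, Real.exp_add]
          ring
        _ ≤ _ := by gcongr
    calc (i.factorial : ℝ)⁻¹ * (‖ξ‖ ^ i * ‖a ^ i‖) ≤ 1 * (‖ξ‖ ^ i * ‖a ^ i‖) := by
          gcongr
          exact inv_le_one_of_one_le₀ h2
      _ ≤ 1 * ((i.factorial / ε ^ i * Real.exp (ε * |Δ|) *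
        (Real.exp (ε * ξ.re) + Real.exp (-ε * ξ.re))) * ‖a ^ i‖) := by gcongr
      _ = _ := by ring
  choose C hC0 hC using key
  refine ⟨∑ i ∈ Finset.range N, C i, Finset.sum_nonneg fun i _ => hC0 i, fun ξ hξ => ?_⟩
  rw [exp_eq_sum_of_pow_eq_zero (N := N) (by rw [smul_pow, hN, smul_zero]), Finset.sum_mul]
  exact (norm_sum_le _ _).trans (Finset.sum_le_sum fun i _ => hC i ξ hξ)

theorem differentiable_exp_smul [CompleteSpace A] (a : A) :
    Differentiable ℂ fun ξ : ℂ => NormedSpace.exp (ξ • a) :=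
  fun ξ => (hasDerivAt_exp_smul_const a ξ).differentiableAt

/-- The Gamma integral with a nilpotent exponent, regularized by the reciprocal Gamma function. -/
theorem integral_exp_smul_ray [FiniteDimensional ℂ A] {a : A} (ha : IsNilpotent a) {σ : ℝ}
    (hσ : -1 < σ) {r : ℂ} (hr : 0 < r.re) :
    nilEval (fun w => (Complex.Gamma w)⁻¹) (1 + σ) a *
      ∫ t : ℝ in Set.Ioi 0, Complex.exp (-(r * t)) •
        (Complex.exp (σ * Real.log t) • NormedSpace.exp ((Real.log t : ℂ) • a)) =
      Complex.exp (-(σ + 1) * Complex.log r) • NormedSpace.exp ((-Complex.log r) • a) := by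
  have : CompleteSpace A := FiniteDimensional.complete ℂ A
  obtain ⟨N, hN⟩ := id ha
  have hσ1 : 0 < ((σ : ℂ) + 1).re := by simp; linarith
  have hset : {w : ℂ | 0 < (w + 1).re} ∈ 𝓝 (σ : ℂ) :=
    (isOpen_lt continuous_const (Complex.continuous_re.comp (continuous_add_const 1))).mem_nhds hσ1
  set m : ℂ → ℂ := fun w => Complex.Gamma (w + 1) * Complex.exp (-((w + 1) * Complex.log r)) with hm
  have hm1 : (fun w => mellin (logPowExp r 0) (w + 1)) =ᶠ[𝓝 (σ : ℂ)] m := by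
    filter_upwards [hset] with w hw
    exact mellin_logPowExp_zero hr hw
  have hGan : AnalyticAt ℂ (fun w : ℂ => Complex.Gamma (w + 1)) σ := by
    refine DifferentiableOn.analyticAt (s := {w : ℂ | 0 < (w + 1).re}) (fun w hw => ?_) hset
    refine (DifferentiableAt.comp w (Complex.differentiableAt_Gamma _ fun k hk => ?_)
      (by fun_prop)).differentiableWithinAt
    have hw' : 0 < (w + 1).re := hw
    rw [hk] at hw'
    simp at hw'
    linarith [(Nat.cast_nonneg k : (0 : ℝ) ≤ k)]
  have hman : AnalyticAt ℂ m σ := by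
    refine hGan.mul ?_
    have : Differentiable ℂ fun w : ℂ => Complex.exp (-((w + 1) * Complex.log r)) := by fun_prop
    exact this.analyticAt _
  have hterm : ∀ i : ℕ, ∀ t ∈ Set.Ioi (0 : ℝ), (t : ℂ) ^ ((σ : ℂ) + 1 - 1) • logPowExp r i t =
      Complex.exp (-(r * t)) * Complex.exp (σ * Real.log t) * (Real.log t : ℂ) ^ i := by
    intro i t ht
    rw [add_sub_cancel_right, logPowExp,
      Complex.cpow_def_of_ne_zero (Complex.ofReal_ne_zero.2 (Set.mem_Ioi.1 ht).ne'),
      ← Complex.ofReal_log (Set.mem_Ioi.1 ht).le, smul_eq_mul, mul_comm (Real.log t : ℂ) (σ : ℂ)]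
    ring
  have hint : ∀ i : ℕ, IntegrableOn (fun t : ℝ => Complex.exp (-(r * t)) *
      Complex.exp (σ * Real.log t) * (Real.log t : ℂ) ^ i) (Set.Ioi 0) := fun i =>
    (mellinConvergent_logPowExp hr i hσ1).congr_fun (hterm i) measurableSet_Ioi
  have hval : ∀ i : ℕ, ∫ t : ℝ in Set.Ioi 0, Complex.exp (-(r * t)) *
      Complex.exp (σ * Real.log t) * (Real.log t : ℂ) ^ i = iteratedDeriv i m σ := by
    intro i
    rw [← hm1.iteratedDeriv_eq, iteratedDeriv_comp_add_const]
    beta_reduce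
    rw [iteratedDeriv_mellin_logPowExp hr i _ hσ1, mellin]
    exact (setIntegral_congr_fun measurableSet_Ioi (hterm i)).symm
  have hI : ∫ t : ℝ in Set.Ioi 0, Complex.exp (-(r * t)) •
      (Complex.exp (σ * Real.log t) • NormedSpace.exp ((Real.log t : ℂ) • a)) =
      nilEval m σ a := by
    rw [nilEval_eq_sum _ _ hN]
    have h1 : ∀ t : ℝ, Complex.exp (-(r * t)) •
        (Complex.exp (σ * Real.log t) • NormedSpace.exp ((Real.log t : ℂ) • a)) =
        ∑ i ∈ Finset.range N, (Complex.exp (-(r * t)) * Complex.exp (σ * Real.log t) *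
          (Real.log t : ℂ) ^ i) • (((i.factorial : ℂ)⁻¹) • a ^ i) := by
      intro t
      rw [exp_eq_sum_of_pow_eq_zero (N := N) (by rw [smul_pow, hN, smul_zero]), smul_smul,
        Finset.smul_sum]
      refine Finset.sum_congr rfl fun i _ => ?_
      rw [smul_pow, smul_smul, smul_smul, smul_smul]
      congr 1
      ring
    simp only [h1]
    rw [integral_finsetSum _ fun i _ => (hint i).smul_const _]
    refine Finset.sum_congr rfl fun i _ => ?_
    rw [integral_smul_const, hval, smul_smul, div_eq_mul_inv]
  rw [hI, add_comm (1 : ℂ), ← nilEval_comp_add, ← nilEval_mul _ hman ha]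
  · have h2 : (fun w : ℂ => (Complex.Gamma (w + 1))⁻¹ * m w) =ᶠ[𝓝 (σ : ℂ)]
        fun w => Complex.exp (-Complex.log r) * Complex.exp (-Complex.log r * w) := by
      filter_upwards [hset] with w hw
      rw [hm]
      beta_reduce
      rw [inv_mul_cancel_left₀ (Complex.Gamma_ne_zero_of_re_pos hw), ← Complex.exp_add]
      congr 1
      ring
    rw [nilEval_congr h2, nilEval_mul analyticAt_const _ ha, nilEval_cexp_mul ha]
    · have h3 : nilEval (fun _ => Complex.exp (-Complex.log r)) (σ : ℂ) a =
          algebraMap ℂ A (Complex.exp (-Complex.log r)) := by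
        have h4 : a ^ (N + 1) = 0 := by rw [pow_succ, hN, zero_mul]
        rw [nilEval_eq_sum _ _ h4, Finset.sum_range_succ', Finset.sum_eq_zero]
        · simp [Algebra.smul_def]
        · intro i _
          simp [iteratedDeriv_const]
      rw [h3, ← Algebra.smul_def, smul_smul, ← Complex.exp_add]
      congr 2
      ring
    · have : Differentiable ℂ fun w : ℂ => Complex.exp (-Complex.log r * w) := by fun_prop
      exact this.analyticAt _
  · exact (analyticAt_inv_Gamma _).fun_comp (analyticAt_id.add analyticAt_const)

/-- The Laplace transform of `x^{σ + a} / Γ(1 + σ + a)` is `u^{-σ - a}`, for nilpotent `a`. -/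
theorem isLaplace_term [FiniteDimensional ℂ A] {a : A} (ha : IsNilpotent a) {σ : ℝ} (hσ : 0 ≤ σ)
    {δ : ℝ} (hδ : δ ≤ Real.pi / 2) :
    IsLaplace δ (fun x => nilEval (fun w => (Complex.Gamma w)⁻¹) (1 + σ) a *
        (Complex.exp (σ * Complex.log x) • NormedSpace.exp (Complex.log x • a)))
      (fun u => Complex.exp (-σ * Complex.log u) • NormedSpace.exp ((-Complex.log u) • a)) := by
  have : CompleteSpace A := FiniteDimensional.complete ℂ A
  have hpi := Real.pi_pos
  intro u α hu h0 h1 hr φ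
  have hu0 : u ≠ 0 := by rintro rfl; simp at hr
  have hsum := add_lt_pi_div_two_of_re_pos hu h0 (h1.trans_le hδ) hr
  obtain ⟨hu1, hu2⟩ := abs_lt.1 hu
  set r := u * Complex.exp (α * Complex.I) with hrdef
  have hlogr : Complex.log r = Complex.log u + α * Complex.I := by
    have h2 : r = Complex.exp (Complex.log u + α * Complex.I) := by
      rw [Complex.exp_add, Complex.exp_log hu0]
    rw [h2, Complex.log_exp] <;> simp [Complex.log_im] <;> linarith
  set R := nilEval (fun w => (Complex.Gamma w)⁻¹) (1 + σ) a
  set c : A := Complex.exp (σ * (α * Complex.I)) • NormedSpace.exp ((α * Complex.I) • a) with hc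
  have hray : ∀ t ∈ Set.Ioi (0 : ℝ), ∀ T : ℂ, T = t * Complex.exp (α * Complex.I) →
      Complex.exp (σ * Complex.log T) • NormedSpace.exp (Complex.log T • a) =
      c * (Complex.exp (σ * Real.log t) • NormedSpace.exp ((Real.log t : ℂ) • a)) := by
    rintro t ht T rfl
    rw [log_ray ht (by linarith) (by linarith), hc, smul_mul_smul_comm, ← Complex.exp_add,
      ← exp_add_algebra, ← add_smul]
    congr 2 <;> ring_nf
  have hint : IntegrableOn (fun t : ℝ => Complex.exp (-(r * t)) •
      (Complex.exp (σ * Real.log t) • NormedSpace.exp ((Real.log t : ℂ) • a))) (Set.Ioi 0) := by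
    obtain ⟨C, hC0, hC⟩ := exists_norm_exp_smul_le ha 0 (ε := 1 / 2) (by norm_num)
    refine integrableOn_laplace (C := C) (κ := σ + 1 / 2) (K := σ - 1 / 2) ?_ (by linarith)
      (by linarith) (fun t ht => ?_) hr
    · refine ContinuousOn.aestronglyMeasurable ?_ measurableSet_Ioi
      have hl : ContinuousOn (fun t : ℝ => (Real.log t : ℂ)) (Set.Ioi 0) :=
        Complex.continuous_ofReal.comp_continuousOn
          (Real.continuousOn_log.mono fun t ht => (Set.mem_Ioi.1 ht).ne')
      exact ((continuousOn_const.mul hl).cexp).smul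
        ((differentiable_exp_smul a).continuous.comp_continuousOn hl)
    · rw [norm_smul, Complex.norm_exp, ← Complex.ofReal_mul, Complex.ofReal_re,
        exp_mul_log_eq_rpow ht]
      have h2 := hC (Real.log t) (by simp)
      rw [Complex.ofReal_re, exp_mul_log_eq_rpow ht, exp_mul_log_eq_rpow ht] at h2
      calc t ^ σ * ‖NormedSpace.exp ((Real.log t : ℂ) • a)‖ ≤
            t ^ σ * (C * (t ^ (1 / 2 : ℝ) + t ^ (-(1 / 2) : ℝ))) := by gcongr
        _ = _ := by
            rw [Real.rpow_add ht, sub_eq_add_neg, Real.rpow_add ht]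
            ring
  have hmul := integral_exp_smul_ray ha (by linarith : -1 < σ) hr
  -- the functional `φ` applied after multiplication by the constants
  let ψ : A →L[ℂ] ℂ := LinearMap.toContinuousLinearMap (φ ∘ₗ LinearMap.mulLeft ℂ (R * c))
  have hψ : ∀ v, ψ v = φ (R * c * v) := fun v => rfl
  have hpt : ∀ t ∈ Set.Ioi (0 : ℝ), ψ (Complex.exp (-(r * t)) •
      (Complex.exp (σ * Real.log t) • NormedSpace.exp ((Real.log t : ℂ) • a))) =
      Complex.exp (-(u * (t * Complex.exp (α * Complex.I)))) * φ (R *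
        (Complex.exp (σ * Complex.log (t * Complex.exp (α * Complex.I))) •
          NormedSpace.exp (Complex.log (t * Complex.exp (α * Complex.I)) • a))) := by
    intro t ht
    rw [hray t ht _ rfl, map_smul, hψ, smul_eq_mul, mul_assoc R, hrdef,
      show u * Complex.exp (α * Complex.I) * t = u * (t * Complex.exp (α * Complex.I)) by ring]
  constructor
  · exact IntegrableOn.congr_fun (ψ.integrable_comp hint) hpt measurableSet_Ioi
  · have h2 : ∫ t : ℝ in Set.Ioi 0, Complex.exp (-(u * (t * Complex.exp (α * Complex.I)))) * φ (R *
        (Complex.exp (σ * Complex.log (t * Complex.exp (α * Complex.I))) •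
          NormedSpace.exp (Complex.log (t * Complex.exp (α * Complex.I)) • a))) *
          Complex.exp (α * Complex.I) =
        φ (c * (Complex.exp (-(σ + 1) * Complex.log r) • NormedSpace.exp ((-Complex.log r) • a))) *
          Complex.exp (α * Complex.I) := by
      rw [integral_mul_const, ← setIntegral_congr_fun measurableSet_Ioi hpt,
        ContinuousLinearMap.integral_comp_comm ψ hint, hψ, ← hmul]
      congr 2
      ring
    rw [h2, hc, smul_mul_smul_comm, ← exp_add_algebra, ← add_smul, ← Complex.exp_add, hlogr,
      map_smul, map_smul, smul_eq_mul, smul_eq_mul]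
    have h3 : (α : ℂ) * Complex.I + -(Complex.log u + α * Complex.I) = -Complex.log u := by ring
    rw [h3]
    have h4 : Complex.exp (σ * (α * Complex.I) + -(σ + 1) * (Complex.log u + α * Complex.I)) *
        Complex.exp (α * Complex.I) * u = Complex.exp (-σ * Complex.log u) := by
      conv_lhs => rw [← Complex.exp_log hu0, ← Complex.exp_add, Complex.log_exp
        (by rw [Complex.log_im]; linarith) (by rw [Complex.log_im]; linarith), ← Complex.exp_add]
      congr 1
      ring
    rw [← h4]
    ring

end NilExp

/-! ### The recursion of the regularized hypergeometric series -/

theorem natDegree_coeff_prod_X_add_C {A : Type*} [CommRing A] {ι : Type*} (s : Finset ι)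
    (β : ι → A) : (∏ i ∈ s, (Polynomial.X + Polynomial.C (β i))).natDegree ≤ s.card ∧
      (∏ i ∈ s, (Polynomial.X + Polynomial.C (β i))).coeff s.card = 1 := by
  have h1 : ∀ i ∈ s, (Polynomial.X + Polynomial.C (β i)).natDegree ≤ 1 := fun i _ =>
    (Polynomial.natDegree_add_le _ _).trans (by simp [Polynomial.natDegree_X_le])
  constructor
  · refine (Polynomial.natDegree_prod_le _ _).trans ((Finset.sum_le_sum h1).trans ?_)
    simp
  · have := Polynomial.coeff_prod_of_natDegree_le s _ 1 h1
    simpa [Polynomial.coeff_X, Polynomial.coeff_C] using this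

section Recursion

variable {m : ℕ}

/-- The limit ratio of consecutive coefficients of the regularized series, that is, the reciprocal
of its singular point. -/
def leadRatio (e : Fin m → ℤ) (E : ℕ) (z : ℂ) : ℂ :=
  (∏ j, (-(e j : ℂ) * z) ^ (e j).toNat) /
    ((∏ j, (-(e j : ℂ) * z) ^ (-e j).toNat) * (E : ℂ) ^ E)

theorem prod_toNat_ne_zero (e : Fin m → ℤ) {z : ℂ} (hz : z ≠ 0) :
    (∏ j, (-(e j : ℂ) * z) ^ (-e j).toNat) ≠ 0 ∧ (∏ j, (-(e j : ℂ) * z) ^ (e j).toNat) ≠ 0 := by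
  constructor <;>
  · refine Finset.prod_ne_zero_iff.2 fun j _ => ?_
    by_cases h : e j = 0
    · simp [h]
    · exact pow_ne_zero _ (mul_ne_zero (neg_ne_zero.2 (Int.cast_ne_zero.2 h)) hz)

theorem leadRatio_ne_zero (e : Fin m → ℤ) {E : ℕ} (hE : 0 < E) {z : ℂ} (hz : z ≠ 0) :
    leadRatio e E z ≠ 0 :=
  div_ne_zero (prod_toNat_ne_zero e hz).2 (mul_ne_zero (prod_toNat_ne_zero e hz).1
    (pow_ne_zero _ (Nat.cast_ne_zero.2 hE.ne')))

theorem leadRatio_im (e : Fin m → ℤ) (E : ℕ) {z : ℂ} (hz : z.im = 0) :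
    (leadRatio e E z).im = 0 := by
  have h : leadRatio e E z = (((∏ j, (-(e j : ℝ) * z.re) ^ (e j).toNat) /
      ((∏ j, (-(e j : ℝ) * z.re) ^ (-e j).toNat) * (E : ℝ) ^ E) : ℝ) : ℂ) := by
    have hz' : z = (z.re : ℂ) := Complex.ext rfl hz
    rw [leadRatio]
    push_cast
    rw [← hz']
  rw [h, Complex.ofReal_im]

variable {A : Type*} [CommRing A] [Algebra ℂ A]

/-- The product of the hypergeometric factors in the degree `k₀ - l e`, where `q j = D_j · k₀`. -/
def hyperProd (u : Fin m → A) (z : ℂ) (q : Fin m → ℚ) (e : Fin m → ℤ) (l : ℤ) : A :=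
  ∏ j, hyperFactor (u j) z (q j - l * e j)

/-- The coefficient of the regularized series in the degree `k₀ - l e`. -/
def regCoeff (u : Fin m → A) (z : ℂ) (q : Fin m → ℚ) (e : Fin m → ℤ) (E : ℕ) (σ : ℝ) (a : A)
    (l : ℤ) : A :=
  nilEval (fun w => (Complex.Gamma w)⁻¹) (1 + (σ + l * E)) a * hyperProd u z q e l

theorem hyperProd_succ {u : Fin m → A} (hu : ∀ j, IsNilpotent (u j)) {z : ℂ} (hz : z ≠ 0)
    (q : Fin m → ℚ) (e : Fin m → ℤ) (l : ℤ) :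
    hyperProd u z q e (l + 1) * ∏ j, ∏ i ∈ Finset.range (-e j).toNat,
        (u j + algebraMap ℂ A (((q j : ℂ) - (l + 1) * e j - i) * z)) =
      hyperProd u z q e l * ∏ j, ∏ i ∈ Finset.range (e j).toNat,
        (u j + algebraMap ℂ A (((q j : ℂ) - l * e j - i) * z)) := by
  rw [hyperProd, hyperProd, ← Finset.prod_mul_distrib, ← Finset.prod_mul_distrib]
  refine Finset.prod_congr rfl fun j _ => ?_
  have h := hyperFactor_sub_int (hu j) hz (q j - l * e j) (e j)
  rw [show q j - l * e j - e j = q j - ((l + 1 : ℤ) : ℚ) * e j by push_cast; ring] at h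
  push_cast at h ⊢
  convert h using 5
  ring

/-- Pulling the slope out of the linear factors of a product. -/
theorem prod_linear_eq {ι : Type*} (s : Finset ι) (f β : ι → A) (κ : ι → ℂ) (x : A)
    (h : ∀ i ∈ s, f i = algebraMap ℂ A (κ i) * (x + β i)) :
    ∏ i ∈ s, f i = algebraMap ℂ A (∏ i ∈ s, κ i) *
      (∏ i ∈ s, (Polynomial.X + Polynomial.C (β i))).eval x := by
  rw [Polynomial.eval_prod, map_prod, ← Finset.prod_mul_distrib]
  refine Finset.prod_congr rfl fun i hi => ?_
  rw [h i hi]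
  simp

/-- The coefficients of the regularized series satisfy a two-term recursion whose two sides have
the same degree in `l`: the Gamma factor supplies exactly the `E` linear factors that the
hypergeometric factors lack. -/
theorem exists_recursion {u : Fin m → A} (hu : ∀ j, IsNilpotent (u j)) {z : ℂ} (hz : z ≠ 0)
    (q : Fin m → ℚ) (e : Fin m → ℤ) {E : ℕ} (hE : 0 < E) (hsum : ∑ j, e j = E) (σ : ℝ) {a : A}
    (ha : IsNilpotent a) :
    ∃ P Q : Polynomial A, P.natDegree ≤ ∑ j, (e j).toNat ∧ P.coeff (∑ j, (e j).toNat) = 1 ∧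
      Q.natDegree ≤ ∑ j, (e j).toNat ∧ Q.coeff (∑ j, (e j).toNat) = 1 ∧
      ∀ l : ℤ, Q.eval ((l + 1 : ℤ) : A) * regCoeff u z q e E σ a (l + 1) =
        leadRatio e E z • (P.eval (l : A) * regCoeff u z q e E σ a l) := by
  have hE0 : (E : ℂ) ≠ 0 := Nat.cast_ne_zero.2 hE.ne'
  have hcard : ∑ j, (-e j).toNat + E = ∑ j, (e j).toNat := by
    have h1 : ∑ j, (((e j).toNat : ℤ) - ((-e j).toNat : ℤ)) = E := by
      rw [← hsum]
      exact Finset.sum_congr rfl fun j _ => Int.toNat_sub_toNat_neg _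
    rw [Finset.sum_sub_distrib] at h1
    have h2 : ((∑ j, (-e j).toNat + E : ℕ) : ℤ) = ((∑ j, (e j).toNat : ℕ) : ℤ) := by
      push_cast
      linarith
    exact_mod_cast h2
  -- the linear factors, divided by their slopes
  let β : (Σ _ : Fin m, ℕ) → A := fun x =>
    algebraMap ℂ A (-(e x.1 : ℂ) * z)⁻¹ * (u x.1 + algebraMap ℂ A (((q x.1 : ℂ) - x.2) * z))
  let γ : ℕ → A := fun i => algebraMap ℂ A (E : ℂ)⁻¹ * (algebraMap ℂ A (1 + σ - E + i) + a)
  let sP : Finset (Σ _ : Fin m, ℕ) := Finset.univ.sigma fun j => Finset.range (e j).toNat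
  let sQ : Finset (Σ _ : Fin m, ℕ) := Finset.univ.sigma fun j => Finset.range (-e j).toNat
  let P : Polynomial A := ∏ i ∈ sP, (Polynomial.X + Polynomial.C (β i))
  let Q₁ : Polynomial A := ∏ i ∈ sQ, (Polynomial.X + Polynomial.C (β i))
  let Q₂ : Polynomial A := ∏ i ∈ Finset.range E, (Polynomial.X + Polynomial.C (γ i))
  have hcP : sP.card = ∑ j, (e j).toNat := by simp [sP]
  have hcQ : sQ.card + (Finset.range E).card = ∑ j, (e j).toNat := by
    rw [← hcard]
    simp [sQ]
  obtain ⟨hP1, hP2⟩ := natDegree_coeff_prod_X_add_C sP β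
  obtain ⟨hQ1, hQ2⟩ := natDegree_coeff_prod_X_add_C sQ β
  obtain ⟨hR1, hR2⟩ := natDegree_coeff_prod_X_add_C (Finset.range E) γ
  refine ⟨P, Q₁ * Q₂, hcP ▸ hP1, hcP ▸ hP2, ?_, ?_, fun l => ?_⟩
  · rw [← hcQ]
    exact Polynomial.natDegree_mul_le_of_le hQ1 hR1
  · rw [← hcQ, Polynomial.coeff_mul_add_eq_of_natDegree_le hQ1 hR1, hQ2, hR2, one_mul]
  · have hlin : ∀ (x : ℤ) (j : Fin m) (i : ℕ), e j ≠ 0 →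
        u j + algebraMap ℂ A (((q j : ℂ) - x * e j - i) * z) =
          algebraMap ℂ A (-(e j : ℂ) * z) * ((x : A) + β ⟨j, i⟩) := by
      intro x j i hj
      have h0 : -(e j : ℂ) * z ≠ 0 := mul_ne_zero (neg_ne_zero.2 (Int.cast_ne_zero.2 hj)) hz
      simp only [β]
      rw [mul_add, ← mul_assoc, ← map_mul, mul_inv_cancel₀ h0, map_one, one_mul,
        ← map_intCast (algebraMap ℂ A), ← map_mul, add_left_comm, ← map_add]
      congr 2
      ring
    have hPe : ∏ j, ∏ i ∈ Finset.range (e j).toNat,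
        (u j + algebraMap ℂ A (((q j : ℂ) - l * e j - i) * z)) =
        algebraMap ℂ A (∏ j, (-(e j : ℂ) * z) ^ (e j).toNat) * P.eval (l : A) := by
      rw [← Finset.prod_sigma Finset.univ (fun j => Finset.range (e j).toNat)
        (fun x => u x.1 + algebraMap ℂ A (((q x.1 : ℂ) - l * e x.1 - x.2) * z)),
        prod_linear_eq sP _ β (fun x => -(e x.1 : ℂ) * z) (l : A), Finset.prod_sigma]
      · simp [P]
      · rintro ⟨j, i⟩ hx
        refine hlin l j i fun h0 => ?_
        simp [sP, h0] at hx
    have hQe : ∏ j, ∏ i ∈ Finset.range (-e j).toNat,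
        (u j + algebraMap ℂ A (((q j : ℂ) - (l + 1) * e j - i) * z)) =
        algebraMap ℂ A (∏ j, (-(e j : ℂ) * z) ^ (-e j).toNat) * Q₁.eval ((l + 1 : ℤ) : A) := by
      rw [← Finset.prod_sigma Finset.univ (fun j => Finset.range (-e j).toNat)
        (fun x => u x.1 + algebraMap ℂ A (((q x.1 : ℂ) - (l + 1) * e x.1 - x.2) * z)),
        prod_linear_eq sQ _ β (fun x => -(e x.1 : ℂ) * z) ((l + 1 : ℤ) : A), Finset.prod_sigma]
      · simp [Q₁]
      · rintro ⟨j, i⟩ hx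
        have := hlin (l + 1) j i fun h0 => by simp [sQ, h0] at hx
        push_cast at this ⊢
        exact this
    have hRe : ∏ i ∈ Finset.range E, (algebraMap ℂ A (1 + (σ + l * E) + i) + a) =
        algebraMap ℂ A ((E : ℂ) ^ E) * Q₂.eval ((l + 1 : ℤ) : A) := by
      rw [prod_linear_eq (Finset.range E) _ γ (fun _ => (E : ℂ)) ((l + 1 : ℤ) : A)]
      · simp [Q₂]
      · intro i _
        simp only [γ]
        rw [mul_add, ← mul_assoc, ← map_mul, mul_inv_cancel₀ hE0, map_one, one_mul,
          ← map_intCast (algebraMap ℂ A), ← map_mul,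
          ← add_assoc (algebraMap ℂ A _) (algebraMap ℂ A _) a, ← map_add]
        congr 2
        push_cast
        ring
    have hG := nilEval_inv_Gamma_iterate (1 + (σ + l * E)) ha E
    rw [show (1 : ℂ) + (σ + l * E) + E = 1 + (σ + ((l + 1 : ℤ) : ℂ) * E) by push_cast; ring,
      hRe] at hG
    have hH := hyperProd_succ hu hz q e l
    rw [hPe, hQe] at hH
    have hκ := (prod_toNat_ne_zero e hz).1
    set κP := ∏ j, (-(e j : ℂ) * z) ^ (e j).toNat with hκP
    set κQ := ∏ j, (-(e j : ℂ) * z) ^ (-e j).toNat with hκQ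
    have hc : leadRatio e E z = κP / (κQ * (E : ℂ) ^ E) := rfl
    have hne : κQ * (E : ℂ) ^ E ≠ 0 := mul_ne_zero hκ (pow_ne_zero _ hE0)
    have hunit : IsUnit (algebraMap ℂ A (κQ * (E : ℂ) ^ E)) :=
      (isUnit_iff_ne_zero.2 hne).map (algebraMap ℂ A)
    refine hunit.mul_left_cancel ?_
    rw [hc, Algebra.smul_def, ← mul_assoc (algebraMap ℂ A (κQ * (E : ℂ) ^ E)) (algebraMap ℂ A _),
      ← map_mul, mul_div_cancel₀ _ hne, regCoeff, regCoeff, Polynomial.eval_mul, map_mul]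
    set g₁ := nilEval (fun w => (Complex.Gamma w)⁻¹) (1 + (σ + ((l + 1 : ℤ) : ℂ) * E)) a
    rw [hG]
    linear_combination g₁ * algebraMap ℂ A ((E : ℂ) ^ E) * Q₂.eval ((l + 1 : ℤ) : A) * hH

end Recursion

/-! ### The function attached to a residue class of degrees -/

section SectorFunction

variable {m : ℕ}

/-- The term of degree `k₀ - l e` of the `I`-function with `ỹ_r = x^s`, as a function of
`ξ = log x`; here `σ = s (p_r · k₀)`, `a = s θ(p_r) / z`, and `b` collects the remaining
logarithms. -/
def expTerm {A : Type*} [CommRing A] [Algebra ℂ A] (u : Fin m → A) (z : ℂ) (q : Fin m → ℚ)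
    (e : Fin m → ℤ) (E : ℕ) (σ : ℝ) (a b : A) (l : ℕ) (ξ : ℂ) : A :=
  z • (nilEval Complex.exp ((σ + l * E) * ξ) (b + ξ • a) * hyperProd u z q e l)

/-- The regularization of `expTerm`. -/
def regTerm {A : Type*} [CommRing A] [Algebra ℂ A] (u : Fin m → A) (z : ℂ) (q : Fin m → ℚ)
    (e : Fin m → ℤ) (E : ℕ) (σ : ℝ) (a b : A) (l : ℕ) (ξ : ℂ) : A :=
  nilEval (fun w => (Complex.Gamma w)⁻¹) (1 + (σ + l * E)) a * expTerm u z q e E σ a b l ξ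

theorem isOpen_sector {δ : ℝ} (hδ : δ ≤ Real.pi / 2) : IsOpen (sector δ) := by
  have hpi := Real.pi_pos
  have h : sector δ = Complex.slitPlane ∩ Complex.arg ⁻¹' (Set.Ioo 0 δ) := by
    ext x
    simp only [sector, Set.mem_ofPred_eq, Set.mem_inter_iff, Set.mem_preimage, Set.mem_Ioo]
    refine ⟨fun h => ⟨Complex.mem_slitPlane_iff_arg.2 ⟨by linarith [h.2], ?_⟩, h⟩, fun h => h.2⟩
    rintro rfl
    simp at h
  rw [h]
  refine ContinuousOn.isOpen_inter_preimage (fun x hx => ?_) Complex.isOpen_slitPlane isOpen_Ioo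
  exact (Complex.continuousAt_arg hx).continuousWithinAt

theorem sector_subset_slitPlane {δ : ℝ} (hδ : δ ≤ Real.pi / 2) : sector δ ⊆ Complex.slitPlane := by
  have hpi := Real.pi_pos
  intro x h
  refine Complex.mem_slitPlane_iff_arg.2 ⟨by linarith [h.2], ?_⟩
  rintro rfl
  simp [sector] at h

theorem log_mem_strip {δ : ℝ} {x : ℂ} (hx : x ∈ sector δ) : Complex.log x ∈ strip δ := by
  simpa [strip, sector, Complex.log_im] using hx

theorem exp_le_exp_add_exp {x lo hi : ℝ} (h1 : lo ≤ x) (h2 : x ≤ hi) (r : ℝ) :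
    Real.exp (x * r) ≤ Real.exp (lo * r) + Real.exp (hi * r) := by
  have e1 := Real.exp_pos (lo * r)
  have e2 := Real.exp_pos (hi * r)
  rcases le_total 0 r with h | h
  · linarith [Real.exp_le_exp.2 (mul_le_mul_of_nonneg_right h2 h)]
  · linarith [Real.exp_le_exp.2 (mul_le_mul_of_nonpos_right h1 h)]

section Normed

variable {A : Type*} [NormedCommRing A] [NormedAlgebra ℂ A] [FiniteDimensional ℂ A]

theorem expTerm_eq (u : Fin m → A) (z : ℂ) (q : Fin m → ℚ) (e : Fin m → ℤ) (E : ℕ) (σ : ℝ)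
    {a b : A} (ha : IsNilpotent a) (hb : IsNilpotent b) (l : ℕ) (ξ : ℂ) :
    expTerm u z q e E σ a b l ξ = (Complex.exp ((σ + l * E) * ξ) • NormedSpace.exp (ξ • a)) *
      (z • (NormedSpace.exp b * hyperProd u z q e l)) := by
  have : CompleteSpace A := FiniteDimensional.complete ℂ A
  have hn : IsNilpotent (b + ξ • a) := (Commute.all _ _).isNilpotent_add hb (ha.smul ξ)
  rw [expTerm, nilEval_cexp hn, exp_add_algebra]
  simp only [Algebra.smul_def]
  ring

theorem isLaplace_regTerm (u : Fin m → A) (z : ℂ) (q : Fin m → ℚ) (e : Fin m → ℤ) (E : ℕ) {σ : ℝ}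
    (hσ : 0 ≤ σ) {a b : A} (ha : IsNilpotent a) (hb : IsNilpotent b) {δ : ℝ}
    (hδ : δ ≤ Real.pi / 2) (l : ℕ) :
    IsLaplace δ (fun x => regTerm u z q e E σ a b l (Complex.log x))
      (fun w => expTerm u z q e E σ a b l (-Complex.log w)) := by
  have hpi := Real.pi_pos
  have h := (isLaplace_term ha (σ := σ + l * E) (by positivity) hδ).map
    (LinearMap.mulLeft ℂ (z • (NormedSpace.exp b * hyperProd u z q e l)))
  refine h.congr (fun x _ => ?_) (by linarith) fun w => ?_
  · rw [regTerm, expTerm_eq u z q e E σ ha hb, LinearMap.mulLeft_apply]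
    push_cast
    ring
  · rw [expTerm_eq u z q e E σ ha hb, LinearMap.mulLeft_apply]
    push_cast
    rw [mul_comm]
    congr 3
    ring

/-- The contribution of one residue class of degrees: the regularized series continues
analytically along the sector, with a Laplace transform, and its partial sums are asymptotic to
it at the origin. -/
theorem exists_sectorFunction_of_normed {u : Fin m → A} (hu : ∀ j, IsNilpotent (u j)) {z : ℂ}
    (hz : z ≠ 0) (q : Fin m → ℚ) (e : Fin m → ℤ) {E : ℕ} (hE : 0 < E) (hsum : ∑ j, e j = E)
    {σ : ℝ} (hσ : 0 ≤ σ) {a b : A} (ha : IsNilpotent a) (hb : IsNilpotent b)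
    (hvan : hyperProd u z q e (-1) = 0) {δ : ℝ} (hδ0 : 0 < δ) (hδ : δ ≤ Real.pi / 2)
    (hc : ∀ φ : ℝ, 0 < φ → φ < E * δ → (leadRatio e E z * Complex.exp (φ * Complex.I)).im ≠ 0) :
    ∃ F G : ℂ → A, (∀ φ : A →ₗ[ℂ] ℂ, AnalyticOnNhd ℂ (fun x => φ (F x)) (sector δ)) ∧
      (∃ R : ℝ, 0 < R ∧ ∀ x ∈ sector δ, ‖x‖ < R → ∀ φ : A →ₗ[ℂ] ℂ,
        HasSum (fun l : ℕ => φ (regTerm u z q e E σ a b l (Complex.log x))) (φ (F x))) ∧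
      IsLaplace δ F G ∧
      ∀ (L : ℕ) (α : ℝ) (φ : A →ₗ[ℂ] ℂ) (ε : ℝ), 0 < α → α < δ → 0 < ε →
        ∃ C K : ℝ, 0 ≤ C ∧ σ + L * E - ε ≤ K ∧ ∀ t : ℝ, 0 < t →
          ‖φ (F (t * Complex.exp (α * Complex.I)) - ∑ l ∈ Finset.range L,
            regTerm u z q e E σ a b l (Complex.log (t * Complex.exp (α * Complex.I))))‖ ≤
            C * (t ^ (σ + L * E - ε) + t ^ K) := by
  have : CompleteSpace A := FiniteDimensional.complete ℂ A
  have hpi := Real.pi_pos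
  have hER : (0 : ℝ) < E := Nat.cast_pos.2 hE
  obtain ⟨P, Q, hP, hP1, hQ, hQ1, hrec⟩ := exists_recursion hu hz q e hE hsum σ ha
  have hB : 0 < ∑ j, (e j).toNat := by
    have h1 : (E : ℤ) ≤ ((∑ j, (e j).toNat : ℕ) : ℤ) := by
      rw [← hsum]
      push_cast
      exact Finset.sum_le_sum fun j _ => Int.self_le_toNat _
    exact hE.trans_le (by exact_mod_cast h1)
  have h0 : Q.eval 0 * regCoeff u z q e E σ a (0 : ℕ) = 0 := by
    have := hrec (-1)
    simp only [regCoeff, hvan, mul_zero, smul_zero] at this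
    simpa [regCoeff] using this
  obtain ⟨Φ, r, hΦd, hΦs, hΦb⟩ := exists_continuation (c := leadRatio e E z)
    (a := fun l : ℕ => regCoeff u z q e E σ a l) hB hP hP1 hQ hQ1 h0
    (fun l => by simpa using hrec l) (mul_pos hER hδ0) hc
  set b' : A := z • NormedSpace.exp b with hb'
  let f : ℂ → A := fun ξ => (Complex.exp (σ * ξ) • NormedSpace.exp (ξ • a)) * (b' * Φ (E * ξ))
  have hmem : ∀ ξ ∈ strip δ, (E : ℂ) * ξ ∈ strip (E * δ) := by
    rintro ξ ⟨h1, h2⟩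
    constructor <;> simp only [Complex.mul_im, Complex.natCast_re, Complex.natCast_im, zero_mul,
      add_zero]
    · positivity
    · gcongr
  have hreg : ∀ (l : ℕ) (ξ : ℂ), regTerm u z q e E σ a b l ξ =
      (Complex.exp (σ * ξ) • NormedSpace.exp (ξ • a)) *
        (b' * (Complex.exp (l * (E * ξ)) • regCoeff u z q e E σ a l)) := by
    intro l ξ
    rw [regTerm, expTerm_eq u z q e E σ ha hb, regCoeff, hb', add_mul, Complex.exp_add, mul_assoc]
    simp only [smul_mul_assoc, mul_smul_comm, Int.cast_natCast, smul_smul]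
    congr 1
    · ring
    · ring
  have hfd : DifferentiableOn ℂ f (strip δ) := by
    have h1 : DifferentiableOn ℂ (fun ξ => Φ (E * ξ)) (strip δ) :=
      hΦd.comp (by fun_prop) hmem
    have h2 : Differentiable ℂ fun ξ : ℂ => Complex.exp (σ * ξ) := by fun_prop
    exact (h2.smul (differentiable_exp_smul a)).differentiableOn.mul
      ((differentiableOn_const b').mul h1)
  -- the remainder estimate, in the coordinate `log x`
  have hbd : ∀ (φ₁ φ₂ : ℝ) (L : ℕ) (ε : ℝ), 0 < φ₁ → φ₂ < δ → 0 < ε → ∃ C K : ℝ, 0 ≤ C ∧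
      σ + L * E - ε ≤ K ∧ ∀ ξ : ℂ, φ₁ ≤ ξ.im → ξ.im ≤ φ₂ →
        ‖f ξ - ∑ l ∈ Finset.range L, regTerm u z q e E σ a b l ξ‖ ≤
          C * (Real.exp ((σ + L * E - ε) * ξ.re) + Real.exp (K * ξ.re)) := by
    intro φ₁ φ₂ L ε h1 h2 hε
    obtain ⟨C, K, hC, hLK, hCK⟩ := hΦb (E * φ₁) (E * φ₂) (by positivity) (by gcongr) L
    obtain ⟨C', hC', hCe⟩ := exists_norm_exp_smul_le ha δ hε
    have hLKE : (L : ℝ) * E ≤ K * E := by gcongr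
    refine ⟨C' * (‖b'‖ * (4 * C)), σ + K * E + ε, by positivity, by linarith, fun ξ h3 h4 => ?_⟩
    have h5 := hCe ξ (abs_le.2 ⟨by linarith, by linarith⟩)
    have h6 := hCK (E * ξ) (by simpa using mul_le_mul_of_nonneg_left h3 hER.le)
      (by simpa using mul_le_mul_of_nonneg_left h4 hER.le)
    have h7 : f ξ - ∑ l ∈ Finset.range L, regTerm u z q e E σ a b l ξ =
        (Complex.exp (σ * ξ) • NormedSpace.exp (ξ • a)) * (b' * (Φ (E * ξ) -
          ∑ l ∈ Finset.range L, Complex.exp (l * (E * ξ)) • regCoeff u z q e E σ a l)) := by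
      simp only [hreg, f]
      rw [mul_sub, mul_sub, Finset.mul_sum, Finset.mul_sum]
    rw [h7]
    simp only [Complex.mul_re, Complex.natCast_re, Complex.natCast_im, zero_mul, sub_zero] at h6
    set X := Real.exp ((σ + L * E - ε) * ξ.re) + Real.exp ((σ + K * E + ε) * ξ.re) with hX
    have h8 : ∀ x : ℝ, σ + L * E - ε ≤ x → x ≤ σ + K * E + ε → Real.exp (x * ξ.re) ≤ X :=
      fun x hx hx' => exp_le_exp_add_exp hx hx' _
    have h9 : Real.exp (σ * ξ.re) * ((Real.exp (ε * ξ.re) + Real.exp (-ε * ξ.re)) *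
        (Real.exp (L * (E * ξ.re)) + Real.exp (K * (E * ξ.re)))) ≤ 4 * X := by
      have e1 := h8 (σ + ε + L * E) (by linarith) (by linarith)
      have e2 := h8 (σ + ε + K * E) (by linarith) (by linarith)
      have e3 := h8 (σ - ε + L * E) (by linarith) (by linarith)
      have e4 := h8 (σ - ε + K * E) (by linarith) (by linarith)
      have e5 : Real.exp (σ * ξ.re) * ((Real.exp (ε * ξ.re) + Real.exp (-ε * ξ.re)) *
        (Real.exp (L * (E * ξ.re)) + Real.exp (K * (E * ξ.re)))) =
          Real.exp ((σ + ε + L * E) * ξ.re) + Real.exp ((σ + ε + K * E) * ξ.re) +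
          Real.exp ((σ - ε + L * E) * ξ.re) + Real.exp ((σ - ε + K * E) * ξ.re) := by
        simp only [add_mul, sub_eq_add_neg, Real.exp_add, neg_mul, mul_assoc]
        ring
      rw [e5]
      linarith
    calc _ ≤ ‖Complex.exp (σ * ξ) • NormedSpace.exp (ξ • a)‖ * (‖b'‖ * ‖Φ (E * ξ) -
          ∑ l ∈ Finset.range L, Complex.exp (l * (E * ξ)) • regCoeff u z q e E σ a l‖) :=
          (norm_mul_le _ _).trans (by gcongr; exact norm_mul_le _ _)
      _ ≤ (Real.exp (σ * ξ.re) * (C' * (Real.exp (ε * ξ.re) + Real.exp (-ε * ξ.re)))) * (‖b'‖ *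
          (C * (Real.exp (L * (E * ξ.re)) + Real.exp (K * (E * ξ.re))))) := by
          rw [norm_smul, Complex.norm_exp, Complex.re_ofReal_mul]
          gcongr
      _ = C' * (‖b'‖ * C) * (Real.exp (σ * ξ.re) * ((Real.exp (ε * ξ.re) +
          Real.exp (-ε * ξ.re)) * (Real.exp (L * (E * ξ.re)) + Real.exp (K * (E * ξ.re))))) := by
          ring
      _ ≤ C' * (‖b'‖ * C) * (4 * X) := by gcongr
      _ = _ := by ring
  obtain ⟨G, hG⟩ := exists_isLaplace hδ hfd fun φ₁ φ₂ h1 h2 => by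
    obtain ⟨C, K, hC, hK, hCK⟩ := hbd φ₁ φ₂ 0 (1 / 2) h1 h2 (by norm_num)
    refine ⟨C, _, K, ?_, ?_, fun ξ h3 h4 => by simpa using hCK ξ h3 h4⟩
    · simp; linarith
    · simp at hK; linarith
  refine ⟨fun x => f (Complex.log x), G, fun φ => ?_, ⟨Real.exp (-(|r| + 1) / E),
    Real.exp_pos _, fun x hx hxR φ => ?_⟩, hG, fun L α φ ε h1 h2 hε => ?_⟩
  · refine DifferentiableOn.analyticOnNhd ?_ (isOpen_sector hδ)
    have h1 : DifferentiableOn ℂ (fun x => f (Complex.log x)) (sector δ) :=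
      hfd.comp (fun x hx => (Complex.differentiableAt_log
        (sector_subset_slitPlane hδ hx)).differentiableWithinAt) fun x hx => log_mem_strip hx
    exact (LinearMap.toContinuousLinearMap φ).differentiable.comp_differentiableOn h1
  · have hx0 : x ≠ 0 := by rintro rfl; simp [sector] at hx
    have hs := hΦs (E * Complex.log x) (hmem _ (log_mem_strip hx)) (by
      have h1 := (Real.log_lt_log (norm_pos_iff.2 hx0) hxR)
      rw [Real.log_exp, lt_div_iff₀ hER] at h1
      simp only [Complex.mul_re, Complex.natCast_re, Complex.natCast_im, zero_mul, sub_zero,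
        Complex.log_re]
      have := le_abs_self r
      nlinarith)
    have hs' := (hs.mul_left b').mul_left
      (Complex.exp (σ * Complex.log x) • NormedSpace.exp (Complex.log x • a))
    simp only [← hreg] at hs'
    exact (LinearMap.toContinuousLinearMap φ).hasSum hs'
  · obtain ⟨C, K, hC, hK, hCK⟩ := hbd α α L ε h1 h2 hε
    let φ' := LinearMap.toContinuousLinearMap φ
    refine ⟨‖φ'‖ * C, K, by positivity, hK, fun t ht => ?_⟩
    have h3 := hCK (Complex.log (t * Complex.exp (α * Complex.I)))
    beta_reduce
    rw [log_ray ht (by linarith) (by linarith)] at h3 ⊢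
    simp only [Complex.add_im, Complex.ofReal_im, Complex.mul_im, Complex.ofReal_re, Complex.I_im,
      mul_one, Complex.I_re, mul_zero, add_zero, zero_add, Complex.add_re, Complex.mul_re, sub_self,
      le_refl, forall_true_left, exp_mul_log_eq_rpow ht] at h3
    calc _ ≤ ‖φ'‖ * _ := φ'.le_opNorm _
      _ ≤ ‖φ'‖ * (C * (t ^ (σ + L * E - ε) + t ^ K)) := by gcongr
      _ = _ := by ring

end Normed

/-- `exists_sectorFunction_of_normed` for an algebra without a norm: a norm is obtained from the
regular representation, and the conclusions do not refer to it. -/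
theorem exists_sectorFunction {A : Type*} [CommRing A] [Algebra ℂ A] [Module.Finite ℂ A]
    {u : Fin m → A} (hu : ∀ j, IsNilpotent (u j)) {z : ℂ}
    (hz : z ≠ 0) (q : Fin m → ℚ) (e : Fin m → ℤ) {E : ℕ} (hE : 0 < E) (hsum : ∑ j, e j = E)
    {σ : ℝ} (hσ : 0 ≤ σ) {a b : A} (ha : IsNilpotent a) (hb : IsNilpotent b)
    (hvan : hyperProd u z q e (-1) = 0) {δ : ℝ} (hδ0 : 0 < δ) (hδ : δ ≤ Real.pi / 2)
    (hc : ∀ φ : ℝ, 0 < φ → φ < E * δ → (leadRatio e E z * Complex.exp (φ * Complex.I)).im ≠ 0) :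
    (∀ l, IsLaplace δ (fun x => regTerm u z q e E σ a b l (Complex.log x))
      (fun w => expTerm u z q e E σ a b l (-Complex.log w))) ∧
    ∃ F G : ℂ → A, (∀ φ : A →ₗ[ℂ] ℂ, AnalyticOnNhd ℂ (fun x => φ (F x)) (sector δ)) ∧
      (∃ R : ℝ, 0 < R ∧ ∀ x ∈ sector δ, ‖x‖ < R → ∀ φ : A →ₗ[ℂ] ℂ,
        HasSum (fun l : ℕ => φ (regTerm u z q e E σ a b l (Complex.log x))) (φ (F x))) ∧
      IsLaplace δ F G ∧
      ∀ (L : ℕ) (α : ℝ) (φ : A →ₗ[ℂ] ℂ) (ε : ℝ), 0 < α → α < δ → 0 < ε →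
        ∃ C K : ℝ, 0 ≤ C ∧ σ + L * E - ε ≤ K ∧ ∀ t : ℝ, 0 < t →
          ‖φ (F (t * Complex.exp (α * Complex.I)) - ∑ l ∈ Finset.range L,
            regTerm u z q e E σ a b l (Complex.log (t * Complex.exp (α * Complex.I))))‖ ≤
            C * (t ^ (σ + L * E - ε) + t ^ K) := by
  classical
  let B := Module.finBasis ℂ A
  let : NormedRing (Matrix (Fin (Module.finrank ℂ A)) (Fin (Module.finrank ℂ A)) ℂ) :=
    Matrix.linftyOpNormedRing
  let : NormedAlgebra ℂ (Matrix (Fin (Module.finrank ℂ A)) (Fin (Module.finrank ℂ A)) ℂ) :=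
    Matrix.linftyOpNormedAlgebra
  let : NormedCommRing A := NormedCommRing.induced A _ (Algebra.leftMulMatrix B)
    (Algebra.leftMulMatrix_injective B)
  let : NormedAlgebra ℂ A := NormedAlgebra.induced ℂ A _ (Algebra.leftMulMatrix B)
  exact ⟨isLaplace_regTerm u z q e E hσ ha hb hδ,
    exists_sectorFunction_of_normed hu hz q e hE hsum hσ ha hb hvan hδ0 hδ hc⟩

end SectorFunction

/-! ### Chambers, nilpotency and finiteness -/

section Toric

variable {n m : ℕ} {D : Fin m → Fin (n + 1) → ℤ} {ω : Fin (n + 1) → ℝ}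

theorem sum_mul_eq_of_mem_angle {I : Set (Fin m)} {v : Fin (n + 1) → ℝ} (hv : v ∈ angle D I) :
    ∃ a : Fin m → ℝ, (∀ j ∈ I, 0 < a j) ∧ (∀ j, j ∉ I → a j = 0) ∧
      ∀ y : Fin (n + 1) → ℝ, ∑ i, v i * y i = ∑ j, a j * ∑ i, (D j i : ℝ) * y i := by
  obtain ⟨a, h1, h2, h3⟩ := hv
  refine ⟨a, h1, h2, fun y => ?_⟩
  simp only [h3, Finset.sum_mul, Finset.mul_sum]
  rw [Finset.sum_comm]
  exact Finset.sum_congr rfl fun j _ => Finset.sum_congr rfl fun i _ => by ring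

theorem eq_zero_of_forall_chamber (hω : (interior (chamber D ω)).Nonempty) {y : Fin (n + 1) → ℝ}
    (h : ∀ v ∈ chamber D ω, ∑ i, v i * y i = 0) : y = 0 := by
  let ℓ : (Fin (n + 1) → ℝ) →ₗ[ℝ] ℝ := ∑ i, y i • LinearMap.proj i
  have hℓ : ∀ v, ℓ v = ∑ i, v i * y i := fun v => by simp [ℓ, mul_comm]
  have htop : LinearMap.ker ℓ = ⊤ := by
    refine Submodule.eq_top_of_nonempty_interior' _ (hω.mono (interior_mono fun v hv => ?_))
    rw [SetLike.mem_coe, LinearMap.mem_ker, hℓ, h v hv]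
  ext i
  have hi : Pi.single i (1 : ℝ) ∈ LinearMap.ker ℓ := htop ▸ Submodule.mem_top
  rw [LinearMap.mem_ker, hℓ] at hi
  simpa [Pi.single_apply] using hi

/-- The Stanley–Reisner relations of a sector have only the trivial common zero, because the
chamber has maximal dimension. -/
theorem zeroLocus_srIdeal_subset (hω : (interior (chamber D ω)).Nonempty)
    (c : (Fin (n + 1) → ℚ) ⧸ latticeL n) :
    MvPolynomial.zeroLocus ℂ (srIdeal D ω c) ⊆ {0} := by
  classical
  intro x hx
  rw [MvPolynomial.mem_zeroLocus_iff] at hx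
  have hlin : ∀ j, MvPolynomial.aeval x (linForm (ratChar (D j))) = ∑ i, (D j i : ℂ) * x i := by
    intro j
    simp [linForm, ratChar]
  set Z : Set (Fin m) := {j | j ∈ classIndex D c ∧ ∑ i, (D j i : ℂ) * x i = 0} with hZ
  have hZA : Z ∈ anticones D ω := by
    by_contra hcon
    have hJ : (((classIndex D c \ Z).toFinset : Finset (Fin m)) : Set (Fin m)) =
        classIndex D c \ Z := Set.coe_toFinset _
    have h1 := hx _ (Ideal.subset_span ⟨(classIndex D c \ Z).toFinset,
      by rw [hJ]; exact Set.sdiff_subset,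
      by rwa [hJ, Set.sdiff_sdiff_cancel_left fun j hj => hj.1], rfl⟩)
    rw [map_prod, Finset.prod_eq_zero_iff] at h1
    obtain ⟨j, hj, hj0⟩ := h1
    rw [Set.mem_toFinset] at hj
    exact hj.2 ⟨hj.1, by rw [← hlin, hj0]⟩
  have hre : (fun i => (x i).re) = 0 := by
    refine eq_zero_of_forall_chamber hω fun v hv => ?_
    obtain ⟨a, -, h2, h3⟩ := sum_mul_eq_of_mem_angle (hv Z hZA)
    rw [h3]
    refine Finset.sum_eq_zero fun j _ => ?_
    by_cases hj : j ∈ Z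
    · have := congrArg Complex.re hj.2
      simp only [Complex.re_sum, Complex.mul_re, Complex.intCast_re, Complex.intCast_im, zero_mul,
        sub_zero, Complex.zero_re] at this
      rw [this, mul_zero]
    · rw [h2 j hj, zero_mul]
  have him : (fun i => (x i).im) = 0 := by
    refine eq_zero_of_forall_chamber hω fun v hv => ?_
    obtain ⟨a, -, h2, h3⟩ := sum_mul_eq_of_mem_angle (hv Z hZA)
    rw [h3]
    refine Finset.sum_eq_zero fun j _ => ?_
    by_cases hj : j ∈ Z
    · have := congrArg Complex.im hj.2
      simp only [Complex.im_sum, Complex.mul_im, Complex.intCast_re, Complex.intCast_im, zero_mul,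
        add_zero, Complex.zero_im] at this
      rw [this, mul_zero]
    · rw [h2 j hj, zero_mul]
  ext i
  exact Complex.ext (congrFun hre i) (congrFun him i)

theorem isNilpotent_mk (hω : (interior (chamber D ω)).Nonempty)
    (c : (Fin (n + 1) → ℚ) ⧸ latticeL n) {f : MvPolynomial (Fin (n + 1)) ℂ}
    (hf : MvPolynomial.aeval (0 : Fin (n + 1) → ℂ) f = 0) :
    IsNilpotent (Ideal.Quotient.mk (srIdeal D ω c) f) := by
  have h : f ∈ (srIdeal D ω c).radical := by
    rw [← MvPolynomial.vanishingIdeal_zeroLocus_eq_radical (K := ℂ),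
      MvPolynomial.mem_vanishingIdeal_iff]
    intro x hx
    rw [zeroLocus_srIdeal_subset hω c hx]
    exact hf
  obtain ⟨N, hN⟩ := h
  exact ⟨N, by rw [← map_pow]; exact Ideal.Quotient.eq_zero_iff_mem.2 hN⟩

theorem isNilpotent_theta (hω : (interior (chamber D ω)).Nonempty) (c : Sector D ω)
    (q : Fin (n + 1) → ℚ) : IsNilpotent (theta D ω c q) :=
  isNilpotent_mk hω c.1 (by simp [linForm])

theorem finite_sectorCoh (hω : (interior (chamber D ω)).Nonempty) (c : Sector D ω) :
    Module.Finite ℂ (SectorCoh D ω c) := by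
  have : Algebra.IsIntegral ℂ (SectorCoh D ω c) := by
    refine ⟨fun y => ?_⟩
    obtain ⟨f, rfl⟩ := Ideal.Quotient.mk_surjective y
    induction f using MvPolynomial.induction_on with
    | C a => exact isIntegral_algebraMap (R := ℂ) (A := SectorCoh D ω c) (x := a)
    | add f g hf hg => rw [map_add]; exact hf.add hg
    | mul_X f i hf =>
      rw [map_mul]
      refine hf.mul ?_
      obtain ⟨N, hN⟩ := isNilpotent_mk hω c.1 (f := MvPolynomial.X i) (by simp)
      refine IsIntegral.of_pow (Nat.succ_pos N) ?_
      rw [pow_succ, hN, zero_mul]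
      exact isIntegral_zero
  exact Algebra.IsIntegral.finite

/-- The classes `I_k` are supported on degrees pairing nonnegatively with the closed chamber. -/
theorem pairQ_nonneg_of_coeffI_ne_zero {z : ℂ} {k : boxSet D ω} (hk : coeffI D ω z k ≠ 0)
    {q : Fin (n + 1) → ℚ} (hq : (fun a => (q a : ℝ)) ∈ closure (chamber D ω)) :
    0 ≤ pairQ q k.1 := by
  classical
  set J : Finset (Fin m) := Finset.univ.filter fun j => ∃ a : ℤ, pairZ (D j) k.1 = a ∧ a < 0
    with hJ
  have hcl : classIndex D (negSector D ω k).1 = intIndex D k.1 := by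
    rw [negSector, classIndex_mk, intIndex_neg]
  have hdvd : ∏ j ∈ J, theta D ω (negSector D ω k) (ratChar (D j)) ∣ coeffI D ω z k := by
    refine (Finset.prod_dvd_prod_of_dvd _ (fun j => hyperFactor (theta D ω (negSector D ω k)
      (ratChar (D j))) z (pairZ (D j) k.1)) fun j hj => ?_).trans
      (Finset.prod_dvd_prod_of_subset _ _ _ (Finset.subset_univ J))
    obtain ⟨a, ha, ha0⟩ := (Finset.mem_filter.1 hj).2
    exact dvd_hyperFactor _ z a ha ha0
  have hA : intIndex D k.1 \ (J : Set (Fin m)) ∈ anticones D ω := by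
    by_contra hcon
    refine hk (zero_dvd_iff.1 ?_)
    refine dvd_trans (dvd_of_eq ?_) hdvd
    have h1 : ∏ j ∈ J, linForm (ratChar (D j)) ∈ srIdeal D ω (negSector D ω k).1 := by
      refine Ideal.subset_span ⟨J, fun j hj => ?_, ?_, rfl⟩
      · rw [hcl]
        obtain ⟨a, ha, -⟩ := (Finset.mem_filter.1 (Finset.mem_coe.1 hj)).2
        exact ⟨a, ha⟩
      · rwa [hcl]
    rw [← Ideal.Quotient.eq_zero_iff_mem, map_prod] at h1
    exact h1.symm
  have hsub : chamber D ω ⊆ {v | 0 ≤ ∑ i, v i * ((k.1 i : ℚ) : ℝ)} := by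
    intro v hv
    obtain ⟨a, h1, h2, h3⟩ := sum_mul_eq_of_mem_angle (hv _ hA)
    rw [Set.mem_ofPred_eq, h3]
    refine Finset.sum_nonneg fun j _ => ?_
    by_cases hj : j ∈ intIndex D k.1 \ (J : Set (Fin m))
    · refine mul_nonneg (h1 j hj).le ?_
      obtain ⟨⟨b, hb⟩, hjJ⟩ := hj
      have hb0 : 0 ≤ b := by
        by_contra hneg
        exact hjJ (Finset.mem_coe.2 (Finset.mem_filter.2 ⟨Finset.mem_univ _, b, hb, by omega⟩))
      have h4 : ∑ i, (D j i : ℝ) * ((k.1 i : ℚ) : ℝ) = ((pairZ (D j) k.1 : ℚ) : ℝ) := by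
        simp [pairZ]
      rw [h4, hb]
      exact_mod_cast hb0
    · rw [h2 j hj, zero_mul]
  have hclosed : IsClosed {v : Fin (n + 1) → ℝ | 0 ≤ ∑ i, v i * ((k.1 i : ℚ) : ℝ)} :=
    isClosed_le continuous_const (by fun_prop)
  have h := closure_minimal hsub hclosed hq
  rw [Set.mem_ofPred_eq] at h
  have h5 : ∑ i, (q i : ℝ) * ((k.1 i : ℚ) : ℝ) = ((pairQ q k.1 : ℚ) : ℝ) := by simp [pairQ]
  rw [h5] at h
  exact_mod_cast h

theorem eq_of_forall_pairQ_eq (p : Module.Basis (Fin (n + 1)) ℤ (dualLattice D ω))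
    {k k' : Fin (n + 1) → ℚ} (h : ∀ i, pairQ (p i).1 k = pairQ (p i).1 k') : k = k' := by
  have hli : LinearIndependent ℤ fun i => (p i).1 :=
    p.linearIndependent.map' (dualLattice D ω).subtype.toIntLinearMap
      (LinearMap.ker_eq_bot.2 Subtype.val_injective)
  rw [LinearIndependent.iff_fractionRing ℤ ℚ] at hli
  have hspan := hli.span_eq_top_of_card_eq_finrank' (by simp)
  let ℓ : (Fin (n + 1) → ℚ) →ₗ[ℚ] ℚ := ∑ i, (k i - k' i) • LinearMap.proj i
  have hℓ : ∀ v, ℓ v = pairQ v k - pairQ v k' := fun v => by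
    simp only [ℓ, LinearMap.sum_apply, LinearMap.smul_apply, LinearMap.proj_apply, smul_eq_mul,
      pairQ, ← Finset.sum_sub_distrib]
    exact Finset.sum_congr rfl fun i _ => by ring
  have h0 : ℓ = 0 := LinearMap.ext_on_range hspan fun i => by rw [hℓ, h i, sub_self]; rfl
  ext i
  have h1 : ℓ (Pi.single i 1) = 0 := by rw [h0]; rfl
  simp only [ℓ, LinearMap.sum_apply, LinearMap.smul_apply, LinearMap.proj_apply, smul_eq_mul,
    Pi.single_apply, mul_ite, mul_one, mul_zero, Finset.sum_ite_eq', Finset.mem_univ, if_true] at h1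
  linarith

/-- In a fiber, an element is determined by the integer `p_r · k`. -/
theorem finite_fiberLE_nonneg (p : Module.Basis (Fin (n + 1)) ℤ (dualLattice D ω)) (N : Fin n → ℤ)
    (M : ℕ) : {k | k ∈ fiberLE D ω (fun i => (p i).1) N M ∧
      0 ≤ pairQ (p (Fin.last n)).1 k.1}.Finite := by
  refine Set.Finite.of_finite_image (f := fun k => pairQ (p (Fin.last n)).1 k.1)
    (((Set.finite_Icc (0 : ℤ) M).image ((↑) : ℤ → ℚ)).subset ?_) ?_
  · rintro _ ⟨k, ⟨hk, hk0⟩, rfl⟩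
    obtain ⟨a, ha⟩ := (p (Fin.last n)).2 k.1 k.2
    have hM := hk.2
    beta_reduce at hM hk0 ⊢
    rw [ha] at hM hk0 ⊢
    exact ⟨a, ⟨by exact_mod_cast hk0, by exact_mod_cast hM⟩, rfl⟩
  · intro k hk k' hk' h
    refine Subtype.ext (eq_of_forall_pairQ_eq p fun i => ?_)
    refine Fin.lastCases ?_ (fun i => ?_) i
    · exact h
    · exact (hk.1.1 i).trans (hk'.1.1 i).symm

theorem finite_fiberLE_coeffI_ne_zero (p : Module.Basis (Fin (n + 1)) ℤ (dualLattice D ω))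
    (hp : (fun a => (((p (Fin.last n)).1 a : ℚ) : ℝ)) ∈ closure (chamber D ω)) (z : ℂ)
    (N : Fin n → ℤ) (M : ℕ) :
    {k | k ∈ fiberLE D ω (fun i => (p i).1) N M ∧ coeffI D ω z k ≠ 0}.Finite :=
  (finite_fiberLE_nonneg p N M).subset fun _ hk =>
    ⟨hk.1, pairQ_nonneg_of_coeffI_ne_zero hk.2 hp⟩

end Toric

/-! ### Translation of degrees by the wall direction -/

section Shift

variable {n m : ℕ} {D : Fin m → Fin (n + 1) → ℤ} {ωp ωm : Fin (n + 1) → ℝ}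
  {e : Fin (n + 1) → ℤ}

theorem pairQ_ratChar_eq_zero {q : Fin (n + 1) → ℚ} (hq : (fun a => (q a : ℝ)) ∈ hyperplane e) :
    pairQ q (ratChar e) = 0 := by
  have h : pairR (fun a => (q a : ℝ)) e = ((pairQ q (ratChar e) : ℚ) : ℝ) := by
    simp [pairR, pairQ, ratChar]
  have h' : pairR (fun a => (q a : ℝ)) e = 0 := hq
  rw [h] at h'
  exact_mod_cast h'

theorem pairQ_last_neg (hW : IsWallCrossing D ωp ωm e)
    (p : Module.Basis (Fin (n + 1)) ℤ (dualLattice D ωm))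
    (hp : (fun a => (((p (Fin.last n)).1 a : ℚ) : ℝ)) ∈ closure (chamber D ωm))
    (hpW : ∀ i : Fin n, (fun a => (((p i.castSucc).1 a : ℚ) : ℝ)) ∈ hyperplane e) :
    pairQ (p (Fin.last n)).1 (ratChar e) < 0 := by
  have hclosed : IsClosed {v : Fin (n + 1) → ℝ | pairR v e ≤ 0} := by
    refine isClosed_le ?_ continuous_const
    unfold pairR
    fun_prop
  have hle : pairQ (p (Fin.last n)).1 (ratChar e) ≤ 0 := by
    have h : pairR (fun a => (((p (Fin.last n)).1 a : ℚ) : ℝ)) e ≤ 0 :=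
      closure_minimal (t := {v | pairR v e ≤ 0}) (fun v hv => (hW.neg_minus v hv).le) hclosed hp
    have h1 : pairR (fun a => (((p (Fin.last n)).1 a : ℚ) : ℝ)) e =
        ((pairQ (p (Fin.last n)).1 (ratChar e) : ℚ) : ℝ) := by
      simp [pairR, pairQ, ratChar]
    rw [h1] at h
    exact_mod_cast h
  refine lt_of_le_of_ne hle fun h0 => ?_
  have he : ratChar e = 0 := by
    refine eq_of_forall_pairQ_eq p fun i => ?_
    have hz : pairQ (p i).1 0 = 0 := by simp [pairQ]
    rw [hz]
    refine Fin.lastCases h0 (fun i => pairQ_ratChar_eq_zero (hpW i)) i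
  have he0 : e = (0 : ℤ) • (0 : Fin (n + 1) → ℤ) := by
    ext i
    have := congrFun he i
    simp only [ratChar, Pi.zero_apply, Int.cast_eq_zero] at this
    simp [this]
  exact not_isUnit_zero (hW.primitive 0 0 he0)

theorem pairZ_sub_smul (χ : Fin (n + 1) → ℤ) (f : Fin (n + 1) → ℚ) (l : ℤ) :
    pairZ χ (f - (l : ℚ) • ratChar e) = pairZ χ f - l * ((∑ i, χ i * e i : ℤ) : ℚ) := by
  simp only [pairZ, Pi.sub_apply, Pi.smul_apply, ratChar, smul_eq_mul]
  push_cast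
  rw [Finset.mul_sum, ← Finset.sum_sub_distrib]
  exact Finset.sum_congr rfl fun i _ => by ring

theorem pairQ_sub_smul (q f g : Fin (n + 1) → ℚ) (l : ℚ) :
    pairQ q (f - l • g) = pairQ q f - l * pairQ q g := by
  simp only [pairQ, Pi.sub_apply, Pi.smul_apply, smul_eq_mul]
  rw [Finset.mul_sum, ← Finset.sum_sub_distrib]
  exact Finset.sum_congr rfl fun i _ => by ring

theorem intIndex_sub_smul (f : Fin (n + 1) → ℚ) (l : ℤ) :
    intIndex D (f - (l : ℚ) • ratChar e) = intIndex D f := by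
  ext j
  simp only [intIndex, Set.mem_ofPred_eq, pairZ_sub_smul]
  constructor
  · rintro ⟨a, ha⟩
    exact ⟨a + l * ∑ i, D j i * e i, by push_cast at ha ⊢; linarith⟩
  · rintro ⟨a, ha⟩
    exact ⟨a - l * ∑ i, D j i * e i, by push_cast; rw [ha]⟩

/-- The degree `k - l e`. -/
def shiftBox (D : Fin m → Fin (n + 1) → ℤ) (ω : Fin (n + 1) → ℝ) (e : Fin (n + 1) → ℤ)
    (k : boxSet D ω) (l : ℤ) : boxSet D ω :=
  ⟨k.1 - (l : ℚ) • ratChar e, by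
    change intIndex D _ ∈ anticones D ω
    rw [intIndex_sub_smul]
    exact k.2⟩

theorem negSector_shiftBox (ω : Fin (n + 1) → ℝ) (k : boxSet D ω) (l : ℤ) :
    negSector D ω (shiftBox D ω e k l) = negSector D ω k := by
  refine Subtype.ext ?_
  change (QuotientAddGroup.mk _ : (Fin (n + 1) → ℚ) ⧸ latticeL n) = QuotientAddGroup.mk _
  rw [QuotientAddGroup.eq]
  refine ⟨fun i => -(l * e i), ?_⟩
  ext i
  simp [shiftBox, ratChar]
  ring

theorem pairQ_shiftBox_castSucc {ω : Fin (n + 1) → ℝ} {q : Fin (n + 1) → ℚ}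
    (hq : (fun a => (q a : ℝ)) ∈ hyperplane e) (k : boxSet D ω) (l : ℤ) :
    pairQ q (shiftBox D ω e k l).1 = pairQ q k.1 := by
  rw [shiftBox, pairQ_sub_smul, pairQ_ratChar_eq_zero hq, mul_zero, sub_zero]

theorem inSector_termI {ω : Fin (n + 1) → ℝ} (p : Fin (n + 1) → Fin (n + 1) → ℚ) (z : ℂ)
    (lam : Fin n → ℂ) (τ : ℂ) {k : boxSet D ω} {c : Sector D ω} (h : negSector D ω k = c) :
    inSector D ω (negSector D ω k) (termI D ω p z lam τ k) = inSector D ω c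
      (z • (nilEval Complex.exp ((pairQ (p (Fin.last n)) k.1 : ℂ) * τ)
        (z⁻¹ • ((∑ i : Fin n, lam i • theta D ω c (p i.castSucc)) +
          τ • theta D ω c (p (Fin.last n)))) *
        ∏ j, hyperFactor (theta D ω c (ratChar (D j))) z (pairZ (D j) k.1))) := by
  subst h
  rfl

theorem inSector_termReg {ω : Fin (n + 1) → ℝ} (p : Fin (n + 1) → Fin (n + 1) → ℚ) (z : ℂ)
    (lam : Fin n → ℂ) (τ : ℂ) {k : boxSet D ω} {c : Sector D ω} (h : negSector D ω k = c) :
    inSector D ω (negSector D ω k) (termReg D ω p e z lam τ k) = inSector D ω c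
      (nilEval (fun w => (Complex.Gamma w)⁻¹)
        (1 + (slope D p e : ℂ) * (pairQ (p (Fin.last n)) k.1 : ℂ))
        (((slope D p e : ℂ) / z) • theta D ω c (p (Fin.last n))) *
      (z • (nilEval Complex.exp ((pairQ (p (Fin.last n)) k.1 : ℂ) * τ)
        (z⁻¹ • ((∑ i : Fin n, lam i • theta D ω c (p i.castSucc)) +
          τ • theta D ω c (p (Fin.last n)))) *
        ∏ j, hyperFactor (theta D ω c (ratChar (D j))) z (pairZ (D j) k.1)))) := by
  subst h
  rfl

theorem prod_hyperFactor_eq_zero {ω : Fin (n + 1) → ℝ} {z : ℂ} {k : boxSet D ω} {c : Sector D ω}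
    (h : negSector D ω k = c) (hk : coeffI D ω z k = 0) :
    ∏ j, hyperFactor (theta D ω c (ratChar (D j))) z (pairZ (D j) k.1) = 0 := by
  subst h
  exact hk

end Shift

/-! ### Residue classes of degrees -/

theorem HasExpansionAlong.sum {V ι : Type*} [AddCommGroup V] [Module ℂ V] {s β : ℝ}
    (A : Finset ι) {G : ι → ℂ → V} {S : ι → ℕ → ℂ → V}
    (h : ∀ i ∈ A, HasExpansionAlong s (G i) (S i) β) :
    HasExpansionAlong s (fun u => ∑ i ∈ A, G i u) (fun M u => ∑ i ∈ A, S i M u) β := by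
  intro M φ
  have h1 := Asymptotics.IsLittleO.sum fun i hi => h i hi M φ
  refine h1.congr_left fun t => ?_
  rw [Finset.sum_apply, ← map_sum, Finset.sum_sub_distrib]

/-- A sector on which the singular ray is avoided; if the ratio is real, it can be taken as wide
as the Laplace transform allows. -/
theorem exists_sector_avoiding {c : ℂ} (hc : c ≠ 0) {E : ℝ} (hE : 0 < E) :
    ∃ δ : ℝ, 0 < δ ∧ δ ≤ min (Real.pi / 2) (Real.pi / E) ∧
      (c.im = 0 → δ = min (Real.pi / 2) (Real.pi / E)) ∧
      ∀ φ : ℝ, 0 < φ → φ < E * δ → (c * Complex.exp (φ * Complex.I)).im ≠ 0 := by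
  have hpi := Real.pi_pos
  have hm : 0 < min (Real.pi / 2) (Real.pi / E) := by positivity
  have hle : ∀ δ ≤ min (Real.pi / 2) (Real.pi / E), E * δ ≤ Real.pi := by
    intro δ hδ
    have := hδ.trans (min_le_right _ _)
    rw [le_div_iff₀ hE] at this
    linarith
  have him : ∀ φ : ℝ, (c * Complex.exp (φ * Complex.I)).im = ‖c‖ * Real.sin (c.arg + φ) := by
    intro φ
    conv_lhs => rw [← Complex.norm_mul_exp_arg_mul_I c, mul_assoc, ← Complex.exp_add, ← add_mul,
      ← Complex.ofReal_add, Complex.im_ofReal_mul, Complex.exp_ofReal_mul_I_im]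
  by_cases h0 : c.im = 0
  · refine ⟨_, hm, le_rfl, fun _ => rfl, fun φ h1 h2 => ?_⟩
    have h3 := Real.sin_pos_of_pos_of_lt_pi h1 (h2.trans_le (hle _ le_rfl))
    have h4 : c.re ≠ 0 := fun h => hc (Complex.ext h h0)
    rw [Complex.mul_im, h0, zero_mul, add_zero, Complex.exp_ofReal_mul_I_im]
    exact mul_ne_zero h4 h3.ne'
  · have hcn := norm_pos_iff.2 hc
    rcases lt_or_gt_of_ne h0 with hneg | hpos
    · have h1 := Complex.arg_neg_iff.2 hneg
      have h1' := Complex.neg_pi_lt_arg c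
      refine ⟨min (min (Real.pi / 2) (Real.pi / E)) (-c.arg / E),
        lt_min hm (div_pos (by linarith) hE), min_le_left _ _, fun h => absurd h h0,
        fun φ h2 h3 => ?_⟩
      have h4 := min_le_right (min (Real.pi / 2) (Real.pi / E)) (-c.arg / E)
      rw [le_div_iff₀ hE] at h4
      rw [him]
      exact mul_ne_zero hcn.ne' (Real.sin_neg_of_neg_of_neg_pi_lt (by linarith) (by linarith)).ne
    · have h1 : 0 < c.arg := by
        refine lt_of_le_of_ne (Complex.arg_nonneg_iff.2 hpos.le) fun h => ?_
        exact h0 (Complex.arg_eq_zero_iff.1 h.symm).2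
      have h1' : c.arg < Real.pi := by
        refine lt_of_le_of_ne (Complex.arg_le_pi c) fun h => ?_
        exact h0 (Complex.arg_eq_pi_iff.1 h).2
      refine ⟨min (min (Real.pi / 2) (Real.pi / E)) ((Real.pi - c.arg) / E),
        lt_min hm (div_pos (by linarith) hE), min_le_left _ _, fun h => absurd h h0,
        fun φ h2 h3 => ?_⟩
      have h4 := min_le_right (min (Real.pi / 2) (Real.pi / E)) ((Real.pi - c.arg) / E)
      rw [le_div_iff₀ hE] at h4
      rw [him]
      exact mul_ne_zero hcn.ne' (Real.sin_pos_of_pos_of_lt_pi (by linarith) (by linarith)).ne'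

section Block

variable {n m : ℕ} {D : Fin m → Fin (n + 1) → ℤ} {ωp ωm : Fin (n + 1) → ℝ}
  {e : Fin (n + 1) → ℤ}

/-- The number of `l ≥ 0` with `d + l T ≤ M`. -/
def blockLength (d T : ℚ) (M : ℕ) : ℕ := (⌊((M : ℚ) - d) / T⌋ + 1).toNat

theorem lt_blockLength_iff {d T : ℚ} (hT : 0 < T) (M l : ℕ) :
    l < blockLength d T M ↔ d + l * T ≤ M := by
  rw [blockLength, Int.lt_toNat, Int.lt_add_one_iff, Int.le_floor, le_div_iff₀ hT]
  push_cast
  constructor <;> intro h <;> linarith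

theorem IsLaplace.inSector {ω : Fin (n + 1) → ℝ} {c : Sector D ω} {δ : ℝ}
    {F G : ℂ → SectorCoh D ω c} (h : IsLaplace δ F G) :
    IsLaplace δ (fun x => ToricWall.inSector D ω c (F x))
      (fun u => ToricWall.inSector D ω c (G u)) :=
  fun u α h1 h2 h3 h4 φ => h u α h1 h2 h3 h4 (φ ∘ₗ ToricWall.inSector D ω c)

/-- The part of the regularized series over the degrees `k - l e`, `l ≥ 0`, where `p_r · k` is
the smallest nonnegative value in its residue class. -/
theorem exists_residueClass_function (hW : IsWallCrossing D ωp ωm e)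
    (p : Module.Basis (Fin (n + 1)) ℤ (dualLattice D ωm))
    (hp : (fun a => (((p (Fin.last n)).1 a : ℚ) : ℝ)) ∈ closure (chamber D ωm))
    (hpW : ∀ i : Fin n, (fun a => (((p i.castSucc).1 a : ℚ) : ℝ)) ∈ hyperplane e)
    {z : ℂ} (hz : z ≠ 0) (lam : Fin n → ℂ) {k : boxSet D ωm}
    (hk0 : 0 ≤ pairQ (p (Fin.last n)).1 k.1)
    (hkT : pairQ (p (Fin.last n)).1 k.1 < -pairQ (p (Fin.last n)).1 (ratChar e))
    {δ : ℝ} (hδ0 : 0 < δ) (hδ : δ ≤ Real.pi / 2)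
    (hc : ∀ φ : ℝ, 0 < φ → φ < (degSum D e).toNat * δ →
      (leadRatio (fun j => ∑ i, D j i * e i) (degSum D e).toNat z *
        Complex.exp (φ * Complex.I)).im ≠ 0) :
    ∃ F G : ℂ → ChenRuan D ωm,
      (∀ φ : ChenRuan D ωm →ₗ[ℂ] ℂ, AnalyticOnNhd ℂ (fun x => φ (F x)) (sector δ)) ∧
      (∃ R : ℝ, 0 < R ∧ ∀ x ∈ sector δ, ‖x‖ < R → ∀ φ : ChenRuan D ωm →ₗ[ℂ] ℂ,
        HasSum (fun l : ℕ => φ (inSector D ωm (negSector D ωm (shiftBox D ωm e k l))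
          (termReg D ωm (fun i => (p i).1) e z lam
            ((slope D (fun i => (p i).1) e : ℂ) * Complex.log x) (shiftBox D ωm e k l))))
          (φ (F x))) ∧
      IsLaplace δ F G ∧
      ∀ β : ℝ, |β| < Real.pi / 2 → HasExpansionAlong (slope D (fun i => (p i).1) e : ℝ) G
        (fun M u => ∑ l ∈ Finset.range (blockLength (pairQ (p (Fin.last n)).1 k.1)
            (-pairQ (p (Fin.last n)).1 (ratChar e)) M),
          inSector D ωm (negSector D ωm (shiftBox D ωm e k l))
            (termI D ωm (fun i => (p i).1) z lam
              (-(slope D (fun i => (p i).1) e : ℂ) * Complex.log u) (shiftBox D ωm e k l))) β := by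
  have hpe := pairQ_last_neg hW p hp hpW
  have hω := hW.stab_minus.maximal
  have hdeg := hW.degSum_pos
  set P : Fin (n + 1) → Fin (n + 1) → ℚ := fun i => (p i).1 with hP
  set pe := pairQ (p (Fin.last n)).1 (ratChar e) with hpedef
  set d := pairQ (p (Fin.last n)).1 k.1 with hd
  set s := slope D P e with hs
  have hsT : s * -pe = degSum D e := by
    rw [hs, slope, mul_neg, neg_div, neg_mul, neg_neg]
    exact div_mul_cancel₀ _ hpe.ne
  have hs0 : 0 < s := by
    have h1 : (0 : ℚ) < s * -pe := by rw [hsT]; exact_mod_cast hdeg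
    exact pos_of_mul_pos_left h1 (by linarith)
  set E := (degSum D e).toNat with hE
  have hEZ : (E : ℤ) = degSum D e := Int.toNat_of_nonneg hdeg.le
  have hE0 : 0 < E := by exact_mod_cast hEZ ▸ hdeg
  have hEQ : s * -pe = E := by rw [hsT, ← hEZ]; simp
  have hER : (s : ℝ) * -(pe : ℝ) = E := by exact_mod_cast hEQ
  set c := negSector D ωm k with hcdef
  have hfin := finite_sectorCoh hω c
  set u : Fin m → SectorCoh D ωm c := fun j => theta D ωm c (ratChar (D j)) with hu
  set q : Fin m → ℚ := fun j => pairZ (D j) k.1 with hq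
  set ej : Fin m → ℤ := fun j => ∑ i, D j i * e i with hej
  set σ : ℝ := (s : ℝ) * (d : ℝ) with hσ
  set a : SectorCoh D ωm c := ((s : ℂ) / z) • theta D ωm c (p (Fin.last n)).1 with ha
  set b : SectorCoh D ωm c := z⁻¹ • ∑ i : Fin n, lam i • theta D ωm c (p i.castSucc).1 with hb
  have hσ0 : 0 ≤ σ := mul_nonneg (by exact_mod_cast hs0.le) (by exact_mod_cast hk0)
  have han : IsNilpotent a := (isNilpotent_theta hω c _).smul _
  have hbn : IsNilpotent b := by
    refine IsNilpotent.smul ?_ _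
    exact isNilpotent_sum fun i _ => (isNilpotent_theta hω c _).smul _
  have hdl : ∀ l : ℤ, pairQ (P (Fin.last n)) (shiftBox D ωm e k l).1 = d + l * -pe := by
    intro l
    rw [shiftBox, pairQ_sub_smul]
    ring
  have hprod : ∀ l : ℤ, ∏ j, hyperFactor (theta D ωm c (ratChar (D j))) z
      (pairZ (D j) (shiftBox D ωm e k l).1) = hyperProd u z q ej l := by
    intro l
    refine Finset.prod_congr rfl fun j _ => ?_
    rw [shiftBox, pairZ_sub_smul]
  have hvan : hyperProd u z q ej (-1) = 0 := by
    rw [← hprod]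
    refine prod_hyperFactor_eq_zero (negSector_shiftBox ωm k (-1)) ?_
    by_contra hne
    have h1 := pairQ_nonneg_of_coeffI_ne_zero hne hp
    have h2 := hdl (-1)
    rw [h2] at h1
    push_cast at h1
    linarith
  have hσl : ∀ l : ℕ, (s : ℂ) * ((d + ((l : ℤ) : ℚ) * -pe : ℚ) : ℂ) = σ + l * E := by
    intro l
    have h1 : (s : ℂ) * -(pe : ℂ) = E := by exact_mod_cast hEQ
    rw [hσ]
    push_cast
    rw [mul_add, mul_left_comm, h1]
  have harg : ∀ ξ : ℂ, z⁻¹ • ((∑ i : Fin n, lam i • theta D ωm c (P i.castSucc)) +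
      ((s : ℂ) * ξ) • theta D ωm c (P (Fin.last n))) = b + ξ • a := by
    intro ξ
    rw [smul_add, hb, ha, smul_smul, smul_smul]
    congr 2
    rw [div_eq_mul_inv]
    ring
  have hterm : ∀ (l : ℕ) (ξ : ℂ), inSector D ωm (negSector D ωm (shiftBox D ωm e k l))
      (termI D ωm P z lam ((s : ℂ) * ξ) (shiftBox D ωm e k l)) =
      inSector D ωm c (expTerm u z q ej E σ a b l ξ) := by
    intro l ξ
    rw [inSector_termI P z lam _ (negSector_shiftBox ωm k l), hprod, hdl, harg, expTerm,
      ← mul_assoc, mul_comm _ (s : ℂ), hσl]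
  have hreg : ∀ (l : ℕ) (ξ : ℂ), inSector D ωm (negSector D ωm (shiftBox D ωm e k l))
      (termReg D ωm P e z lam ((s : ℂ) * ξ) (shiftBox D ωm e k l)) =
      inSector D ωm c (regTerm u z q ej E σ a b l ξ) := by
    intro l ξ
    rw [inSector_termReg P z lam _ (negSector_shiftBox ωm k l), hprod, hdl, harg, regTerm, expTerm,
      ← mul_assoc _ (s : ℂ), mul_comm _ (s : ℂ), hσl]
  obtain ⟨hL, F, G, hFa, ⟨R, hR, hFs⟩, hG, hbd⟩ := exists_sectorFunction
    (u := u) (fun j => isNilpotent_theta hω c _) hz q ej hE0 (by rw [hEZ]; rfl) hσ0 han hbn hvan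
    hδ0 hδ hc
  have hGi : IsLaplace δ (fun x => inSector D ωm c (F x)) fun w => inSector D ωm c (G w) := by
    exact hG.inSector
  refine ⟨fun x => inSector D ωm c (F x), fun w => inSector D ωm c (G w),
    fun φ => hFa (φ ∘ₗ inSector D ωm c), ⟨R, hR, fun x hx hxR φ => ?_⟩,
    hGi, fun β hβ => ?_⟩
  · simp only [hreg]
    exact hFs x hx hxR (φ ∘ₗ inSector D ωm c)
  · have hS : (fun (M : ℕ) (w : ℂ) => ∑ l ∈ Finset.range (blockLength d (-pe) M),
        inSector D ωm (negSector D ωm (shiftBox D ωm e k l))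
          (termI D ωm P z lam (-(s : ℂ) * Complex.log w) (shiftBox D ωm e k l))) =
        fun M w => ∑ l ∈ Finset.range (blockLength d (-pe) M),
          inSector D ωm c (expTerm u z q ej E σ a b l (-Complex.log w)) := by
      ext1 M
      ext1 w
      refine Finset.sum_congr rfl fun l _ => ?_
      rw [neg_mul_comm, hterm]
    rw [hS]
    refine hasExpansionAlong_of_isLaplace hδ0 hδ (by exact_mod_cast hs0) hGi
      (fun M => IsLaplace.sum _ fun l _ => (hL l).inSector)
      (fun M α φ h1 h2 => ?_) hβ
    -- the first omitted exponent exceeds `s M`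
    set L := blockLength d (-pe) M with hLdef
    have hM : (s : ℝ) * M < σ + L * E := by
      have h3 : (M : ℚ) < d + L * -pe :=
        not_le.1 fun h => lt_irrefl L ((lt_blockLength_iff (by linarith) M L).2 h)
      have h4 : (M : ℝ) < d + L * -pe := by exact_mod_cast h3
      have h5 : (0 : ℝ) < s := by exact_mod_cast hs0
      have h6 := mul_lt_mul_of_pos_left h4 h5
      rw [← hER, hσ]
      linarith
    obtain ⟨C, K, -, hK, hCK⟩ := hbd L α (φ ∘ₗ inSector D ωm c)
      ((σ + L * E - s * M) / 2) h1 h2 (by linarith)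
    refine ⟨C, σ + L * E - (σ + L * E - s * M) / 2, K, ?_, ?_, fun t ht => ?_⟩
    · linarith
    · linarith
    · have := hCK t ht
      rw [LinearMap.comp_apply, map_sub, map_sum] at this
      exact this

end Block

/-! ### Decomposition of a fiber into residue classes -/

theorem hasSum_prod_of_finite {ι : Type*} [Fintype ι] {f : ι × ℕ → ℂ} {a : ι → ℂ}
    (h : ∀ i, HasSum (fun l => f (i, l)) (a i)) : HasSum f (∑ i, a i) := by
  classical
  have h1 : ∀ i ∈ (Finset.univ : Finset ι),
      HasSum (fun x : ι × ℕ => if x.1 = i then f x else 0) (a i) := by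
    intro i _
    have hinj : Function.Injective fun l : ℕ => (i, l) := fun _ _ h => (Prod.mk.inj h).2
    refine (hinj.hasSum_iff ?_).1 ?_
    · rintro ⟨j, l⟩ hj
      refine if_neg fun h : j = i => hj ⟨l, by rw [h]⟩
    · have h2 : ((fun x : ι × ℕ => if x.1 = i then f x else 0) ∘ fun l : ℕ => (i, l)) =
          fun l => f (i, l) := by
        ext l
        exact if_pos rfl
      rw [h2]
      exact h i
  have h2 := hasSum_sum h1
  have h3 : (fun x : ι × ℕ => ∑ i, if x.1 = i then f x else 0) = f := by
    ext x
    simp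
  rwa [h3] at h2

section Fiber

variable {n m : ℕ} {D : Fin m → Fin (n + 1) → ℤ} {ωp ωm : Fin (n + 1) → ℝ}
  {e : Fin (n + 1) → ℤ}

/-- The representatives, modulo translation by `e`, of the degrees in a fiber: those with
`0 ≤ p_r · k < -p_r · e`. -/
def fiberBase (D : Fin m → Fin (n + 1) → ℤ) (ω : Fin (n + 1) → ℝ)
    (p : Fin (n + 1) → Fin (n + 1) → ℚ) (e : Fin (n + 1) → ℤ) (N : Fin n → ℤ) :
    Set (boxSet D ω) :=
  {k | k ∈ fiber D ω p N ∧ 0 ≤ pairQ (p (Fin.last n)) k.1 ∧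
    pairQ (p (Fin.last n)) k.1 < -pairQ (p (Fin.last n)) (ratChar e)}

theorem finite_fiberBase (p : Module.Basis (Fin (n + 1)) ℤ (dualLattice D ωm)) (N : Fin n → ℤ) :
    (fiberBase D ωm (fun i => (p i).1) e N).Finite := by
  refine (finite_fiberLE_nonneg p N ⌈-pairQ (p (Fin.last n)).1 (ratChar e)⌉₊).subset ?_
  rintro k ⟨h1, h2, h3⟩
  exact ⟨⟨h1, h3.le.trans (Nat.le_ceil _)⟩, h2⟩

theorem pairQ_last_shiftBox {ω : Fin (n + 1) → ℝ} (q : Fin (n + 1) → ℚ) (k : boxSet D ω) (l : ℤ) :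
    pairQ q (shiftBox D ω e k l).1 = pairQ q k.1 + l * -pairQ q (ratChar e) := by
  rw [shiftBox, pairQ_sub_smul]
  ring

theorem shiftBox_mem_fiber {ω : Fin (n + 1) → ℝ} {p : Fin (n + 1) → Fin (n + 1) → ℚ}
    (hpW : ∀ i : Fin n, (fun a => (p i.castSucc a : ℝ)) ∈ hyperplane e) {N : Fin n → ℤ}
    {k : boxSet D ω} (hk : k ∈ fiber D ω p N) (l : ℤ) : shiftBox D ω e k l ∈ fiber D ω p N :=
  fun i => (pairQ_shiftBox_castSucc (hpW i) k l).trans (hk i)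

theorem shiftBox_injective (p : Module.Basis (Fin (n + 1)) ℤ (dualLattice D ωm))
    (hpe : pairQ (p (Fin.last n)).1 (ratChar e) < 0) {N : Fin n → ℤ}
    {k k' : boxSet D ωm} (hk : k ∈ fiberBase D ωm (fun i => (p i).1) e N)
    (hk' : k' ∈ fiberBase D ωm (fun i => (p i).1) e N) {l l' : ℕ}
    (h : shiftBox D ωm e k l = shiftBox D ωm e k' l') : k = k' ∧ l = l' := by
  have hd := congrArg (fun k => pairQ (p (Fin.last n)).1 (Subtype.val k)) h
  obtain ⟨h1, h2, h3⟩ := hk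
  obtain ⟨h1', h2', h3'⟩ := hk'
  beta_reduce at hd h2 h3 h2' h3'
  rw [pairQ_last_shiftBox, pairQ_last_shiftBox] at hd
  push_cast at hd
  have hl : l = l' := by
    by_contra hne
    rcases lt_or_gt_of_ne hne with hlt | hlt
    · have h4 : (l : ℚ) + 1 ≤ l' := by exact_mod_cast hlt
      nlinarith
    · have h4 : (l' : ℚ) + 1 ≤ l := by exact_mod_cast hlt
      nlinarith
  refine ⟨Subtype.ext (eq_of_forall_pairQ_eq p fun i => ?_), hl⟩
  refine Fin.lastCases ?_ (fun i => ?_) i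
  · rw [hl] at hd
    linarith
  · exact (h1 i).trans (h1' i).symm

/-- Division with remainder of `p_r · k` by `-p_r · e`. -/
theorem exists_shiftBox_eq {p : Fin (n + 1) → Fin (n + 1) → ℚ}
    (hpW : ∀ i : Fin n, (fun a => (p i.castSucc a : ℝ)) ∈ hyperplane e)
    (hpe : pairQ (p (Fin.last n)) (ratChar e) < 0) {N : Fin n → ℤ}
    {k : boxSet D ωm} (hk : k ∈ fiber D ωm p N) (hk0 : 0 ≤ pairQ (p (Fin.last n)) k.1) :
    ∃ k' ∈ fiberBase D ωm p e N, ∃ l : ℕ, shiftBox D ωm e k' l = k := by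
  have hT : 0 < -pairQ (p (Fin.last n)) (ratChar e) := by linarith
  set T := -pairQ (p (Fin.last n)) (ratChar e) with hTdef
  set d := pairQ (p (Fin.last n)) k.1 with hd
  have hfl := Nat.floor_le (div_nonneg hk0 hT.le)
  have hfl' := Nat.lt_floor_add_one (d / T)
  rw [le_div_iff₀ hT] at hfl
  rw [div_lt_iff₀ hT] at hfl'
  refine ⟨shiftBox D ωm e k (-(⌊d / T⌋₊ : ℤ)), ⟨shiftBox_mem_fiber hpW hk _, ?_, ?_⟩,
    ⌊d / T⌋₊, ?_⟩
  · rw [pairQ_last_shiftBox, ← hTdef, ← hd]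
    push_cast
    linarith
  · rw [pairQ_last_shiftBox, ← hTdef, ← hd]
    push_cast
    linarith
  · refine Subtype.ext ?_
    simp only [shiftBox]
    push_cast
    rw [neg_smul, sub_neg_eq_add, add_sub_cancel_right]

theorem partialI_eq_sum (p : Module.Basis (Fin (n + 1)) ℤ (dualLattice D ωm))
    (hp : (fun a => (((p (Fin.last n)).1 a : ℚ) : ℝ)) ∈ closure (chamber D ωm))
    (hpW : ∀ i : Fin n, (fun a => (((p i.castSucc).1 a : ℚ) : ℝ)) ∈ hyperplane e)
    (hpe : pairQ (p (Fin.last n)).1 (ratChar e) < 0) (z : ℂ) (N : Fin n → ℤ) (lam : Fin n → ℂ)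
    [Fintype (fiberBase D ωm (fun i => (p i).1) e N)] (M : ℕ) (τ : ℂ) :
    partialI D ωm (fun i => (p i).1) z N lam M τ =
      ∑ k : fiberBase D ωm (fun i => (p i).1) e N,
        ∑ l ∈ Finset.range (blockLength (pairQ (p (Fin.last n)).1 k.1.1)
            (-pairQ (p (Fin.last n)).1 (ratChar e)) M),
          inSector D ωm (negSector D ωm (shiftBox D ωm e k.1 l))
            (termI D ωm (fun i => (p i).1) z lam τ (shiftBox D ωm e k.1 l)) := by
  classical
  set g : boxSet D ωm → ChenRuan D ωm := fun k =>
    inSector D ωm (negSector D ωm k) (termI D ωm (fun i => (p i).1) z lam τ k) with hg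
  set S : Finset (Σ _ : fiberBase D ωm (fun i => (p i).1) e N, ℕ) := Finset.univ.sigma fun k =>
    Finset.range (blockLength (pairQ (p (Fin.last n)).1 k.1.1)
      (-pairQ (p (Fin.last n)).1 (ratChar e)) M) with hS
  have hT : 0 < -pairQ (p (Fin.last n)).1 (ratChar e) := by linarith
  have hsum : ∑ᶠ k ∈ fiberLE D ωm (fun i => (p i).1) N M, g k =
      ∑ k ∈ S.image (fun x => shiftBox D ωm e x.1.1 x.2), g k := by
    refine finsum_mem_eq_sum_of_inter_support_eq g ?_
    ext k
    simp only [Set.mem_inter_iff, Finset.coe_image, Set.mem_image, and_congr_left_iff]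
    intro hk
    constructor
    · rintro ⟨h1, h2⟩
      have hc : coeffI D ωm z k ≠ 0 := by
        intro h0
        refine hk ?_
        simp [hg, termI, h0]
      obtain ⟨k', hk', l, rfl⟩ := exists_shiftBox_eq (p := fun i => (p i).1) hpW hpe h1
        (pairQ_nonneg_of_coeffI_ne_zero hc hp)
      refine ⟨⟨⟨k', hk'⟩, l⟩, ?_, rfl⟩
      simp only [hS, Finset.mem_coe, Finset.mem_sigma, Finset.mem_univ, true_and,
        Finset.mem_range]
      rw [lt_blockLength_iff hT]
      rw [pairQ_last_shiftBox] at h2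
      exact_mod_cast h2
    · rintro ⟨⟨⟨k', hk'⟩, l⟩, hx, rfl⟩
      simp only [hS, Finset.mem_coe, Finset.mem_sigma, Finset.mem_univ, true_and,
        Finset.mem_range] at hx
      rw [lt_blockLength_iff hT] at hx
      refine ⟨shiftBox_mem_fiber (p := fun i => (p i).1) hpW hk'.1 l, ?_⟩
      rw [pairQ_last_shiftBox]
      exact_mod_cast hx
  rw [partialI, hsum, Finset.sum_image, hS, Finset.sum_sigma]
  rintro ⟨⟨k, hk⟩, l⟩ - ⟨⟨k', hk'⟩, l'⟩ - h
  obtain ⟨rfl, rfl⟩ := shiftBox_injective p hpe hk hk' h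
  rfl

/-- A series over a fiber is summed class by class, the degrees with `p_r · k < 0` contributing
nothing. -/
theorem hasSum_fiber (p : Module.Basis (Fin (n + 1)) ℤ (dualLattice D ωm))
    (hp : (fun a => (((p (Fin.last n)).1 a : ℚ) : ℝ)) ∈ closure (chamber D ωm))
    (hpW : ∀ i : Fin n, (fun a => (((p i.castSucc).1 a : ℚ) : ℝ)) ∈ hyperplane e)
    (hpe : pairQ (p (Fin.last n)).1 (ratChar e) < 0) {z : ℂ} {N : Fin n → ℤ}
    [Fintype (fiberBase D ωm (fun i => (p i).1) e N)] {f : boxSet D ωm → ℂ}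
    (hf : ∀ k, coeffI D ωm z k = 0 → f k = 0)
    {a : fiberBase D ωm (fun i => (p i).1) e N → ℂ}
    (h : ∀ k : fiberBase D ωm (fun i => (p i).1) e N,
      HasSum (fun l : ℕ => f (shiftBox D ωm e k.1 l)) (a k)) :
    HasSum (fun k : fiber D ωm (fun i => (p i).1) N => f k.1) (∑ k, a k) := by
  let ψ : fiberBase D ωm (fun i => (p i).1) e N × ℕ → fiber D ωm (fun i => (p i).1) N := fun x =>
    ⟨shiftBox D ωm e x.1.1 x.2, shiftBox_mem_fiber (p := fun i => (p i).1) hpW x.1.2.1 x.2⟩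
  have hψ : Function.Injective ψ := by
    rintro ⟨⟨k, hk⟩, l⟩ ⟨⟨k', hk'⟩, l'⟩ h
    obtain ⟨rfl, rfl⟩ := shiftBox_injective p hpe hk hk' (congrArg Subtype.val h)
    rfl
  refine (hψ.hasSum_iff ?_).1 (hasSum_prod_of_finite h)
  rintro ⟨k, hk⟩ hr
  refine hf k (by_contra fun hc => hr ?_)
  obtain ⟨k', hk', l, rfl⟩ := exists_shiftBox_eq (p := fun i => (p i).1) hpW hpe hk
    (pairQ_nonneg_of_coeffI_ne_zero hc hp)
  exact ⟨⟨⟨k', hk'⟩, l⟩, rfl⟩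

end Fiber

end ToricWall

end

open ToricWall Filter Topology
theorem proposition4p4 {n m : ℕ} (D : Fin m → Fin (n + 1) → ℤ) (ωp ωm : Fin (n + 1) → ℝ)
    (e : Fin (n + 1) → ℤ) (hW : ToricWall.IsWallCrossing D ωp ωm e)
    (p : Module.Basis (Fin (n + 1)) ℤ (ToricWall.dualLattice D ωm))
    (hp : ∀ i, (fun a => (((p i).1 a : ℚ) : ℝ)) ∈ closure (ToricWall.chamber D ωm))
    (hpW : ∀ i : Fin n,
      (fun a => (((p i.castSucc).1 a : ℚ) : ℝ)) ∈ ToricWall.hyperplane e)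
    (z : ℂ) (hz : z ≠ 0) :
    ∃ δ : ℝ, 0 < δ ∧ δ ≤ min (Real.pi / 2) (Real.pi / ToricWall.degSum D e) ∧
      (0 < z.re → z.im = 0 → δ = min (Real.pi / 2) (Real.pi / ToricWall.degSum D e)) ∧
      ∀ (N : Fin n → ℤ) (lam : Fin n → ℂ),
        (∀ M : ℕ, {k | k ∈ ToricWall.fiberLE D ωm (fun i => (p i).1) N M ∧
          ToricWall.coeffI D ωm z k ≠ 0}.Finite) ∧
        ∃ F G : ℂ → ToricWall.ChenRuan D ωm,
          ToricWall.IsRegularized D ωm (fun i => (p i).1) e z N lam δ F ∧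
          ToricWall.IsLaplace δ F G ∧
          ∀ β : ℝ, |β| < Real.pi / 2 →
            ToricWall.HasExpansionAlong (ToricWall.slope D (fun i => (p i).1) e : ℝ) G
              (fun M u => ToricWall.partialI D ωm (fun i => (p i).1) z N lam M
                (-(ToricWall.slope D (fun i => (p i).1) e : ℂ) * Complex.log u)) β := by
  have hdeg := hW.degSum_pos
  have hE : 0 < (degSum D e).toNat := by omega
  have hER : (((degSum D e).toNat : ℕ) : ℝ) = (degSum D e : ℝ) := by
    exact_mod_cast Int.toNat_of_nonneg hdeg.le
  have hpl := hp (Fin.last n)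
  have hpe := pairQ_last_neg hW p hpl hpW
  obtain ⟨δ, hδ0, hδ, hδz, hc⟩ := exists_sector_avoiding
    (leadRatio_ne_zero (fun j => ∑ i, D j i * e i) hE hz)
    (E := (degSum D e : ℝ)) (by exact_mod_cast hdeg)
  rw [← hER] at hc
  refine ⟨δ, hδ0, hδ, fun _ hz0 => hδz (leadRatio_im _ _ hz0), fun N lam =>
    ⟨finite_fiberLE_coeffI_ne_zero p hpl z N, ?_⟩⟩
  have := (finite_fiberBase (e := e) p N).fintype
  have hblock := fun k : fiberBase D ωm (fun i => (p i).1) e N =>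
    exists_residueClass_function hW p hpl hpW hz lam k.2.2.1 k.2.2.2 hδ0
      (hδ.trans (min_le_left _ _)) hc
  choose F G hFa hFs hG hexp using hblock
  choose R hR hFs using hFs
  refine ⟨fun x => ∑ k, F k x, fun u => ∑ k, G k u, ⟨fun φ => ?_, ?_⟩,
    IsLaplace.sum _ fun k _ => hG k, fun β hβ => ?_⟩
  · simp only [map_sum]
    exact Finset.analyticOnNhd_fun_sum _ fun k _ => hFa k φ
  · have hev : ∀ᶠ r in 𝓝[>] (0 : ℝ), ∀ k, r < R k :=
      eventually_all.2 fun k => mem_of_superset (Ioo_mem_nhdsGT (hR k)) fun r hr => hr.2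
    obtain ⟨r, hr, hr0⟩ := (hev.and self_mem_nhdsWithin).exists
    refine ⟨r, hr0, fun x hx hxr φ => ?_⟩
    rw [map_sum]
    refine hasSum_fiber p hpl hpW hpe (z := z) (f := fun k => φ (inSector D ωm (negSector D ωm k)
      (termReg D ωm (fun i => (p i).1) e z lam
        ((slope D (fun i => (p i).1) e : ℂ) * Complex.log x) k))) (fun k hk => ?_)
      fun k => hFs k x hx (hxr.trans (hr k)) φ
    simp [termReg, termI, hk]
  · simp only [partialI_eq_sum p hpl hpW hpe]
    exact HasExpansionAlong.sum _ fun k _ => hexp k β hβ
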